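/- **Setting.** Let $L,\nu>0$, $\Omega=[0,L]^3$ with periodic boundary conditions and $\lambda_1=4\pi^2/L^2$. For $s\ge 0$ let $\dot V_s$ be the space of real, mean-free, divergence-free fields $u=\sum_{K\in\mathbb Z^3\setminus\{0\}}\hat u_K e^{2\pi iK\cdot x/L}$ with $\sum_K|K|^{2s}|\hat u_K|^2<\infty$; put $H=\dot V_0$, $V=\dot V_1$, $D(A)=\dot V_2$, $A=-\Delta$. Let $\mathcal P$ be the Helmholtz–Leray projection (which also removes the mean), $\tilde B(u,v)=-\mathcal P(u\times(\nabla\times v))$, and let $\|\cdot\|$ be the norm of $L^2(\Omega)$. Let $f\in L^\infty(0,\infty;H)$, let $\sup_{s\ge0}\|f(s)\|^2$ denote the essential supremum, and let $\alpha,\beta,h,c_1,c_2>0$ and $\eta\in\mathbb R$. Let $I_h$ be a linear operator from $D(A)$ to $L^2(\Omega)^3$ with $$\|I_h\varphi-\varphi\|^2\le c_1h^2\|\nabla\varphi\|^2+c_2h^4\|\Delta\varphi\|^2\qquad(\varphi\in D(A)).$$ Let $u$ be a solution of the Navier–Stokes-$\alpha$ system $$\frac{dv}{dt}+\nu Av+\tilde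 B(u,v)=f,\qquad v=u+\alpha^2Au,\qquad u(0)=u_0\in V,$$ and $w$ a solution of the nudged system with guessed parameter $\beta$ $$\frac{dz}{dt}+\nu Az+\tilde B(w,z)=f-\eta(I+\beta^2A)\mathcal P(I_hw-I_hu),\qquad z=w+\beta^2Aw,\qquad w(0)=w_0\in V.$$ Solutions are global: $u,w\in C([0,\infty);V)$, and for every $T>0$, $u,w\in L^2(0,T;D(A))$, $\frac{du}{dt},\frac{dw}{dt}\in L^2(0,T;H)$; the equations hold for a.e. $t$ in the dual of $D(A)$. Put $$M_1=\|u_0\|^2+\alpha^2\|\nabla u_0\|^2+\frac1{\lambda_1^2\nu^2}\sup_{s\ge0}\|f(s)\|^2 .$$ **Theorem.** There is a dimensionless absolute constant $c>0$ (independent of all the data above, including $L$), for which the inequalities $$\|g\|_{L^3}\le c\|g\|^{1/2}\|\nabla g\|^{1/2},\qquad \|g\|_{L^4}\le c\|g\|^{1/4}\|\nabla g\|^{3/4},\qquad \|g\|_{L^6}\le c\|\nabla g\|\qquad(g\in V)$$ hold, and such that the following is true for all data as above. If 1. $\displaystyle \eta>\frac{576c^8M_1^2}{\alpha^4\nu^3}$,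 2. $\displaystyle \eta c_1h^2+\frac{\eta^2c_1\beta^2h^2}{\nu}+\frac{432c^8\beta^2M_1^2}{\nu^3\alpha^4}-\eta\beta^2<\frac{11\nu}{16}$, 3. $\displaystyle \eta c_2h^4+\frac{\eta^2\beta^2c_2h^4}{\nu}<\frac{\nu}{4}\beta^2$, then $g=w-u$ satisfies, for all $t\ge0$, $$\|g(t)\|^2+\beta^2\|\nabla g(t)\|^2\le e^{-\frac{\lambda_1\nu}{2}t}\left(\|g(0)\|^2+\beta^2\|\nabla g(0)\|^2\right)+\frac{2e}{e^{1/2}-1}\cdot\frac{|\beta^2-\alpha^2|^2}{\beta^2}M_3,$$ where, with $S=\sup_{s\ge0}\|f(s)\|^2$ and $Q=\frac{M_1}{\nu}+\frac{S}{\nu^3\lambda_1^2}$, $$M_3=\frac4\nu\left[\frac6{\alpha^2}\left(\nu^2+\frac{c^4M_1}{\lambda_1^{1/2}\alpha^2}\right)Q+\frac{3c^4M_1^2}{\alpha^6\nu\lambda_1^{3/2}}+\frac{3S}{\nu\lambda_1}\right]+\frac{4\nu}{\alpha^2}Q+\frac{2c^4M_1}{\nu\alpha^4\lambda_1^{1/2}}Q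 .$$ -/

import Mathlib

open MeasureTheory Filter Topology

namespace NSAlpha

noncomputable section

/-! ### Periodic vector fields on `Ω = [0, L]³` through their Fourier coefficients -/

/-- Wave vectors `K ∈ ℤ³`. -/
abbrev Mode := Fin 3 → ℤ

/-- The family of Fourier coefficients `û_K ∈ ℂ³` of a (generalized) vector field
`u(x) = ∑_K û_K exp (2πi K·x / L)` on the periodic box. -/
abbrev FourierField := Mode → Fin 3 → ℂ

/-- `|K|²`. -/
def modeSq (K : Mode) : ℝ := ∑ i, (K i : ℝ) ^ 2

/-- The wave vector `K`, as an element of `ℂ³`. -/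
def modeVec (K : Mode) : Fin 3 → ℂ := fun i => (K i : ℂ)

/-- `|a|²` for `a ∈ ℂ³`. -/
def vecSq (a : Fin 3 → ℂ) : ℝ := ∑ i, ‖a i‖ ^ 2

/-- `4π²|K|²/L² = (2π|K|/L)²`, the eigenvalue of `A = -Δ` on the mode `K`. -/
def waveSq (L : ℝ) (K : Mode) : ℝ := (2 * Real.pi / L) ^ 2 * modeSq K

/-- `λ₁ = 4π²/L²`. -/
def lambda1 (L : ℝ) : ℝ := 4 * Real.pi ^ 2 / L ^ 2

/-- The field is real valued: `û_{-K}` is the complex conjugate of `û_K`. -/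
def IsReal (u : FourierField) : Prop :=
  ∀ K i, u (-K) i = (starRingEnd ℂ) (u K i)

/-- Real square-integrable periodic vector fields, `L²(Ω)³`
(mean and divergence are arbitrary). -/
structure MemL2 (u : FourierField) : Prop where
  real : IsReal u
  summable : Summable fun K => vecSq (u K)

/-- The space `V̇_s` of real, mean-free, divergence-free fields with
`∑_K |K|^{2s} |û_K|² < ∞`. Here `H = V̇_0`, `V = V̇_1` and `D(A) = V̇_2`. -/
structure MemVdot (s : ℕ) (u : FourierField) : Prop where
  zero : u 0 = 0
  real : IsReal u
  div_free : ∀ K, ∑ i, (K i : ℂ) * u K i = 0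
  summable : Summable fun K => modeSq K ^ s * vecSq (u K)

/-- The squared norm `L³ ∑_K (2π|K|/L)^{2s} |û_K|²`. For `s = 0, 1, 2` this is
`‖u‖²`, `‖∇u‖²`, `‖Au‖²`, with `‖·‖` the norm of `L²(Ω)`. -/
def sobSq (L : ℝ) (s : ℕ) (u : FourierField) : ℝ :=
  L ^ 3 * ∑' K, waveSq L K ^ s * vecSq (u K)

/-! ### The operators -/

/-- `A = -Δ`. -/
def stokesA (L : ℝ) (u : FourierField) : FourierField :=
  fun K => (waveSq L K : ℂ) • u K

/-- `(I + a² A) u`. -/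
def helmholtz (L a : ℝ) (u : FourierField) : FourierField :=
  u + ((a : ℂ) ^ 2) • stokesA L u

/-- The Helmholtz-Leray projection `𝒫`: `û_K - K (û_K·K)/|K|²` for `K ≠ 0`;
the mean is removed. -/
def leray (u : FourierField) : FourierField := fun K =>
  if K = 0 then 0
  else u K - ((∑ j, u K j * (K j : ℂ)) / (modeSq K : ℂ)) • modeVec K

/-- `∇ × u`. -/
def curl (L : ℝ) (u : FourierField) : FourierField := fun K =>
  (2 * Real.pi * Complex.I / L : ℂ) • crossProduct (modeVec K) (u K)

/-- The pointwise vector product `u × v`, whose Fourier coefficients are the convolutions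
`∑_J û_J × v̂_{K-J}`. -/
def cross (u v : FourierField) : FourierField := fun K =>
  ∑' J, crossProduct (u J) (v (K - J))

/-- `B̃(u, v) = -𝒫 (u × (∇ × v))`. For `u ∈ V` and `v ∈ H` every coefficient is an absolutely
convergent series, because `|K - J| ≤ |K| + |J|`; this is the extension of `B̃` to `V × H`
with values in the dual of `D(A)`. -/
def Btilde (L : ℝ) (u v : FourierField) : FourierField :=
  -leray (cross u (curl L v))

/-! ### Spaces of time-dependent fields on `[0, ∞)` -/

/-- `u ∈ C([0, ∞); V)`. -/
structure ContV (L : ℝ) (u : ℝ → FourierField) : Prop where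
  mem : ∀ t, 0 ≤ t → MemVdot 1 (u t)
  tendsto : ∀ t₀, 0 ≤ t₀ →
    Tendsto (fun t => sobSq L 1 (u t - u t₀)) (𝓝[Set.Ici 0] t₀) (𝓝 0)

/-- `u ∈ L²(0, T; V̇_s)` for all `T > 0`. -/
structure L2Loc (L : ℝ) (s : ℕ) (u : ℝ → FourierField) : Prop where
  meas : ∀ K i, AEStronglyMeasurable (fun t => u t K i) (volume.restrict (Set.Ici 0))
  mem : ∀ᵐ t ∂(volume.restrict (Set.Ici (0 : ℝ))), MemVdot s (u t)
  finite : ∀ T : ℝ, 0 < T → ∫⁻ t in Set.Icc 0 T, ENNReal.ofReal (sobSq L s (u t)) ≠ ⊤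

/-- `f ∈ L^∞(0, ∞; H)`. -/
structure LinftyH (L : ℝ) (f : ℝ → FourierField) : Prop where
  meas : ∀ K i, AEStronglyMeasurable (fun t => f t K i) (volume.restrict (Set.Ici 0))
  mem : ∀ᵐ t ∂(volume.restrict (Set.Ici (0 : ℝ))), MemVdot 0 (f t)
  bounded : essSup (fun t => ENNReal.ofReal (sobSq L 0 (f t)))
    (volume.restrict (Set.Ici 0)) ≠ ⊤

/-- `sup_{s ≥ 0} ‖f(s)‖²` (essential supremum). -/
def supForce (L : ℝ) (f : ℝ → FourierField) : ℝ :=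
  (essSup (fun t => ENNReal.ofReal (sobSq L 0 (f t))) (volume.restrict (Set.Ici 0))).toReal

/-- `du/dt = u'` on `[0, ∞)`, with `u' ∈ L²(0, T; H)` for all `T > 0`. -/
structure HasTimeDeriv (L : ℝ) (u u' : ℝ → FourierField) : Prop where
  l2 : L2Loc L 0 u'
  ftc : ∀ t, 0 ≤ t → ∀ K i, u t K i = u 0 K i + ∫ s in (0 : ℝ)..t, u' s K i

/-! ### The two systems -/

/-- `u` is a global solution with initial value `u₀` of the evolution equation
`dv/dt + νAv + B̃(u, v) = F`, `v = u + a²Au`, with right-hand side `F`: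
`u ∈ C([0,∞); V) ∩ L²(0,T; D(A))`, `du/dt ∈ L²(0,T; H)`, and the equation holds for a.e. time
(in the dual of `D(A)`, that is, in every Fourier mode). -/
structure IsSolution (L ν a : ℝ) (F : ℝ → FourierField) (u₀ : FourierField)
    (u : ℝ → FourierField) : Prop where
  init : u 0 = u₀
  cont : ContV L u
  l2DA : L2Loc L 2 u
  eqn : ∃ u' : ℝ → FourierField, HasTimeDeriv L u u' ∧
    ∀ᵐ t ∂(volume.restrict (Set.Ici (0 : ℝ))),
      helmholtz L a (u' t) + (ν : ℂ) • stokesA L (helmholtz L a (u t))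
        + Btilde L (u t) (helmholtz L a (u t)) = F t

/-- The right-hand side `f - η (I + β²A) 𝒫 (I_h w - I_h u)` of the nudged system. -/
def nudgedForce (L β η : ℝ) (Ih : FourierField →ₗ[ℝ] FourierField)
    (f u w : ℝ → FourierField) : ℝ → FourierField := fun t =>
  f t - (η : ℂ) • helmholtz L β (leray (Ih (w t) - Ih (u t)))

/-- `I_h` is a linear interpolant operator `D(A) → L²(Ω)³` with
`‖I_h φ - φ‖² ≤ c₁ h² ‖∇φ‖² + c₂ h⁴ ‖Δφ‖²`. Only the values of `Ih` on `D(A)` are constrained,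
and a linear map given on `D(A)` alone can be extended linearly in any way. -/
structure IsInterpolant (L h c₁ c₂ : ℝ) (Ih : FourierField →ₗ[ℝ] FourierField) : Prop where
  mem : ∀ φ, MemVdot 2 φ → MemL2 (Ih φ)
  approx : ∀ φ, MemVdot 2 φ →
    sobSq L 0 (Ih φ - φ) ≤ c₁ * h ^ 2 * sobSq L 1 φ + c₂ * h ^ 4 * sobSq L 2 φ

/-! ### The Gagliardo-Nirenberg constant -/

/-- The box `Ω = [0, L]³`. -/
def box (L : ℝ) : Set (Fin 3 → ℝ) := Set.Icc 0 (fun _ => L)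

/-- The Fourier coefficients `L⁻³ ∫_Ω G(x) exp (-2πi K·x / L) dx` of a vector field on `Ω`. -/
def fourierCoeffs (L : ℝ) (G : (Fin 3 → ℝ) → EuclideanSpace ℝ (Fin 3)) : FourierField :=
  fun K i => (L ^ 3 : ℂ)⁻¹ * ∫ x in box L,
    (G x i : ℂ) * Complex.exp (-(2 * Real.pi * Complex.I * (∑ j, (K j : ℂ) * (x j : ℂ)) / L))

/-- The inequalities `‖g‖_{L³} ≤ c ‖g‖^{1/2} ‖∇g‖^{1/2}`,
`‖g‖_{L⁴} ≤ c ‖g‖^{1/4} ‖∇g‖^{3/4}` and `‖g‖_{L⁶} ≤ c ‖∇g‖` hold for all `g ∈ V`, on every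
periodic box. -/
def IsGagliardoNirenbergConst (c : ℝ) : Prop :=
  ∀ L : ℝ, 0 < L → ∀ G : (Fin 3 → ℝ) → EuclideanSpace ℝ (Fin 3),
    MemLp G 2 (volume.restrict (box L)) → MemVdot 1 (fourierCoeffs L G) →
    let n0 := Real.sqrt (sobSq L 0 (fourierCoeffs L G))
    let n1 := Real.sqrt (sobSq L 1 (fourierCoeffs L G))
    eLpNorm G 3 (volume.restrict (box L))
        ≤ ENNReal.ofReal (c * n0 ^ (1 / 2 : ℝ) * n1 ^ (1 / 2 : ℝ)) ∧
      eLpNorm G 4 (volume.restrict (box L))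
        ≤ ENNReal.ofReal (c * n0 ^ (1 / 4 : ℝ) * n1 ^ (3 / 4 : ℝ)) ∧
      eLpNorm G 6 (volume.restrict (box L)) ≤ ENNReal.ofReal (c * n1)

/-! ### The constants of the error estimate -/

/-- `M₁ = ‖u₀‖² + α²‖∇u₀‖² + sup ‖f‖² / (λ₁²ν²)`. -/
def M1 (L ν α : ℝ) (f : ℝ → FourierField) (u₀ : FourierField) : ℝ :=
  sobSq L 0 u₀ + α ^ 2 * sobSq L 1 u₀ + 1 / (lambda1 L ^ 2 * ν ^ 2) * supForce L f

/-- The constant `M₃`; the argument `M` is `M₁`, `S` is `sup ‖f‖²` and `l` is `λ₁`. -/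
def M3 (c ν α M S l : ℝ) : ℝ :=
  4 / ν * (6 / α ^ 2 * (ν ^ 2 + c ^ 4 * M / (l ^ (1 / 2 : ℝ) * α ^ 2))
        * (M / ν + 1 / (ν ^ 3 * l ^ 2) * S)
      + 3 * c ^ 4 * M ^ 2 / (α ^ 6 * ν * l ^ (3 / 2 : ℝ)) + 3 / (ν * l) * S)
    + 4 * ν / α ^ 2 * (M / ν + 1 / (ν ^ 3 * l ^ 2) * S)
    + 2 * c ^ 4 * M / (ν * α ^ 4 * l ^ (1 / 2 : ℝ)) * (M / ν + 1 / (ν ^ 3 * l ^ 2) * S)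

end

end NSAlpha

open NSAlpha

/-!
The difference `g = w - u` of the two solutions is estimated through its energy
`E_g = ‖g‖² + β² ‖∇g‖²`. The equation for `u` is first rewritten with the parameter `β`: the defect
`(β² - α²)(A (u' + ν A u) + B̃(u, Au))` still contains `u'`, but the equation itself gives
`u' + ν A u = (I + α² A)⁻¹ (f - B̃(u, u) - α² B̃(u, Au))`, so that the defect, paired with `g`, only
involves `f`, `B̃(u, u)` and `B̃(u, Au)` tested against `A (I + α² A)⁻¹ g` and `(I + α² A)⁻¹ g`
(`dotRe_balance`). Since `⟨B̃(g, z), g⟩ = 0` (`Btilde_pairing_self`), what is left of the nonlinearity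
is `⟨B̃(u, g), g⟩ + β² ⟨B̃(u, Ag), g⟩`. These terms, the interpolation error and the defect are
absorbed by the viscosity and the nudging under the three hypotheses on `η` and `h`
(`difference_balance_le`, `energyRate_difference_le`), with the outcome
`E_g' + (λ₁ν/2) E_g ≤ F + k ‖Au‖²`, where `F` and `k` are proportional to `(β² - α²)²`.

The term `k ‖Au‖²` is only controlled on average in time, by the dissipation of the `α`-energy
`E_u = ‖u‖² + α² ‖∇u‖²` of `u` (`energyRate_le_of_NSAlpha`), and `E_u ≤ M₁` for all times
(`energy_le_M1`). Adding a multiple `κ E_u` to `E_g` cancels it and leaves an inequality with constant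
forcing, to which Gronwall's inequality applies (`gronwall_of_primitive`, `error_le`). The forcing
accumulates to at most `4 (β² - α²)² / β² · M₃`, and `4 ≤ 2e / (√e - 1)`.

All estimates of the trilinear form are made on the Fourier side. It is dominated by a lattice sum
`∑ a_J N(K-J) d_{K-J} b_K`, which the Cauchy–Schwarz inequality bounds by the `H¹`, `H^{1/2}` and `L²`
norms of the factors (`trilinear_le`): the shorter of the two wave vectors `J` and `K` is summed
with the weight `N⁻²` or `N⁻¹`, which over a ball of radius `R` adds up to a multiple of `R` or `R²`.
With the interpolation of norms, and Agmon's inequality (`agmon_le`) where the derivative on `v` is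
moved to `u`, this gives `|⟨B̃(u, v), φ⟩|⁴ ≤ C ‖∇u‖⁴ ‖v‖⁴ ‖∇φ‖² ‖Δφ‖²` (`Btilde_pairing_DA`) and
`|⟨B̃(u, v), φ⟩|⁴ ≤ C ‖∇u‖⁴ ‖∇v‖⁴ ‖φ‖² ‖∇φ‖²` (`Btilde_pairing_V`). The energy identity in time is
obtained mode by mode and summed (`energy_eq_add_integral`).

The same lattice sum bounds the convolution cube of the Fourier coefficients in `ℓ²`, hence by
Parseval's identity the `L²` norm of `P³` for a trigonometric polynomial `P`, which is the embedding
`H¹ ⊂ L⁶` (`lintegral_pow_six_le`). The Gagliardo–Nirenberg inequalities follow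
(`isGagliardoNirenbergConst_of_le`), and hold with every larger constant. The constant `c` of the
theorem is therefore chosen so large that `c⁸` also dominates the constant `C` (`triConst`).
-/

namespace NSAlpha

open scoped ENNReal

/-! ### Lattice sums -/

/-- The sup norm `max |K_i|` of a wave vector, as a natural number. It is comparable with `|K|`
and its balls and spheres are easy to count. -/
def supN (K : Mode) : ℕ := Finset.univ.sup fun i => (K i).natAbs

theorem supN_le_iff (K : Mode) (R : ℕ) : supN K ≤ R ↔ ∀ i, (K i).natAbs ≤ R := by
  simp [supN]

theorem natAbs_le_supN (K : Mode) (i : Fin 3) : (K i).natAbs ≤ supN K :=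
  (supN_le_iff K _).1 le_rfl i

theorem supN_eq_zero {K : Mode} : supN K = 0 ↔ K = 0 := by
  rw [← Nat.le_zero, supN_le_iff]
  simp [funext_iff]

theorem supN_add_le (J K : Mode) : supN (J + K) ≤ supN J + supN K := by
  rw [supN_le_iff]
  intro i
  exact (Int.natAbs_add_le _ _).trans (add_le_add (natAbs_le_supN J i) (natAbs_le_supN K i))

theorem supN_neg (K : Mode) : supN (-K) = supN K := by
  simp [supN]

theorem supN_sub_le (J K : Mode) : supN (J - K) ≤ supN J + supN K := by
  rw [sub_eq_add_neg, ← supN_neg K]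
  exact supN_add_le _ _

theorem supN_ball (R : ℕ) :
    {K : Mode | supN K ≤ R} = (Finset.Icc (fun _ => -(R : ℤ)) (fun _ => (R : ℤ)) : Finset Mode) := by
  ext K
  simp only [Set.mem_ofPred_eq, supN_le_iff, Finset.coe_Icc, Set.mem_Icc, Pi.le_def]
  constructor
  · intro h
    exact ⟨fun i => by have := h i; omega, fun i => by have := h i; omega⟩
  · rintro ⟨h1, h2⟩ i
    have := h1 i
    have := h2 i
    omega

theorem card_ball (R : ℕ) :
    (Finset.Icc (fun _ => -(R : ℤ)) (fun _ => (R : ℤ)) : Finset Mode).card = (2 * R + 1) ^ 3 := by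
  rw [Pi.card_Icc]
  simp only [Int.card_Icc, Finset.prod_const, Finset.card_univ, Fintype.card_fin]
  congr 1
  omega

theorem tsum_shell_le (n : ℕ) :
    ∑' K : Mode, (if supN K = n + 1 then (1 : ℝ≥0∞) else 0) ≤ 26 * ((n + 1 : ℕ) : ℝ≥0∞) ^ 2 := by
  classical
  set B := (Finset.Icc (fun _ => -((n + 1 : ℕ) : ℤ)) (fun _ => ((n + 1 : ℕ) : ℤ)) : Finset Mode)
  set b := (Finset.Icc (fun _ => -(n : ℤ)) (fun _ => (n : ℤ)) : Finset Mode)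
  have hB : ∀ K : Mode, K ∈ B ↔ supN K ≤ n + 1 := fun K => by
    have := Set.ext_iff.1 (supN_ball (n + 1)) K
    exact this.symm
  have hb : ∀ K : Mode, K ∈ b ↔ supN K ≤ n := fun K => by
    have := Set.ext_iff.1 (supN_ball n) K
    exact this.symm
  have hsub : b ⊆ B := fun K hK => (hB K).2 (((hb K).1 hK).trans (Nat.le_succ n))
  have h1 : ∀ K : Mode, K ∉ B \ b → (if supN K = n + 1 then (1 : ℝ≥0∞) else 0) = 0 := by
    intro K hK
    rw [if_neg]
    intro h
    apply hK
    rw [Finset.mem_sdiff, hB, hb]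
    omega
  rw [tsum_eq_sum (s := B \ b) (fun K hK => h1 K hK)]
  calc ∑ K ∈ B \ b, (if supN K = n + 1 then (1 : ℝ≥0∞) else 0)
      ≤ ∑ K ∈ B \ b, (1 : ℝ≥0∞) := Finset.sum_le_sum fun K _ => by split_ifs <;> simp
    _ = ((B \ b).card : ℝ≥0∞) := by simp
    _ ≤ ((26 * (n + 1) ^ 2 : ℕ) : ℝ≥0∞) := by
        norm_cast
        rw [Finset.card_sdiff_of_subset hsub, card_ball, card_ball]
        rw [Nat.sub_le_iff_le_add]
        have : (2 * (n + 1) + 1) ^ 3 + (2 * n ^ 2 + 4 * n) = 26 * (n + 1) ^ 2 + (2 * n + 1) ^ 3 := by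
          ring
        exact Nat.le.intro this
    _ = _ := by push_cast; ring

/-- Summation of a radial function over the lattice `ℤ³`, by spheres of the sup norm. -/
theorem tsum_radial_le (F : ℕ → ℝ≥0∞) (hF : F 0 = 0) :
    ∑' K : Mode, F (supN K) ≤ 26 * ∑' n : ℕ, ((n + 1 : ℕ) : ℝ≥0∞) ^ 2 * F (n + 1) := by
  have h1 : ∀ K : Mode, F (supN K) = ∑' n : ℕ, F (n + 1) * (if supN K = n + 1 then 1 else 0) := by
    intro K
    rcases Nat.eq_zero_or_pos (supN K) with h | h
    · simp [h, hF]
    · obtain ⟨m, hm⟩ := Nat.exists_eq_succ_of_ne_zero h.ne'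
      rw [tsum_eq_single m]
      · simp [hm]
      · intro n hn
        rw [if_neg]
        · simp
        · omega
  simp_rw [h1]
  rw [ENNReal.tsum_comm, ← ENNReal.tsum_mul_left]
  refine ENNReal.tsum_le_tsum fun n => ?_
  rw [ENNReal.tsum_mul_left]
  calc _ ≤ F (n + 1) * (26 * ((n + 1 : ℕ) : ℝ≥0∞) ^ 2) := by gcongr; exact tsum_shell_le n
    _ = _ := by ring

theorem tsum_inv_sq_le (R : ℕ) :
    ∑' K : Mode, (if 0 < supN K ∧ supN K ≤ R then ((supN K : ℝ≥0∞)⁻¹) ^ 2 else 0) ≤ 26 * R := by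
  refine (tsum_radial_le (fun n => if 0 < n ∧ n ≤ R then ((n : ℝ≥0∞)⁻¹) ^ 2 else 0)
    (by simp)).trans ?_
  gcongr
  rw [tsum_eq_sum (s := Finset.range R)]
  · calc _ ≤ ∑ n ∈ Finset.range R, (1 : ℝ≥0∞) := by
          refine Finset.sum_le_sum fun n _ => ?_
          split_ifs
          · rw [← mul_pow, ENNReal.mul_inv_cancel]
            · simp
            · exact_mod_cast Nat.succ_ne_zero n
            · exact ENNReal.natCast_ne_top _
          · simp
      _ = R := by simp
  · intro n hn
    rw [Finset.mem_range] at hn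
    rw [if_neg (by omega), mul_zero]

theorem tsum_inv_le (R : ℕ) :
    ∑' K : Mode, (if 0 < supN K ∧ supN K ≤ R then ((supN K : ℝ≥0∞)⁻¹) else 0)
      ≤ 26 * (R : ℝ≥0∞) ^ 2 := by
  calc _ ≤ ∑' K : Mode, (R : ℝ≥0∞) *
          (if 0 < supN K ∧ supN K ≤ R then ((supN K : ℝ≥0∞)⁻¹) ^ 2 else 0) := by
        refine ENNReal.tsum_le_tsum fun K => ?_
        split_ifs with h
        · have h0 : (supN K : ℝ≥0∞) ≠ 0 := by exact_mod_cast h.1.ne'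
          calc (supN K : ℝ≥0∞)⁻¹ = supN K * ((supN K : ℝ≥0∞)⁻¹) ^ 2 := by
                rw [sq, ← mul_assoc, ENNReal.mul_inv_cancel h0 (ENNReal.natCast_ne_top _), one_mul]
            _ ≤ _ := by gcongr; exact h.2
        · simp
    _ ≤ R * (26 * R) := by
        rw [ENNReal.tsum_mul_left]
        gcongr
        exact tsum_inv_sq_le R
    _ = _ := by ring

theorem tsum_tail_le (R : ℕ) (hR : 0 < R) :
    ∑' K : Mode, (if R < supN K then ((supN K : ℝ≥0∞)⁻¹) ^ 4 else 0) ≤ 52 * (R : ℝ≥0∞)⁻¹ := by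
  refine (tsum_radial_le (fun n => if R < n then ((n : ℝ≥0∞)⁻¹) ^ 4 else 0)
    (by simp)).trans ?_
  have key : ∑' n : ℕ, ((n + 1 : ℕ) : ℝ≥0∞) ^ 2 *
      (if R < n + 1 then (((n + 1 : ℕ) : ℝ≥0∞)⁻¹) ^ 4 else 0) ≤ 2 * (R : ℝ≥0∞)⁻¹ := by
    have h1 : ∀ n : ℕ, ((n + 1 : ℕ) : ℝ≥0∞) ^ 2 *
        (if R < n + 1 then (((n + 1 : ℕ) : ℝ≥0∞)⁻¹) ^ 4 else 0)
        = ENNReal.ofReal (if R < n + 1 then (((n + 1 : ℕ) : ℝ) ^ 2)⁻¹ else 0) := by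
      intro n
      split_ifs
      · have h0 : ((n + 1 : ℕ) : ℝ≥0∞) ≠ 0 := by exact_mod_cast Nat.succ_ne_zero n
        have e : ((n + 1 : ℕ) : ℝ≥0∞) ^ 2 * (((n + 1 : ℕ) : ℝ≥0∞)⁻¹) ^ 4
            = (((n + 1 : ℕ) : ℝ≥0∞)⁻¹) ^ 2 := by
          rw [show (4 : ℕ) = 2 + 2 from rfl, pow_add, ← mul_assoc, ← mul_pow,
            ENNReal.mul_inv_cancel h0 (ENNReal.natCast_ne_top _), one_pow, one_mul]
        rw [e, ENNReal.ofReal_inv_of_pos (by positivity), ENNReal.ofReal_pow (by positivity),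
          ENNReal.ofReal_natCast, ENNReal.inv_pow]
      · simp
    simp_rw [h1]
    refine ENNReal.tsum_le_of_sum_range_le fun m => ?_
    rw [← ENNReal.ofReal_sum_of_nonneg (fun n _ => by split_ifs <;> positivity)]
    have h2 : ∑ i ∈ Finset.range m, (if R < i + 1 then (((i + 1 : ℕ) : ℝ) ^ 2)⁻¹ else 0)
        ≤ 2 / ((R : ℝ) + 1) := by
      refine le_trans (le_of_eq ?_) (sum_Ioo_inv_sq_le R (m + 1))
      rw [← Finset.sum_filter]
      refine Finset.sum_bij (fun i _ => i + 1) ?_ ?_ ?_ ?_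
      · intro i hi
        simp only [Finset.mem_filter, Finset.mem_range] at hi
        simp only [Finset.mem_Ioo]
        omega
      · intro i _ j _ h
        omega
      · intro j hj
        simp only [Finset.mem_Ioo] at hj
        exact ⟨j - 1, by simp only [Finset.mem_filter, Finset.mem_range]; omega, by omega⟩
      · intro i _
        rfl
    refine (ENNReal.ofReal_le_ofReal h2).trans ?_
    have hR' : (0 : ℝ) < R := by exact_mod_cast hR
    calc ENNReal.ofReal (2 / ((R : ℝ) + 1)) ≤ ENNReal.ofReal (2 * (R : ℝ)⁻¹) := by
          apply ENNReal.ofReal_le_ofReal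
          rw [div_eq_mul_inv]
          gcongr
          linarith
      _ = _ := by
          rw [ENNReal.ofReal_mul (by norm_num), ENNReal.ofReal_inv_of_pos hR',
            ENNReal.ofReal_natCast]
          norm_num
  calc _ ≤ 26 * (2 * (R : ℝ≥0∞)⁻¹) := by gcongr
    _ = _ := by rw [← mul_assoc]; norm_num

/-! ### Product estimates for sequences -/

/-- Cauchy–Schwarz for series in `[0, ∞]`. -/
theorem tsum_sq_le {ι : Type*} {f p q : ι → ℝ≥0∞} (h : ∀ i, f i ^ 2 ≤ p i * q i) :
    (∑' i, f i) ^ 2 ≤ (∑' i, p i) * ∑' i, q i := by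
  have sq_root : ∀ x : ℝ≥0∞, (x ^ (1 / 2 : ℝ)) ^ (2 : ℝ) = x := fun x => by
    rw [← ENNReal.rpow_mul]; norm_num
  have h1 : ∀ i, f i ≤ p i ^ (1 / 2 : ℝ) * q i ^ (1 / 2 : ℝ) := by
    intro i
    rw [← ENNReal.mul_rpow_of_nonneg _ _ (by norm_num : (0 : ℝ) ≤ 1 / 2)]
    calc f i = (f i ^ (2 : ℝ)) ^ (1 / 2 : ℝ) := by rw [← ENNReal.rpow_mul]; norm_num
      _ ≤ _ := by
        gcongr
        rw [ENNReal.rpow_two]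
        exact h i
  have h2 : ∑' i, f i ≤ ((∑' i, p i) * ∑' i, q i) ^ (1 / 2 : ℝ) := by
    rw [ENNReal.tsum_eq_iSup_sum]
    refine iSup_le fun s => ?_
    calc ∑ i ∈ s, f i ≤ ∑ i ∈ s, p i ^ (1 / 2 : ℝ) * q i ^ (1 / 2 : ℝ) :=
          Finset.sum_le_sum fun i _ => h1 i
      _ ≤ (∑ i ∈ s, (p i ^ (1 / 2 : ℝ)) ^ (2 : ℝ)) ^ (1 / 2 : ℝ)
          * (∑ i ∈ s, (q i ^ (1 / 2 : ℝ)) ^ (2 : ℝ)) ^ (1 / 2 : ℝ) :=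
          ENNReal.inner_le_Lp_mul_Lq s _ _ Real.HolderConjugate.two_two
      _ = ((∑ i ∈ s, p i) * ∑ i ∈ s, q i) ^ (1 / 2 : ℝ) := by
          simp_rw [sq_root]
          rw [ENNReal.mul_rpow_of_nonneg _ _ (by norm_num : (0 : ℝ) ≤ 1 / 2)]
      _ ≤ _ := by
          gcongr <;> exact ENNReal.sum_le_tsum s
  calc (∑' i, f i) ^ 2 ≤ (((∑' i, p i) * ∑' i, q i) ^ (1 / 2 : ℝ)) ^ 2 := by gcongr
    _ = _ := by rw [← ENNReal.rpow_two, sq_root]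

theorem ennreal_add_sq_le (x y : ℝ≥0∞) : (x + y) ^ 2 ≤ 4 * (x ^ 2 + y ^ 2) := by
  wlog h : x ≤ y generalizing x y
  · have := this y x (le_of_not_ge h)
    rwa [add_comm x y, add_comm (x ^ 2)]
  calc (x + y) ^ 2 ≤ (y + y) ^ 2 := by gcongr
    _ = 4 * y ^ 2 := by ring
    _ ≤ _ := by gcongr; exact le_add_self

/-- The square of the homogeneous Sobolev norm of order `s / 2` of a nonnegative sequence on the
lattice, with the sup norm as weight: `∑ N(K)^s a_K²`. -/
noncomputable def wsum (s : ℕ) (a : Mode → ℝ≥0∞) : ℝ≥0∞ := ∑' K, (supN K : ℝ≥0∞) ^ s * a K ^ 2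

/-- The product estimate `H¹ · H^{1/2} → L²` in dimension three, on the Fourier side and in dual
form. The kernel `e` is `d (K - J)` or `d (J + K)` in the applications. Where `N(J) ≤ N(K)`, the
Cauchy–Schwarz inequality with the weight `N(J)²` works because `∑_{N(J) ≤ R} N(J)⁻² ≲ R`;
elsewhere the weight `N(K)` does because `∑_{N(K) ≤ R} N(K)⁻¹ ≲ R²`. -/
theorem trilinear_le (a b : Mode → ℝ≥0∞) (e : Mode → Mode → ℝ≥0∞) (D : ℝ≥0∞)
    (ha : a 0 = 0) (hb : b 0 = 0) (h1 : ∀ J, ∑' K, e J K ^ 2 ≤ D) (h2 : ∀ K, ∑' J, e J K ^ 2 ≤ D) :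
    (∑' J, ∑' K, a J * b K * e J K) ^ 2 ≤ 208 * (wsum 2 a * wsum 1 b * D) := by
  set f1 : Mode × Mode → ℝ≥0∞ := fun x =>
    if supN x.1 ≤ supN x.2 then a x.1 * b x.2 * e x.1 x.2 else 0
  set f2 : Mode × Mode → ℝ≥0∞ := fun x =>
    if supN x.1 ≤ supN x.2 then 0 else a x.1 * b x.2 * e x.1 x.2
  have hsplit : ∑' J, ∑' K, a J * b K * e J K = ∑' x, f1 x + ∑' x, f2 x := by
    rw [← ENNReal.tsum_add, ← ENNReal.tsum_prod (f := fun J K => a J * b K * e J K)]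
    refine tsum_congr fun x => ?_
    simp only [f1, f2]
    split_ifs <;> simp
  have inv_cancel : ∀ K : Mode, 0 < supN K → (supN K : ℝ≥0∞) * (supN K : ℝ≥0∞)⁻¹ = 1 := fun K hK =>
    ENNReal.mul_inv_cancel (by exact_mod_cast hK.ne') (ENNReal.natCast_ne_top _)
  have hpos : ∀ {g : Mode → ℝ≥0∞} {K : Mode}, g 0 = 0 → g K ≠ 0 → 0 < supN K := by
    intro g K hg hK
    rw [Nat.pos_iff_ne_zero]
    intro h
    rw [supN_eq_zero] at h
    exact hK (h ▸ hg)
  have e1 : (∑' x, f1 x) ^ 2 ≤ (wsum 2 a * D) * (26 * wsum 1 b) := by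
    refine (tsum_sq_le (p := fun x => ((supN x.1 : ℝ≥0∞) ^ 2 * a x.1 ^ 2) * e x.1 x.2 ^ 2)
      (q := fun x => b x.2 ^ 2 * (if 0 < supN x.1 ∧ supN x.1 ≤ supN x.2
        then ((supN x.1 : ℝ≥0∞)⁻¹) ^ 2 else 0)) ?_).trans ?_
    · intro x
      simp only [f1]
      by_cases hx : supN x.1 ≤ supN x.2
      · by_cases h0 : a x.1 = 0
        · simp [h0]
        · have hp := hpos ha h0
          rw [if_pos hx, if_pos ⟨hp, hx⟩]
          apply le_of_eq
          calc (a x.1 * b x.2 * e x.1 x.2) ^ 2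
              = ((supN x.1 : ℝ≥0∞) * (supN x.1 : ℝ≥0∞)⁻¹) ^ 2 * (a x.1 * b x.2 * e x.1 x.2) ^ 2 := by
                rw [inv_cancel _ hp]; simp
            _ = _ := by ring
      · simp [hx]
    · refine mul_le_mul' ?_ ?_
      · rw [ENNReal.tsum_prod (f := fun J K => ((supN J : ℝ≥0∞) ^ 2 * a J ^ 2) * e J K ^ 2), wsum,
          ← ENNReal.tsum_mul_right]
        refine ENNReal.tsum_le_tsum fun J => ?_
        rw [ENNReal.tsum_mul_left]
        gcongr
        exact h1 J
      · rw [ENNReal.tsum_prod (f := fun J K => b K ^ 2 * (if 0 < supN J ∧ supN J ≤ supN K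
          then ((supN J : ℝ≥0∞)⁻¹) ^ 2 else 0)), ENNReal.tsum_comm, wsum, ← ENNReal.tsum_mul_left]
        refine ENNReal.tsum_le_tsum fun K => ?_
        rw [ENNReal.tsum_mul_left]
        calc _ ≤ b K ^ 2 * (26 * supN K) := by gcongr; exact tsum_inv_sq_le _
          _ = _ := by ring
  have e2 : (∑' x, f2 x) ^ 2 ≤ (wsum 1 b * D) * (26 * wsum 2 a) := by
    refine (tsum_sq_le (p := fun x => ((supN x.2 : ℝ≥0∞) ^ 1 * b x.2 ^ 2) * e x.1 x.2 ^ 2)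
      (q := fun x => a x.1 ^ 2 * (if 0 < supN x.2 ∧ supN x.2 ≤ supN x.1
        then ((supN x.2 : ℝ≥0∞)⁻¹) else 0)) ?_).trans ?_
    · intro x
      simp only [f2]
      by_cases hx : supN x.1 ≤ supN x.2
      · simp [hx]
      · by_cases h0 : b x.2 = 0
        · simp [h0]
        · have hp := hpos hb h0
          rw [if_neg hx, if_pos ⟨hp, by omega⟩]
          apply le_of_eq
          calc (a x.1 * b x.2 * e x.1 x.2) ^ 2
              = ((supN x.2 : ℝ≥0∞) * (supN x.2 : ℝ≥0∞)⁻¹) * (a x.1 * b x.2 * e x.1 x.2) ^ 2 := by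
                rw [inv_cancel _ hp]; simp
            _ = _ := by ring
    · refine mul_le_mul' ?_ ?_
      · rw [ENNReal.tsum_prod (f := fun J K => ((supN K : ℝ≥0∞) ^ 1 * b K ^ 2) * e J K ^ 2),
          ENNReal.tsum_comm, wsum, ← ENNReal.tsum_mul_right]
        refine ENNReal.tsum_le_tsum fun J => ?_
        rw [ENNReal.tsum_mul_left]
        gcongr
        exact h2 J
      · rw [ENNReal.tsum_prod (f := fun J K => a J ^ 2 * (if 0 < supN K ∧ supN K ≤ supN J
          then ((supN K : ℝ≥0∞)⁻¹) else 0)), wsum, ← ENNReal.tsum_mul_left]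
        refine ENNReal.tsum_le_tsum fun K => ?_
        rw [ENNReal.tsum_mul_left]
        calc _ ≤ a K ^ 2 * (26 * (supN K : ℝ≥0∞) ^ 2) := by gcongr; exact tsum_inv_le _
          _ = _ := by ring
  rw [hsplit]
  calc _ ≤ 4 * ((∑' x, f1 x) ^ 2 + (∑' x, f2 x) ^ 2) := ennreal_add_sq_le _ _
    _ ≤ 4 * ((wsum 2 a * D) * (26 * wsum 1 b) + (wsum 1 b * D) * (26 * wsum 2 a)) := by gcongr
    _ = _ := by ring

theorem wsum_mono_order {s t : ℕ} (a : Mode → ℝ≥0∞) (ha : a 0 = 0) (hst : s ≤ t) :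
    wsum s a ≤ wsum t a := by
  refine ENNReal.tsum_le_tsum fun K => ?_
  by_cases h : supN K = 0
  · rw [supN_eq_zero] at h
    simp [h, ha]
  · have : (1 : ℝ≥0∞) ≤ supN K := by exact_mod_cast Nat.one_le_iff_ne_zero.2 h
    gcongr

/-- Interpolation between Sobolev norms: a half-integral order lies between two integral ones. -/
theorem wsum_interp (s : ℕ) (a : Mode → ℝ≥0∞) :
    wsum (s + 1) a ^ 2 ≤ wsum s a * wsum (s + 2) a := by
  refine tsum_sq_le fun K => le_of_eq ?_
  ring

/-- Agmon's inequality for absolutely convergent Fourier series: `(∑ b_K)⁴ ≲ ‖b‖²_{H¹} ‖b‖²_{H²}`. -/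
theorem agmon_le (b : Mode → ℝ≥0∞) (hb : b 0 = 0) :
    (∑' K, b K) ^ 4 ≤ 1000000 * (wsum 2 b * wsum 4 b) := by
  set B1 := wsum 2 b
  set B2 := wsum 4 b
  have h12 : B1 ≤ B2 := wsum_mono_order b hb (by norm_num)
  have main : ∀ R : ℕ, 0 < R → (∑' K, b K) ^ 2 ≤ 4 * (26 * R * B1 + 52 * (R : ℝ≥0∞)⁻¹ * B2) := by
    intro R hR
    have hs : ∑' K, b K = ∑' K, (if supN K ≤ R then b K else 0)
        + ∑' K, (if supN K ≤ R then 0 else b K) := by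
      rw [← ENNReal.tsum_add]
      refine tsum_congr fun K => ?_
      split_ifs <;> simp
    have inv_cancel : ∀ K : Mode, 0 < supN K → (supN K : ℝ≥0∞) * (supN K : ℝ≥0∞)⁻¹ = 1 :=
      fun K hK => ENNReal.mul_inv_cancel (by exact_mod_cast hK.ne') (ENNReal.natCast_ne_top _)
    have g1 : (∑' K, (if supN K ≤ R then b K else 0)) ^ 2 ≤ (26 * R) * B1 := by
      refine (tsum_sq_le (p := fun K => if 0 < supN K ∧ supN K ≤ R
        then ((supN K : ℝ≥0∞)⁻¹) ^ 2 else 0)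
        (q := fun K => (supN K : ℝ≥0∞) ^ 2 * b K ^ 2) fun K => ?_).trans ?_
      · by_cases h : supN K ≤ R
        · rcases Nat.eq_zero_or_pos (supN K) with h0 | h0
          · rw [supN_eq_zero] at h0
            simp [h0, hb]
          · rw [if_pos h, if_pos ⟨h0, h⟩]
            apply le_of_eq
            calc b K ^ 2 = ((supN K : ℝ≥0∞) * (supN K : ℝ≥0∞)⁻¹) ^ 2 * b K ^ 2 := by
                  rw [inv_cancel K h0]; simp
              _ = _ := by ring
        · simp [h]
      · gcongr
        · exact tsum_inv_sq_le R
        · exact le_rfl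
    have g2 : (∑' K, (if supN K ≤ R then 0 else b K)) ^ 2 ≤ (52 * (R : ℝ≥0∞)⁻¹) * B2 := by
      refine (tsum_sq_le (p := fun K => if R < supN K
        then ((supN K : ℝ≥0∞)⁻¹) ^ 4 else 0)
        (q := fun K => (supN K : ℝ≥0∞) ^ 4 * b K ^ 2) fun K => ?_).trans ?_
      · by_cases h : supN K ≤ R
        · simp [h]
        · rw [if_neg h, if_pos (by omega)]
          apply le_of_eq
          calc b K ^ 2 = ((supN K : ℝ≥0∞) * (supN K : ℝ≥0∞)⁻¹) ^ 4 * b K ^ 2 := by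
                rw [inv_cancel K (by omega)]; simp
            _ = _ := by ring
      · gcongr
        · exact tsum_tail_le R hR
        · exact le_rfl
    rw [hs]
    refine (ennreal_add_sq_le _ _).trans ?_
    gcongr
  rcases eq_or_ne B1 0 with h0 | h0
  · have : ∀ K, b K = 0 := by
      intro K
      have := (ENNReal.tsum_eq_zero.1 h0) K
      rcases mul_eq_zero.1 this with h | h
      · have : supN K = 0 := by simpa using h
        rw [supN_eq_zero] at this
        rw [this, hb]
      · simpa using h
    simp [this]
  rcases eq_or_ne B2 ⊤ with ht | ht
  · rw [ht, ENNReal.mul_top h0]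
    simp
  have ht1 : B1 ≠ ⊤ := ne_top_of_le_ne_top ht h12
  -- the optimal splitting radius is `R ≈ (B2 / B1)^{1/2}`
  obtain ⟨R, hR, hl, hu⟩ : ∃ R : ℕ, 0 < R ∧ (R : ℝ≥0∞) ^ 2 * B1 ≤ B2 ∧
      B2 ≤ 4 * (R : ℝ≥0∞) ^ 2 * B1 := by
    lift B1 to NNReal using ht1 with x hx
    lift B2 to NNReal using ht with y hy
    have hx0 : 0 < x := pos_iff_ne_zero.2 (by exact_mod_cast h0)
    have hxy : x ≤ y := by exact_mod_cast h12
    set r : ℝ := Real.sqrt (y / x)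
    have hr1 : 1 ≤ r := by
      rw [Real.one_le_sqrt, one_le_div (by exact_mod_cast hx0)]
      exact_mod_cast hxy
    have hr2 : r ^ 2 = y / x := Real.sq_sqrt (by positivity)
    have hx0' : (0 : ℝ) < x := by exact_mod_cast hx0
    have hr3 : r ^ 2 * x = y := by rw [hr2]; field_simp
    have hf := Nat.floor_le (zero_le_one.trans hr1)
    have hg := Nat.lt_floor_add_one r
    have hR1 : 1 ≤ ⌊r⌋₊ := (Nat.one_le_floor_iff r).2 hr1
    have hR1' : (1 : ℝ) ≤ ⌊r⌋₊ := by exact_mod_cast hR1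
    refine ⟨⌊r⌋₊, hR1, ?_, ?_⟩
    · have : ((⌊r⌋₊ : ℝ)) ^ 2 * x ≤ y := by
        rw [← hr3]; gcongr
      exact_mod_cast this
    · have : (y : ℝ) ≤ 4 * (⌊r⌋₊ : ℝ) ^ 2 * x := by
        rw [← hr3]
        gcongr
        nlinarith
      exact_mod_cast this
  have hRt : (R : ℝ≥0∞) * (R : ℝ≥0∞)⁻¹ = 1 :=
    ENNReal.mul_inv_cancel (by exact_mod_cast hR.ne') (ENNReal.natCast_ne_top _)
  have h3 : (∑' K, b K) ^ 2 ≤ 936 * (R * B1) := by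
    refine (main R hR).trans ?_
    calc _ ≤ 4 * (26 * R * B1 + 52 * (R : ℝ≥0∞)⁻¹ * (4 * (R : ℝ≥0∞) ^ 2 * B1)) := by gcongr
      _ = 4 * (26 * R * B1 + 208 * ((R : ℝ≥0∞) * (R : ℝ≥0∞)⁻¹) * (R * B1)) := by ring
      _ = _ := by rw [hRt]; ring
  calc (∑' K, b K) ^ 4 = ((∑' K, b K) ^ 2) ^ 2 := by ring
    _ ≤ (936 * (R * B1)) ^ 2 := by gcongr
    _ = 936 ^ 2 * (B1 * ((R : ℝ≥0∞) ^ 2 * B1)) := by ring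
    _ ≤ 1000000 * (B1 * B2) := by gcongr; norm_num

/-! ### Elementary facts on Fourier fields -/

theorem modeSq_nonneg (K : Mode) : 0 ≤ modeSq K := Finset.sum_nonneg fun _ _ => sq_nonneg _

theorem vecSq_nonneg (a : Fin 3 → ℂ) : 0 ≤ vecSq a := Finset.sum_nonneg fun _ _ => sq_nonneg _

theorem vecSq_zero : vecSq 0 = 0 := by simp [vecSq]

theorem modeSq_neg (K : Mode) : modeSq (-K) = modeSq K := by simp [modeSq]

theorem one_le_modeSq {K : Mode} (hK : K ≠ 0) : 1 ≤ modeSq K := by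
  obtain ⟨i, hi⟩ := Function.ne_iff.1 hK
  have h1 : (1 : ℝ) ≤ (K i : ℝ) ^ 2 := by
    have : 0 < (K i) ^ 2 := by
      have : K i ≠ 0 := hi
      positivity
    exact_mod_cast this
  exact h1.trans (Finset.single_le_sum (f := fun i => (K i : ℝ) ^ 2)
    (fun _ _ => sq_nonneg _) (Finset.mem_univ i))

theorem supN_sq_le_modeSq (K : Mode) : (supN K : ℝ) ^ 2 ≤ modeSq K := by
  obtain ⟨i, -, hi⟩ := Finset.exists_mem_eq_sup (Finset.univ : Finset (Fin 3)) ⟨0, by simp⟩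
    fun i => (K i).natAbs
  have h1 : (supN K : ℝ) ^ 2 = (K i : ℝ) ^ 2 := by
    rw [supN, hi, Nat.cast_natAbs, Int.cast_abs, sq_abs]
  rw [h1]
  exact Finset.single_le_sum (f := fun i => (K i : ℝ) ^ 2)
    (fun _ _ => sq_nonneg _) (Finset.mem_univ i)

theorem norm_modeVec_le (K : Mode) : ‖modeVec K‖ ≤ supN K := by
  rw [pi_norm_le_iff_of_nonneg (Nat.cast_nonneg _)]
  intro i
  have h : (((K i).natAbs : ℕ) : ℝ) ≤ supN K := by exact_mod_cast natAbs_le_supN K i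
  rw [Nat.cast_natAbs, Int.cast_abs] at h
  simpa [modeVec] using h

theorem norm_sq_le_vecSq (a : Fin 3 → ℂ) : ‖a‖ ^ 2 ≤ vecSq a := by
  obtain ⟨i, hi⟩ : ∃ i, ‖a‖ = ‖a i‖ := by
    obtain ⟨i, -, hi⟩ := Finset.exists_mem_eq_sup (Finset.univ : Finset (Fin 3)) ⟨0, by simp⟩
      fun i => ‖a i‖₊
    exact ⟨i, by rw [Pi.norm_def, hi]; rfl⟩
  rw [hi]
  exact Finset.single_le_sum (f := fun i => ‖a i‖ ^ 2) (fun _ _ => sq_nonneg _) (Finset.mem_univ i)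

theorem vecSq_smul (c : ℂ) (a : Fin 3 → ℂ) : vecSq (c • a) = ‖c‖ ^ 2 * vecSq a := by
  simp [vecSq, Finset.mul_sum, mul_pow]

theorem vecSq_add_le (a b : Fin 3 → ℂ) : vecSq (a + b) ≤ 2 * vecSq a + 2 * vecSq b := by
  simp only [vecSq, Finset.mul_sum, ← Finset.sum_add_distrib]
  refine Finset.sum_le_sum fun i _ => ?_
  have := norm_add_le (a i) (b i)
  simp only [Pi.add_apply]
  nlinarith [norm_nonneg (a i + b i), sq_nonneg (‖a i‖ - ‖b i‖)]

theorem vecSq_neg (a : Fin 3 → ℂ) : vecSq (-a) = vecSq a := by simp [vecSq]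

theorem norm_cross_le (a b : Fin 3 → ℂ) : ‖crossProduct a b‖ ≤ 2 * (‖a‖ * ‖b‖) := by
  rw [pi_norm_le_iff_of_nonneg (by positivity)]
  have h : ∀ i j k l : Fin 3, ‖a i * b j - a k * b l‖ ≤ 2 * (‖a‖ * ‖b‖) := by
    intro i j k l
    calc _ ≤ ‖a i‖ * ‖b j‖ + ‖a k‖ * ‖b l‖ := by
          refine (norm_sub_le _ _).trans ?_
          rw [norm_mul, norm_mul]
      _ ≤ ‖a‖ * ‖b‖ + ‖a‖ * ‖b‖ := by
          gcongr <;> exact norm_le_pi_norm _ _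
      _ = _ := by ring
  intro i
  rw [cross_apply]
  fin_cases i
  · exact h 1 2 2 1
  · exact h 2 0 0 2
  · exact h 0 1 1 0

/-- The real inner product of `ℂ³`. -/
noncomputable def dotRe (x y : Fin 3 → ℂ) : ℝ := ∑ i, (x i * (starRingEnd ℂ) (y i)).re

theorem dotRe_self (x : Fin 3 → ℂ) : dotRe x x = vecSq x := by
  simp only [dotRe, vecSq]
  refine Finset.sum_congr rfl fun i _ => ?_
  rw [Complex.mul_conj, Complex.ofReal_re, Complex.normSq_eq_norm_sq]

theorem dotRe_add_left (x y z : Fin 3 → ℂ) : dotRe (x + y) z = dotRe x z + dotRe y z := by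
  simp [dotRe, add_mul, Finset.sum_add_distrib]

theorem dotRe_neg_left (x z : Fin 3 → ℂ) : dotRe (-x) z = -dotRe x z := by
  simp [dotRe, ← Finset.sum_neg_distrib]

theorem dotRe_sub_left (x y z : Fin 3 → ℂ) : dotRe (x - y) z = dotRe x z - dotRe y z := by
  rw [sub_eq_add_neg, dotRe_add_left, dotRe_neg_left, sub_eq_add_neg]

theorem dotRe_smul_left (c : ℝ) (x z : Fin 3 → ℂ) : dotRe ((c : ℂ) • x) z = c * dotRe x z := by
  simp only [dotRe, Finset.mul_sum, Pi.smul_apply, smul_eq_mul, mul_assoc, Complex.re_ofReal_mul]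

theorem dotRe_smul_right (c : ℝ) (x z : Fin 3 → ℂ) : dotRe x ((c : ℂ) • z) = c * dotRe x z := by
  simp only [dotRe, Finset.mul_sum, Pi.smul_apply, smul_eq_mul, map_mul, Complex.conj_ofReal]
  refine Finset.sum_congr rfl fun i _ => ?_
  rw [← Complex.re_ofReal_mul]
  ring_nf

theorem abs_dotRe_le (x y : Fin 3 → ℂ) : |dotRe x y| ≤ 3 * (‖x‖ * ‖y‖) := by
  calc |dotRe x y| ≤ ∑ i : Fin 3, |(x i * (starRingEnd ℂ) (y i)).re| := Finset.abs_sum_le_sum_abs _ _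
    _ ≤ ∑ _i : Fin 3, ‖x‖ * ‖y‖ := by
        refine Finset.sum_le_sum fun i _ => (Complex.abs_re_le_norm _).trans ?_
        rw [norm_mul, RCLike.norm_conj]
        gcongr <;> exact norm_le_pi_norm _ _
    _ = _ := by simp

theorem dotRe_sq_le (x y : Fin 3 → ℂ) : dotRe x y ^ 2 ≤ vecSq x * vecSq y := by
  have h : |dotRe x y| ≤ ∑ i : Fin 3, ‖x i‖ * ‖y i‖ := by
    refine (Finset.abs_sum_le_sum_abs _ _).trans (Finset.sum_le_sum fun i _ => ?_)
    refine (Complex.abs_re_le_norm _).trans ?_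
    rw [norm_mul, RCLike.norm_conj]
  calc dotRe x y ^ 2 = |dotRe x y| ^ 2 := (sq_abs _).symm
    _ ≤ (∑ i : Fin 3, ‖x i‖ * ‖y i‖) ^ 2 := by gcongr
    _ ≤ _ := Finset.sum_mul_sq_le_sq_mul_sq _ _ _

theorem HasSum.dotRe_left {ι : Type*} {f : ι → Fin 3 → ℂ} {x : Fin 3 → ℂ} (h : HasSum f x)
    (y : Fin 3 → ℂ) : HasSum (fun j => dotRe (f j) y) (dotRe x y) := by
  refine hasSum_sum fun i _ => ?_
  exact Complex.hasSum_re ((Pi.hasSum.1 h i).mul_right _)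

/-! ### Fourier multipliers and the spaces `V̇_s` -/

theorem MemVdot.add {s : ℕ} {u v : FourierField} (hu : MemVdot s u) (hv : MemVdot s v) :
    MemVdot s (u + v) where
  zero := by simp [hu.zero, hv.zero]
  real K i := by simp [hu.real K i, hv.real K i]
  div_free K := by
    simp only [Pi.add_apply, mul_add, Finset.sum_add_distrib, hu.div_free K, hv.div_free K, add_zero]
  summable := by
    refine Summable.of_nonneg_of_le
      (fun K => mul_nonneg (pow_nonneg (modeSq_nonneg K) _) (vecSq_nonneg _)) (fun K => ?_)
      ((hu.summable.mul_left 2).add (hv.summable.mul_left 2))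
    calc modeSq K ^ s * vecSq ((u + v) K)
        ≤ modeSq K ^ s * (2 * vecSq (u K) + 2 * vecSq (v K)) := by
          have := pow_nonneg (modeSq_nonneg K) s
          gcongr
          exact vecSq_add_le _ _
      _ = _ := by ring

/-- The Fourier multiplier with symbol `m`. -/
noncomputable def fmul (m : Mode → ℝ) (u : FourierField) : FourierField := fun K => (m K : ℂ) • u K

theorem MemVdot.fmul {s t : ℕ} {u : FourierField} (hu : MemVdot s u) {m : Mode → ℝ} {C : ℝ}
    (hm : ∀ K, m (-K) = m K) (hC : ∀ K, modeSq K ^ t * m K ^ 2 ≤ C * modeSq K ^ s) :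
    MemVdot t (fmul m u) where
  zero := by simp [NSAlpha.fmul, hu.zero]
  real K i := by simp [NSAlpha.fmul, hu.real K i, hm]
  div_free K := by
    have h := hu.div_free K
    simp only [NSAlpha.fmul, Pi.smul_apply, smul_eq_mul]
    calc _ = (m K : ℂ) * ∑ i, (K i : ℂ) * u K i := by
          rw [Finset.mul_sum]
          exact Finset.sum_congr rfl fun i _ => by ring
      _ = 0 := by rw [h, mul_zero]
  summable := by
    refine Summable.of_nonneg_of_le
      (fun K => mul_nonneg (pow_nonneg (modeSq_nonneg K) _) (vecSq_nonneg _)) (fun K => ?_)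
      (hu.summable.mul_left C)
    rw [NSAlpha.fmul, vecSq_smul]
    calc _ = (modeSq K ^ t * m K ^ 2) * vecSq (u K) := by simp; ring
      _ ≤ (C * modeSq K ^ s) * vecSq (u K) := by
          exact mul_le_mul_of_nonneg_right (hC K) (vecSq_nonneg _)
      _ = _ := by ring

theorem MemVdot.smul {s : ℕ} {u : FourierField} (hu : MemVdot s u) (c : ℝ) :
    MemVdot s ((c : ℂ) • u) :=
  hu.fmul (m := fun _ => c) (C := c ^ 2) (fun _ => rfl) fun K => le_of_eq (by ring)

theorem MemVdot.neg {s : ℕ} {u : FourierField} (hu : MemVdot s u) : MemVdot s (-u) := by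
  have := hu.smul (-1)
  simpa using this

theorem MemVdot.sub {s : ℕ} {u v : FourierField} (hu : MemVdot s u) (hv : MemVdot s v) :
    MemVdot s (u - v) := by
  rw [sub_eq_add_neg]
  exact hu.add hv.neg

theorem MemVdot.mono {s t : ℕ} {u : FourierField} (hu : MemVdot s u) (hts : t ≤ s) :
    MemVdot t u where
  zero := hu.zero
  real := hu.real
  div_free := hu.div_free
  summable := by
    refine Summable.of_nonneg_of_le
      (fun K => mul_nonneg (pow_nonneg (modeSq_nonneg K) _) (vecSq_nonneg _)) (fun K => ?_)
      hu.summable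
    by_cases h : K = 0
    · simp [h, hu.zero, vecSq_zero]
    · have := one_le_modeSq h
      have := vecSq_nonneg (u K)
      gcongr

theorem waveSq_nonneg (L : ℝ) (K : Mode) : 0 ≤ waveSq L K :=
  mul_nonneg (sq_nonneg _) (modeSq_nonneg K)

theorem waveSq_neg (L : ℝ) (K : Mode) : waveSq L (-K) = waveSq L K := by
  simp [waveSq, modeSq_neg]

theorem MemVdot.stokesA {u : FourierField} (hu : MemVdot 2 u) (L : ℝ) :
    MemVdot 0 (stokesA L u) :=
  hu.fmul (m := waveSq L) (C := (2 * Real.pi / L) ^ 4) (waveSq_neg L) fun K =>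
    le_of_eq (by rw [waveSq]; ring)

theorem MemVdot.helmholtz {u : FourierField} (hu : MemVdot 2 u) (L a : ℝ) :
    MemVdot 0 (helmholtz L a u) := by
  have h := (hu.mono (Nat.zero_le 2)).add ((hu.stokesA L).smul (a ^ 2))
  simpa [NSAlpha.helmholtz] using h

/-- The homogeneous Sobolev norm in the units of the lattice: `∑ |K|^{2s} |û_K|²`. -/
noncomputable def latSq (s : ℕ) (u : FourierField) : ℝ := ∑' K, modeSq K ^ s * vecSq (u K)

theorem sobSq_eq_latSq (L : ℝ) (s : ℕ) (u : FourierField) :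
    sobSq L s u = L ^ 3 * ((2 * Real.pi / L) ^ (2 * s) * latSq s u) := by
  rw [sobSq, latSq, ← tsum_mul_left (a := (2 * Real.pi / L) ^ (2 * s))]
  congr 1
  refine tsum_congr fun K => ?_
  rw [waveSq, mul_pow, ← pow_mul]
  ring

theorem latSq_nonneg (s : ℕ) (u : FourierField) : 0 ≤ latSq s u :=
  tsum_nonneg fun K => mul_nonneg (pow_nonneg (modeSq_nonneg K) _) (vecSq_nonneg _)

theorem sobSq_nonneg {L : ℝ} (hL : 0 < L) (s : ℕ) (u : FourierField) : 0 ≤ sobSq L s u :=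
  mul_nonneg (by positivity) (tsum_nonneg fun K =>
    mul_nonneg (pow_nonneg (waveSq_nonneg L K) _) (vecSq_nonneg _))

theorem MemVdot.summable_wave {s : ℕ} {u : FourierField} (hu : MemVdot s u) (L : ℝ) :
    Summable fun K => waveSq L K ^ s * vecSq (u K) := by
  refine (hu.summable.mul_left ((2 * Real.pi / L) ^ (2 * s))).congr fun K => ?_
  rw [waveSq, mul_pow, ← pow_mul]
  ring

theorem MemVdot.hasSum_sobSq {s : ℕ} {u : FourierField} (hu : MemVdot s u) (L : ℝ) :
    HasSum (fun K => L ^ 3 * (waveSq L K ^ s * vecSq (u K))) (sobSq L s u) :=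
  (hu.summable_wave L).hasSum.mul_left _

theorem lambda1_pos {L : ℝ} (hL : 0 < L) : 0 < lambda1 L := by
  unfold lambda1
  positivity

theorem lambda1_le_waveSq {L : ℝ} {K : Mode} (hK : K ≠ 0) : lambda1 L ≤ waveSq L K := by
  rw [lambda1, waveSq, div_pow, mul_pow]
  have := one_le_modeSq hK
  calc 4 * Real.pi ^ 2 / L ^ 2 = 2 ^ 2 * Real.pi ^ 2 / L ^ 2 * 1 := by norm_num
    _ ≤ _ := by gcongr

/-- Poincaré's inequality. -/
theorem MemVdot.poincare {s : ℕ} {u : FourierField} (hu : MemVdot (s + 1) u) {L : ℝ} (hL : 0 < L) :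
    lambda1 L * sobSq L s u ≤ sobSq L (s + 1) u := by
  have h1 := ((hu.mono (Nat.le_succ s)).hasSum_sobSq L).mul_left (lambda1 L)
  refine hasSum_le (fun K => ?_) h1 (hu.hasSum_sobSq L)
  by_cases h : K = 0
  · simp [h, hu.zero, vecSq_zero]
  · have h2 := lambda1_le_waveSq (L := L) h
    have h3 := mul_nonneg (pow_nonneg (waveSq_nonneg L K) s) (vecSq_nonneg (u K))
    calc _ = L ^ 3 * (lambda1 L * (waveSq L K ^ s * vecSq (u K))) := by ring
      _ ≤ L ^ 3 * (waveSq L K * (waveSq L K ^ s * vecSq (u K))) := by gcongr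
      _ = _ := by ring

/-- Sup norms of the Fourier coefficients. -/
noncomputable def coeffNorm (u : FourierField) (K : Mode) : ℝ≥0∞ := ‖u K‖ₑ

theorem wsum_coeffNorm_le {s : ℕ} {u : FourierField} (hu : MemVdot s u) :
    wsum (2 * s) (coeffNorm u) ≤ ENNReal.ofReal (latSq s u) := by
  rw [latSq, ENNReal.ofReal_tsum_of_nonneg
    (fun K => mul_nonneg (pow_nonneg (modeSq_nonneg K) _) (vecSq_nonneg _)) hu.summable]
  refine ENNReal.tsum_le_tsum fun K => ?_
  have h1 : coeffNorm u K = ENNReal.ofReal ‖u K‖ := (ofReal_norm _).symm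
  rw [h1, ← ENNReal.ofReal_natCast, ← ENNReal.ofReal_pow (by positivity),
    ← ENNReal.ofReal_pow (by positivity), ← ENNReal.ofReal_mul (by positivity)]
  apply ENNReal.ofReal_le_ofReal
  rw [pow_mul]
  have := modeSq_nonneg K
  gcongr
  · exact supN_sq_le_modeSq K
  · exact norm_sq_le_vecSq _

theorem wsum_coeffNorm_ne_top {s : ℕ} {u : FourierField} (hu : MemVdot s u) :
    wsum (2 * s) (coeffNorm u) ≠ ⊤ :=
  ne_top_of_le_ne_top ENNReal.ofReal_ne_top (wsum_coeffNorm_le hu)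

theorem MemVdot.coeffNorm_zero {s : ℕ} {u : FourierField} (hu : MemVdot s u) :
    coeffNorm u 0 = 0 := by
  simp [coeffNorm, hu.zero]

/-! ### Bounds for the trilinear form -/

/-- The majorant `∑_{J,K} a_J N(K-J) d_{K-J} b_K` of the trilinear form `⟨u × (∇ × v), φ⟩`. -/
noncomputable def triSum (a d b : Mode → ℝ≥0∞) : ℝ≥0∞ :=
  ∑' J, ∑' K, a J * (supN (K - J) * d (K - J)) * b K

theorem tsum_sub_right (d : Mode → ℝ≥0∞) (J : Mode) : ∑' K, d (K - J) = ∑' K, d K :=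
  (Equiv.subRight J).tsum_eq d

theorem tsum_sub_left (d : Mode → ℝ≥0∞) (K : Mode) : ∑' J, d (K - J) = ∑' J, d J :=
  (Equiv.subLeft K).tsum_eq d

theorem triSum_pow_four_le_of_deriv_mid (a d b : Mode → ℝ≥0∞) (ha : a 0 = 0) (hb : b 0 = 0) :
    triSum a d b ^ 4 ≤ 208 ^ 2 * (wsum 2 a ^ 2 * wsum 2 d ^ 2 * (wsum 0 b * wsum 2 b)) := by
  have h1 : triSum a d b ^ 2 ≤ 208 * (wsum 2 a * wsum 1 b * wsum 2 d) := by
    have h := trilinear_le a b (fun J K => supN (K - J) * d (K - J)) (wsum 2 d) ha hb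
      (fun J => le_of_eq ?_) (fun K => le_of_eq ?_)
    · refine le_trans (le_of_eq ?_) h
      rw [triSum]
      congr 1
      refine tsum_congr fun J => tsum_congr fun K => ?_
      ring
    · simp_rw [mul_pow]
      exact tsum_sub_right (fun K => (supN K : ℝ≥0∞) ^ 2 * d K ^ 2) J
    · simp_rw [mul_pow]
      exact tsum_sub_left (fun K => (supN K : ℝ≥0∞) ^ 2 * d K ^ 2) K
  calc triSum a d b ^ 4 = (triSum a d b ^ 2) ^ 2 := by ring
    _ ≤ (208 * (wsum 2 a * wsum 1 b * wsum 2 d)) ^ 2 := by gcongr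
    _ = 208 ^ 2 * (wsum 2 a ^ 2 * wsum 2 d ^ 2 * wsum 1 b ^ 2) := by ring
    _ ≤ _ := by
        gcongr
        exact wsum_interp 0 b

/-- The derivative on the middle factor is moved to the others by `N(K-J) ≤ N(J) + N(K)`. -/
theorem triSum_pow_four_le_of_deriv_last (a d b : Mode → ℝ≥0∞) (ha : a 0 = 0) (hb : b 0 = 0) :
    triSum a d b ^ 4 ≤ 100000000 * (wsum 2 a ^ 2 * wsum 0 d ^ 2 * (wsum 2 b * wsum 4 b)) := by
  set X := ∑' J, ∑' K, a J * (supN K * b K) * d (K - J)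
  set Y := ∑' K, (∑' J, (supN J * a J) * d (K - J)) * b K
  have h0 : triSum a d b ≤ X + Y := by
    have hY : Y = ∑' J, ∑' K, (supN J * a J) * d (K - J) * b K := by
      rw [ENNReal.tsum_comm]
      exact tsum_congr fun K => ENNReal.tsum_mul_right.symm
    rw [hY, ← ENNReal.tsum_add]
    refine ENNReal.tsum_le_tsum fun J => ?_
    rw [← ENNReal.tsum_add]
    refine ENNReal.tsum_le_tsum fun K => ?_
    have : (supN (K - J) : ℝ≥0∞) ≤ supN K + supN J := by exact_mod_cast supN_sub_le K J
    calc _ ≤ a J * ((supN K + supN J) * d (K - J)) * b K := by gcongr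
      _ = _ := by ring
  have hD0 : ∀ J, ∑' K, d (K - J) ^ 2 = wsum 0 d := fun J => by
    rw [tsum_sub_right (fun K => d K ^ 2) J]
    simp [wsum]
  have hD0' : ∀ K, ∑' J, d (K - J) ^ 2 = wsum 0 d := fun K => by
    rw [tsum_sub_left (fun K => d K ^ 2) K]
    simp [wsum]
  have hX : X ^ 2 ≤ 208 * (wsum 2 a * wsum 3 b * wsum 0 d) := by
    have h := trilinear_le a (fun K => supN K * b K) (fun J K => d (K - J)) (wsum 0 d) ha
      (by simp [hb]) (fun J => (hD0 J).le) (fun K => (hD0' K).le)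
    have e : wsum 1 (fun K => supN K * b K) = wsum 3 b := tsum_congr fun K => by ring
    rwa [e] at h
  have hY : Y ^ 2 ≤ (∑' K, b K) ^ 2 * (wsum 2 a * wsum 0 d) := by
    have hroot : ∀ K, (∑' J, (supN J * a J) * d (K - J)) ≤ (wsum 2 a * wsum 0 d) ^ (1 / 2 : ℝ) := by
      intro K
      have : (∑' J, (supN J * a J) * d (K - J)) ^ 2 ≤ wsum 2 a * wsum 0 d := by
        refine (tsum_sq_le (p := fun J => (supN J : ℝ≥0∞) ^ 2 * a J ^ 2)
          (q := fun J => d (K - J) ^ 2) fun J => le_of_eq (by ring)).trans (le_of_eq ?_)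
        rw [hD0' K]
        rfl
      calc _ = ((∑' J, (supN J * a J) * d (K - J)) ^ (2 : ℝ)) ^ (1 / 2 : ℝ) := by
            rw [← ENNReal.rpow_mul]; norm_num
        _ ≤ _ := by
            gcongr
            rw [ENNReal.rpow_two]
            exact this
    calc Y ^ 2 ≤ (∑' K, (wsum 2 a * wsum 0 d) ^ (1 / 2 : ℝ) * b K) ^ 2 := by
          refine pow_le_pow_left' (ENNReal.tsum_le_tsum fun K => ?_) 2
          exact mul_le_mul_left (hroot K) _
      _ = (∑' K, b K) ^ 2 * ((wsum 2 a * wsum 0 d) ^ (1 / 2 : ℝ)) ^ (2 : ℝ) := by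
          rw [ENNReal.tsum_mul_left, ENNReal.rpow_two]; ring
      _ = _ := by rw [← ENNReal.rpow_mul]; norm_num
  have hX4 : X ^ 4 ≤ 208 ^ 2 * (wsum 2 a ^ 2 * wsum 0 d ^ 2 * (wsum 2 b * wsum 4 b)) := by
    calc X ^ 4 = (X ^ 2) ^ 2 := by ring
      _ ≤ (208 * (wsum 2 a * wsum 3 b * wsum 0 d)) ^ 2 := by gcongr
      _ = 208 ^ 2 * (wsum 2 a ^ 2 * wsum 0 d ^ 2 * wsum 3 b ^ 2) := by ring
      _ ≤ _ := by
          gcongr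
          exact wsum_interp 2 b
  have hY4 : Y ^ 4 ≤ 1000000 * (wsum 2 a ^ 2 * wsum 0 d ^ 2 * (wsum 2 b * wsum 4 b)) := by
    calc Y ^ 4 = (Y ^ 2) ^ 2 := by ring
      _ ≤ ((∑' K, b K) ^ 2 * (wsum 2 a * wsum 0 d)) ^ 2 := by gcongr
      _ = (∑' K, b K) ^ 4 * (wsum 2 a ^ 2 * wsum 0 d ^ 2) := by ring
      _ ≤ 1000000 * (wsum 2 b * wsum 4 b) * (wsum 2 a ^ 2 * wsum 0 d ^ 2) := by
          gcongr
          exact agmon_le b hb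
      _ = _ := by ring
  set Z := wsum 2 a ^ 2 * wsum 0 d ^ 2 * (wsum 2 b * wsum 4 b)
  calc triSum a d b ^ 4 ≤ (X + Y) ^ 4 := by gcongr
    _ = ((X + Y) ^ 2) ^ 2 := by ring
    _ ≤ (4 * (X ^ 2 + Y ^ 2)) ^ 2 := by gcongr; exact ennreal_add_sq_le _ _
    _ = 16 * (X ^ 2 + Y ^ 2) ^ 2 := by ring
    _ ≤ 16 * (4 * ((X ^ 2) ^ 2 + (Y ^ 2) ^ 2)) := by gcongr; exact ennreal_add_sq_le _ _
    _ = 64 * (X ^ 4 + Y ^ 4) := by ring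
    _ ≤ 64 * (208 ^ 2 * Z + 1000000 * Z) := by gcongr
    _ = (64 * (208 ^ 2 + 1000000)) * Z := by ring
    _ ≤ _ := by gcongr; norm_num

/-! ### The bilinear operator -/

theorem norm_curl_le {L : ℝ} (hL : 0 < L) (v : FourierField) (M : Mode) :
    ‖curl L v M‖ ≤ 2 * (2 * Real.pi / L) * (supN M * ‖v M‖) := by
  have h1 : ‖(2 * Real.pi * Complex.I / L : ℂ)‖ = 2 * Real.pi / L := by
    simp [abs_of_pos Real.pi_pos, abs_of_pos hL]
  rw [curl, norm_smul, h1]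
  have hk : 0 < 2 * Real.pi / L := by positivity
  calc _ ≤ 2 * Real.pi / L * (2 * (‖modeVec M‖ * ‖v M‖)) := by
        gcongr
        exact norm_cross_le _ _
    _ ≤ 2 * Real.pi / L * (2 * (supN M * ‖v M‖)) := by
        gcongr
        exact norm_modeVec_le M
    _ = _ := by ring

theorem enorm_cross_curl_le {L : ℝ} (hL : 0 < L) (u v : FourierField) (J K : Mode) :
    ‖crossProduct (u J) (curl L v (K - J))‖ₑ ≤ ENNReal.ofReal (4 * (2 * Real.pi / L)) *
      (coeffNorm u J * (supN (K - J) * coeffNorm v (K - J))) := by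
  have hk : 0 < 2 * Real.pi / L := by positivity
  simp only [coeffNorm, ← ofReal_norm, ← ENNReal.ofReal_natCast]
  rw [← ENNReal.ofReal_mul (by positivity), ← ENNReal.ofReal_mul (by positivity),
    ← ENNReal.ofReal_mul (by positivity)]
  apply ENNReal.ofReal_le_ofReal
  calc _ ≤ 2 * (‖u J‖ * ‖curl L v (K - J)‖) := norm_cross_le _ _
    _ ≤ 2 * (‖u J‖ * (2 * (2 * Real.pi / L) * (supN (K - J) * ‖v (K - J)‖))) := by
        gcongr
        exact norm_curl_le hL v _
    _ = _ := by ring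

theorem summable_of_tsum_enorm {ι E : Type*} [NormedAddCommGroup E] [CompleteSpace E] {f : ι → E}
    (h : ∑' i, ‖f i‖ₑ ≠ ⊤) : Summable f := by
  apply Summable.of_nnnorm
  rw [← ENNReal.tsum_coe_ne_top_iff_summable]
  exact h

/-- The convolution that defines `u × (∇ × v)` converges absolutely for `u ∈ V` and `v ∈ H`. -/
theorem summable_cross {L : ℝ} (hL : 0 < L) {u v : FourierField} (hu : MemVdot 1 u)
    (hv : MemVdot 0 v) (K : Mode) :
    Summable fun J => crossProduct (u J) (curl L v (K - J)) := by
  apply summable_of_tsum_enorm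
  have hD : ∑' J, coeffNorm v (K - J) ^ 2 ≠ ⊤ := by
    rw [tsum_sub_left (fun K => coeffNorm v K ^ 2) K]
    have := wsum_coeffNorm_ne_top hv
    simpa [wsum] using this
  have fin : ∀ p : Mode → ℝ≥0∞, ∑' J, p J ^ 2 ≠ ⊤ → ∑' J, p J * coeffNorm v (K - J) ≠ ⊤ := by
    intro p hp h
    have := tsum_sq_le (f := fun J => p J * coeffNorm v (K - J)) (p := fun J => p J ^ 2)
      (q := fun J => coeffNorm v (K - J) ^ 2) fun J => le_of_eq (by ring)
    rw [h, ENNReal.top_pow (by norm_num), top_le_iff] at this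
    exact ENNReal.mul_ne_top hp hD this
  have h0 := fin (coeffNorm u) (by
    have := wsum_coeffNorm_ne_top (hu.mono zero_le_one)
    simpa [wsum] using this)
  have h1 := fin (fun J => supN J * coeffNorm u J) (by
    have := wsum_coeffNorm_ne_top hu
    simpa [wsum, mul_pow] using this)
  refine ne_top_of_le_ne_top (b := ENNReal.ofReal (4 * (2 * Real.pi / L)) *
    (supN K * ∑' J, coeffNorm u J * coeffNorm v (K - J)
      + ∑' J, supN J * coeffNorm u J * coeffNorm v (K - J))) ?_ ?_
  · exact ENNReal.mul_ne_top ENNReal.ofReal_ne_top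
      (ENNReal.add_ne_top.2 ⟨ENNReal.mul_ne_top (ENNReal.natCast_ne_top _) h0, h1⟩)
  · rw [← ENNReal.tsum_mul_left, ← ENNReal.tsum_add, ← ENNReal.tsum_mul_left]
    refine ENNReal.tsum_le_tsum fun J => (enorm_cross_curl_le hL u v J K).trans ?_
    gcongr
    have : (supN (K - J) : ℝ≥0∞) ≤ supN K + supN J := by exact_mod_cast supN_sub_le K J
    calc _ ≤ coeffNorm u J * ((supN K + supN J) * coeffNorm v (K - J)) := by gcongr
      _ = _ := by ring

theorem leray_add (x y : FourierField) : leray (x + y) = leray x + leray y := by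
  ext K i
  by_cases h : K = 0
  · simp [leray, h]
  · simp only [leray, h, if_false, Pi.add_apply, Pi.sub_apply, Pi.smul_apply, smul_eq_mul, add_mul,
      Finset.sum_add_distrib, add_div]
    ring

theorem leray_smul (c : ℂ) (x : FourierField) : leray (c • x) = c • leray x := by
  ext K i
  by_cases h : K = 0
  · simp [leray, h]
  · simp only [leray, h, if_false, Pi.sub_apply, Pi.smul_apply, smul_eq_mul, mul_assoc,
      ← Finset.mul_sum]
    ring

/-- The Leray projection does not change the pairing with a mean-free, divergence-free field. -/
theorem dotRe_leray {s : ℕ} {φ : FourierField} (hφ : MemVdot s φ) (x : FourierField) (K : Mode) :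
    dotRe (leray x K) (φ K) = dotRe (x K) (φ K) := by
  by_cases h : K = 0
  · simp [h, hφ.zero, dotRe]
  · simp only [leray, h, if_false]
    rw [dotRe_sub_left, sub_eq_self]
    set c := (∑ j, x K j * (K j : ℂ)) / (modeSq K : ℂ)
    have : ∑ i, (c • modeVec K) i * (starRingEnd ℂ) (φ K i) = 0 := by
      calc _ = c * (starRingEnd ℂ) (∑ i, (K i : ℂ) * φ K i) := by
            rw [map_sum, Finset.mul_sum]
            refine Finset.sum_congr rfl fun i _ => ?_
            simp [modeVec]
            ring
        _ = 0 := by rw [hφ.div_free K]; simp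
    rw [dotRe, ← Complex.re_sum, this, Complex.zero_re]

theorem curl_add (L : ℝ) (v w : FourierField) : curl L (v + w) = curl L v + curl L w := by
  ext1 K
  simp [curl]

theorem curl_smul (L : ℝ) (c : ℂ) (v : FourierField) : curl L (c • v) = c • curl L v := by
  ext1 K
  simp only [curl, Pi.smul_apply, map_smul]
  rw [smul_comm]

theorem Btilde_add_left {L : ℝ} (hL : 0 < L) {u g v : FourierField} (hu : MemVdot 1 u)
    (hg : MemVdot 1 g) (hv : MemVdot 0 v) : Btilde L (u + g) v = Btilde L u v + Btilde L g v := by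
  have : cross (u + g) (curl L v) = cross u (curl L v) + cross g (curl L v) := by
    ext1 K
    simp only [cross, Pi.add_apply, map_add, LinearMap.add_apply]
    exact (summable_cross hL hu hv K).tsum_add (summable_cross hL hg hv K)
  rw [Btilde, this, leray_add, Btilde, Btilde]
  abel

theorem Btilde_add_right {L : ℝ} (hL : 0 < L) {u v w : FourierField} (hu : MemVdot 1 u)
    (hv : MemVdot 0 v) (hw : MemVdot 0 w) :
    Btilde L u (v + w) = Btilde L u v + Btilde L u w := by
  have : cross u (curl L (v + w)) = cross u (curl L v) + cross u (curl L w) := by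
    ext1 K
    simp only [cross, Pi.add_apply, map_add, curl_add]
    exact (summable_cross hL hu hv K).tsum_add (summable_cross hL hu hw K)
  rw [Btilde, this, leray_add, Btilde, Btilde]
  abel

theorem Btilde_smul_right (L : ℝ) (u v : FourierField) (c : ℂ) :
    Btilde L u (c • v) = c • Btilde L u v := by
  have : cross u (curl L (c • v)) = c • cross u (curl L v) := by
    ext1 K
    simp only [cross, Pi.smul_apply, curl_smul, map_smul]
    exact tsum_const_smul'' c
  rw [Btilde, this, leray_smul, Btilde, smul_neg]

theorem enorm_dotRe_Btilde_le {L : ℝ} (hL : 0 < L) {s : ℕ} {u v φ : FourierField}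
    (hφ : MemVdot s φ) (K : Mode) :
    ‖dotRe (Btilde L u v K) (φ K)‖ₑ ≤ ENNReal.ofReal (12 * (2 * Real.pi / L)) *
      ∑' J, coeffNorm u J * (supN (K - J) * coeffNorm v (K - J)) * coeffNorm φ K := by
  have h0 : dotRe (Btilde L u v K) (φ K) = -dotRe (cross u (curl L v) K) (φ K) := by
    rw [Btilde, Pi.neg_apply, dotRe_neg_left, dotRe_leray hφ]
  have h1 : ‖cross u (curl L v) K‖ₑ ≤ ∑' J, ‖crossProduct (u J) (curl L v (K - J))‖ₑ :=
    enorm_tsum_le_tsum_enorm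
  have hk : 0 < 2 * Real.pi / L := by positivity
  rw [h0, enorm_neg]
  calc _ ≤ 3 * (‖cross u (curl L v) K‖ₑ * ‖φ K‖ₑ) := by
        simp only [← ofReal_norm]
        rw [← ENNReal.ofReal_mul (norm_nonneg _), show (3 : ℝ≥0∞) = ENNReal.ofReal 3 by norm_num,
          ← ENNReal.ofReal_mul (by norm_num)]
        exact ENNReal.ofReal_le_ofReal (abs_dotRe_le _ _)
    _ ≤ 3 * ((∑' J, ENNReal.ofReal (4 * (2 * Real.pi / L)) *
          (coeffNorm u J * (supN (K - J) * coeffNorm v (K - J)))) * ‖φ K‖ₑ) := by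
        gcongr
        exact h1.trans (ENNReal.tsum_le_tsum fun J => enorm_cross_curl_le hL u v J K)
    _ = _ := by
        rw [ENNReal.tsum_mul_left, ENNReal.tsum_mul_right,
          show (12 : ℝ) * (2 * Real.pi / L) = 3 * (4 * (2 * Real.pi / L)) by ring,
          ENNReal.ofReal_mul (by norm_num : (0 : ℝ) ≤ 3),
          show ENNReal.ofReal 3 = 3 by norm_num, coeffNorm]
        ring

theorem Btilde_pairing_of_triSum_le {L : ℝ} (hL : 0 < L) {s : ℕ} {u v φ : FourierField}
    (hφ : MemVdot s φ) {B : ℝ} (hB0 : 0 ≤ B)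
    (hB : triSum (coeffNorm u) (coeffNorm v) (coeffNorm φ) ^ 4 ≤ ENNReal.ofReal B) :
    (Summable fun K => dotRe (Btilde L u v K) (φ K)) ∧
      (∑' K, dotRe (Btilde L u v K) (φ K)) ^ 4 ≤ (12 * (2 * Real.pi / L)) ^ 4 * B := by
  have hk : 0 < 2 * Real.pi / L := by positivity
  have h1 : ∑' K, ‖dotRe (Btilde L u v K) (φ K)‖ₑ ≤ ENNReal.ofReal (12 * (2 * Real.pi / L)) *
      triSum (coeffNorm u) (coeffNorm v) (coeffNorm φ) := by
    rw [triSum, ENNReal.tsum_comm, ← ENNReal.tsum_mul_left]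
    exact ENNReal.tsum_le_tsum fun K => enorm_dotRe_Btilde_le hL hφ K
  have ht : triSum (coeffNorm u) (coeffNorm v) (coeffNorm φ) ≠ ⊤ := by
    intro h
    rw [h, ENNReal.top_pow (by norm_num), top_le_iff] at hB
    exact ENNReal.ofReal_ne_top hB
  refine ⟨summable_of_tsum_enorm
    (ne_top_of_le_ne_top (ENNReal.mul_ne_top ENNReal.ofReal_ne_top ht) h1), ?_⟩
  set X := ∑' K, dotRe (Btilde L u v K) (φ K)
  have h2 : ‖X‖ₑ ≤ _ := (enorm_tsum_le_tsum_enorm).trans h1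
  have h3 : ENNReal.ofReal (X ^ 4) ≤ ENNReal.ofReal ((12 * (2 * Real.pi / L)) ^ 4 * B) := by
    calc ENNReal.ofReal (X ^ 4) = ‖X‖ₑ ^ 4 := by
          rw [Real.enorm_eq_ofReal_abs, ← ENNReal.ofReal_pow (abs_nonneg _),
            Even.pow_abs (by decide)]
      _ ≤ (ENNReal.ofReal (12 * (2 * Real.pi / L)) *
          triSum (coeffNorm u) (coeffNorm v) (coeffNorm φ)) ^ 4 := by gcongr
      _ = ENNReal.ofReal ((12 * (2 * Real.pi / L)) ^ 4) *
          triSum (coeffNorm u) (coeffNorm v) (coeffNorm φ) ^ 4 := by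
          rw [mul_pow, ENNReal.ofReal_pow (by positivity)]
      _ ≤ ENNReal.ofReal ((12 * (2 * Real.pi / L)) ^ 4) * ENNReal.ofReal B := by gcongr
      _ = _ := (ENNReal.ofReal_mul (by positivity)).symm
  exact (ENNReal.ofReal_le_ofReal_iff (by positivity)).1 h3

/-- The absolute constant in the estimates of the trilinear form. -/
noncomputable def triConst : ℝ := 12 ^ 4 * 100000000

theorem triConst_scale {L : ℝ} (hL : 0 < L) {Y x : ℝ} (hx : 0 ≤ x) {i j k : ℕ}
    (hijk : i + j + k = 10) (hY : Y ^ 4 ≤ (12 * (2 * Real.pi / L)) ^ 4 * (100000000 * x)) :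
    (L ^ 3 * Y) ^ 4 ≤ triConst * ((L ^ 3) ^ 6 * (2 * Real.pi / L) ^ (i + j + k) * x) := by
  have hk : 0 < 2 * Real.pi / L := by positivity
  have h1 : 1 ≤ (L * (2 * Real.pi / L)) := by
    rw [mul_div_cancel₀ _ hL.ne']
    linarith [Real.pi_gt_three]
  have h2 : (1 : ℝ) ≤ (L * (2 * Real.pi / L)) ^ 6 := one_le_pow₀ h1
  calc (L ^ 3 * Y) ^ 4 = L ^ 12 * Y ^ 4 := by ring
    _ ≤ L ^ 12 * ((12 * (2 * Real.pi / L)) ^ 4 * (100000000 * x)) := by gcongr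
    _ = triConst * (L ^ 12 * (2 * Real.pi / L) ^ 4 * x) * 1 := by rw [triConst]; ring
    _ ≤ triConst * (L ^ 12 * (2 * Real.pi / L) ^ 4 * x) * (L * (2 * Real.pi / L)) ^ 6 := by
        have : 0 ≤ triConst * (L ^ 12 * (2 * Real.pi / L) ^ 4 * x) := by
          unfold triConst; positivity
        gcongr
    _ = _ := by rw [hijk, mul_pow]; ring

/-- The pairing of `B̃(u, v)` with `φ`, where `u ∈ V`, `v ∈ H`, `φ ∈ D(A)`. The derivative on `v` is
moved to the other factors. -/
theorem Btilde_pairing_DA {L : ℝ} (hL : 0 < L) {u v φ : FourierField}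
    (hu : MemVdot 1 u) (hv : MemVdot 0 v) (hφ : MemVdot 2 φ) :
    (Summable fun K => dotRe (Btilde L u v K) (φ K)) ∧
      (L ^ 3 * ∑' K, dotRe (Btilde L u v K) (φ K)) ^ 4
        ≤ triConst * (sobSq L 1 u ^ 2 * sobSq L 0 v ^ 2 * (sobSq L 1 φ * sobSq L 2 φ)) := by
  have hφ1 := hφ.mono (show 1 ≤ 2 by norm_num)
  have n1 := latSq_nonneg 1 u
  have n2 := latSq_nonneg 0 v
  have n3 := latSq_nonneg 1 φ
  have n4 := latSq_nonneg 2 φ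
  have key := Btilde_pairing_of_triSum_le (u := u) (v := v) hL hφ
    (B := 100000000 * (latSq 1 u ^ 2 * latSq 0 v ^ 2 * (latSq 1 φ * latSq 2 φ))) (by positivity) ?_
  · refine ⟨key.1, ?_⟩
    refine (triConst_scale hL (by positivity) (i := 4) (j := 2) (k := 4) rfl key.2).trans
      (le_of_eq ?_)
    simp only [sobSq_eq_latSq]
    ring
  · refine (triSum_pow_four_le_of_deriv_last _ _ _ hu.coeffNorm_zero hφ.coeffNorm_zero).trans ?_
    rw [ENNReal.ofReal_mul (by norm_num), ENNReal.ofReal_mul (by positivity),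
      ENNReal.ofReal_mul (by positivity), ENNReal.ofReal_mul (by positivity),
      ENNReal.ofReal_pow n1, ENNReal.ofReal_pow n2,
      show ENNReal.ofReal 100000000 = 100000000 by norm_num]
    gcongr
    · exact wsum_coeffNorm_le hu
    · exact wsum_coeffNorm_le hv
    · exact wsum_coeffNorm_le hφ1
    · exact wsum_coeffNorm_le hφ

/-- The pairing of `B̃(u, v)` with `φ`, where `u`, `v` and `φ` are in `V`. The derivative stays
on `v`. -/
theorem Btilde_pairing_V {L : ℝ} (hL : 0 < L) {u v φ : FourierField}
    (hu : MemVdot 1 u) (hv : MemVdot 1 v) (hφ : MemVdot 1 φ) :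
    (Summable fun K => dotRe (Btilde L u v K) (φ K)) ∧
      (L ^ 3 * ∑' K, dotRe (Btilde L u v K) (φ K)) ^ 4
        ≤ triConst * (sobSq L 1 u ^ 2 * sobSq L 1 v ^ 2 * (sobSq L 0 φ * sobSq L 1 φ)) := by
  have hφ1 := hφ.mono (show 0 ≤ 1 by norm_num)
  have n1 := latSq_nonneg 1 u
  have n2 := latSq_nonneg 1 v
  have n3 := latSq_nonneg 0 φ
  have n4 := latSq_nonneg 1 φ
  have key := Btilde_pairing_of_triSum_le (u := u) (v := v) hL hφ
    (B := 100000000 * (latSq 1 u ^ 2 * latSq 1 v ^ 2 * (latSq 0 φ * latSq 1 φ))) (by positivity) ?_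
  · refine ⟨key.1, ?_⟩
    refine (triConst_scale hL (by positivity) (i := 4) (j := 4) (k := 2) rfl key.2).trans
      (le_of_eq ?_)
    simp only [sobSq_eq_latSq]
    ring
  · refine (triSum_pow_four_le_of_deriv_mid _ _ _ hu.coeffNorm_zero hφ.coeffNorm_zero).trans ?_
    rw [ENNReal.ofReal_mul (by norm_num), ENNReal.ofReal_mul (by positivity),
      ENNReal.ofReal_mul (by positivity), ENNReal.ofReal_mul (by positivity),
      ENNReal.ofReal_pow n1, ENNReal.ofReal_pow n2,
      show ENNReal.ofReal 100000000 = 100000000 by norm_num]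
    gcongr
    · norm_num
    · exact wsum_coeffNorm_le hu
    · exact wsum_coeffNorm_le hv
    · exact wsum_coeffNorm_le hφ1
    · exact wsum_coeffNorm_le hφ

/-- The orthogonality `⟨B̃(g, z), g⟩ = 0`. With `ĝ_{-K}` for the conjugate of `ĝ_K`, the double
series changes sign under `(J, K) ↦ (-K, -J)`. -/
theorem Btilde_pairing_self {L : ℝ} (hL : 0 < L) {g z : FourierField} (hg : MemVdot 2 g)
    (hz : MemVdot 0 z) : ∑' K, dotRe (Btilde L g z K) (g K) = 0 := by
  have hg1 := hg.mono (show 1 ≤ 2 by norm_num)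
  set c := curl L z with hc
  set F : Mode × Mode → ℝ := fun x => dotRe (crossProduct (g x.2) (c (x.1 - x.2))) (g x.1) with hF
  have h0 : ∀ K, HasSum (fun J => F (K, J)) (-dotRe (Btilde L g z K) (g K)) := by
    intro K
    have e : -dotRe (Btilde L g z K) (g K) = dotRe (cross g c K) (g K) := by
      rw [Btilde, Pi.neg_apply, dotRe_neg_left, dotRe_leray hg, neg_neg]
    rw [e]
    exact (summable_cross hL hg1 hz K).hasSum.dotRe_left (g K)
  have ht : triSum (coeffNorm g) (coeffNorm z) (coeffNorm g) ≠ ⊤ := by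
    intro h
    have := triSum_pow_four_le_of_deriv_last _ (coeffNorm z) _ hg.coeffNorm_zero hg.coeffNorm_zero
    rw [h, ENNReal.top_pow (by norm_num), top_le_iff] at this
    refine ENNReal.mul_ne_top (by norm_num) (ENNReal.mul_ne_top (ENNReal.mul_ne_top ?_ ?_)
      (ENNReal.mul_ne_top ?_ ?_)) this
    · exact ENNReal.pow_ne_top (wsum_coeffNorm_ne_top hg1)
    · exact ENNReal.pow_ne_top (wsum_coeffNorm_ne_top hz)
    · exact wsum_coeffNorm_ne_top hg1
    · exact wsum_coeffNorm_ne_top hg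
  have hsum : Summable F := by
    apply summable_of_tsum_enorm
    refine ne_top_of_le_ne_top (b := ENNReal.ofReal (12 * (2 * Real.pi / L)) *
      triSum (coeffNorm g) (coeffNorm z) (coeffNorm g)) (ENNReal.mul_ne_top ENNReal.ofReal_ne_top ht) ?_
    rw [ENNReal.tsum_prod (f := fun K J => ‖F (K, J)‖ₑ), triSum, ENNReal.tsum_comm,
      ← ENNReal.tsum_mul_left]
    refine ENNReal.tsum_le_tsum fun J => ?_
    rw [← ENNReal.tsum_mul_left]
    refine ENNReal.tsum_le_tsum fun K => ?_
    calc ‖F (K, J)‖ₑ ≤ 3 * (‖crossProduct (g J) (c (K - J))‖ₑ * ‖g K‖ₑ) := by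
          simp only [← ofReal_norm]
          rw [← ENNReal.ofReal_mul (norm_nonneg _), show (3 : ℝ≥0∞) = ENNReal.ofReal 3 by norm_num,
            ← ENNReal.ofReal_mul (by norm_num)]
          exact ENNReal.ofReal_le_ofReal (abs_dotRe_le _ _)
      _ ≤ 3 * (ENNReal.ofReal (4 * (2 * Real.pi / L)) *
          (coeffNorm g J * (supN (K - J) * coeffNorm z (K - J))) * ‖g K‖ₑ) := by
          gcongr
          exact enorm_cross_curl_le hL g z J K
      _ = _ := by
          rw [show (12 : ℝ) * (2 * Real.pi / L) = 3 * (4 * (2 * Real.pi / L)) by ring,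
            ENNReal.ofReal_mul (by norm_num : (0 : ℝ) ≤ 3),
            show ENNReal.ofReal 3 = 3 by norm_num]
          simp only [coeffNorm]
          ring
  let σ : Mode × Mode ≃ Mode × Mode :=
    ⟨fun x => (-x.2, -x.1), fun x => (-x.2, -x.1), fun x => by simp, fun x => by simp⟩
  have hanti : ∀ x, F (σ x) = -F x := by
    rintro ⟨K, J⟩
    have hr : ∀ M i, (starRingEnd ℂ) (g M i) = g (-M) i := fun M i => (hg.real M i).symm
    simp only [F, σ, Equiv.coe_fn_mk, dotRe, hr, neg_neg, ← Complex.re_sum,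
      show -J - -K = K - J by abel]
    rw [← Complex.neg_re]
    congr 1
    simp only [cross_apply, Fin.sum_univ_three, Matrix.cons_val_zero, Matrix.cons_val_one,
      Matrix.cons_val]
    ring
  have hzero : ∑' x, F x = 0 := by
    have h1 := σ.tsum_eq F
    simp_rw [hanti, tsum_neg] at h1
    linarith
  rw [hsum.tsum_prod' (fun K => (h0 K).summable)] at hzero
  simp_rw [fun K => (h0 K).tsum_eq, tsum_neg] at hzero
  linarith

/-! ### Absolutely continuous functions of time -/

/-- The product rule for primitives of integrable functions. -/
theorem mul_eq_add_integral_of_primitive {f g f' g' : ℝ → ℝ} {T : ℝ} (hT : 0 ≤ T)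
    (hf : ∀ t ∈ Set.Icc 0 T, f t = f 0 + ∫ s in (0 : ℝ)..t, f' s)
    (hg : ∀ t ∈ Set.Icc 0 T, g t = g 0 + ∫ s in (0 : ℝ)..t, g' s)
    (hf' : IntervalIntegrable f' volume 0 T) (hg' : IntervalIntegrable g' volume 0 T) :
    f T * g T = f 0 * g 0 + ∫ s in (0 : ℝ)..T, (f' s * g s + f s * g' s) := by
  set F : ℝ → ℝ := fun t => f 0 + ∫ s in (0 : ℝ)..t, f' s with hF
  set G : ℝ → ℝ := fun t => g 0 + ∫ s in (0 : ℝ)..t, g' s with hG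
  have hc : ∀ c : ℝ, AbsolutelyContinuousOnInterval (fun _ : ℝ => c) 0 T := fun c =>
    ((LipschitzWith.const c).lipschitzOnWith (s := Set.uIcc 0 T)).absolutelyContinuousOnInterval
  have hFac : AbsolutelyContinuousOnInterval F 0 T :=
    (hc (f 0)).add (hf'.absolutelyContinuousOnInterval_intervalIntegral (c := 0) (by simp))
  have hGac : AbsolutelyContinuousOnInterval G 0 T :=
    (hc (g 0)).add (hg'.absolutelyContinuousOnInterval_intervalIntegral (c := 0) (by simp))
  have h := hFac.integral_deriv_mul_eq_sub hGac
  have hF0 : F 0 = f 0 := by simp [hF]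
  have hG0 : G 0 = g 0 := by simp [hG]
  have hFT : F T = f T := (hf T ⟨hT, le_rfl⟩).symm
  have hGT : G T = g T := (hg T ⟨hT, le_rfl⟩).symm
  rw [hF0, hG0, hFT, hGT] at h
  rw [← sub_eq_iff_eq_add', ← h]
  apply intervalIntegral.integral_congr_ae
  filter_upwards [hf'.ae_hasDerivAt_integral, hg'.ae_hasDerivAt_integral] with t h1 h2 ht
  rw [Set.uIoc_of_le hT] at ht
  have ht' : t ∈ Set.Icc 0 T := ⟨ht.1.le, ht.2⟩
  have ht'' : t ∈ Set.uIcc 0 T := by rwa [Set.uIcc_of_le hT]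
  have d1 : HasDerivAt F (f' t) t := (h1 ht'' 0 (by simp)).const_add _
  have d2 : HasDerivAt G (g' t) t := (h2 ht'' 0 (by simp)).const_add _
  rw [d1.deriv, d2.deriv, show F t = f t from (hf t ht').symm, show G t = g t from (hg t ht').symm]

theorem continuousOn_of_primitive {f f' : ℝ → ℝ} {T : ℝ} (hT : 0 ≤ T)
    (hf : ∀ t ∈ Set.Icc 0 T, f t = f 0 + ∫ s in (0 : ℝ)..t, f' s)
    (hf' : IntervalIntegrable f' volume 0 T) : ContinuousOn f (Set.Icc 0 T) := by
  have h := (hf'.absolutelyContinuousOnInterval_intervalIntegral (c := 0) (by simp)).continuousOn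
  rw [Set.uIcc_of_le hT] at h
  exact (continuousOn_const.add h).congr hf

/-- Gronwall's inequality for an absolutely continuous function with constant forcing. -/
theorem gronwall_of_primitive {E ψ : ℝ → ℝ} {a F T : ℝ} (ha : 0 < a) (hF : 0 ≤ F) (hT : 0 ≤ T)
    (hE : ∀ t, 0 ≤ t → IntervalIntegrable ψ volume 0 t ∧ E t = E 0 + ∫ s in (0 : ℝ)..t, ψ s)
    (hψ : ∀ᵐ t ∂(volume.restrict (Set.Ici (0 : ℝ))), ψ t ≤ -a * E t + F) :
    E T ≤ Real.exp (-a * T) * E 0 + F / a := by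
  have hexp : ∀ t : ℝ, HasDerivAt (fun s : ℝ => Real.exp (a * s)) (a * Real.exp (a * t)) t := by
    intro t
    have := ((hasDerivAt_id t).const_mul a).exp
    simpa [mul_comm] using this
  have hci : ∀ t : ℝ, IntervalIntegrable (fun s : ℝ => a * Real.exp (a * s)) volume 0 t := fun t =>
    (by fun_prop : Continuous fun s : ℝ => a * Real.exp (a * s)).intervalIntegrable _ _
  have hint : ∀ t : ℝ, ∫ s in (0 : ℝ)..t, a * Real.exp (a * s) = Real.exp (a * t) - 1 := fun t => by
    rw [intervalIntegral.integral_eq_sub_of_hasDerivAt (fun x _ => hexp x) (hci t)]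
    simp
  have hEp : ∀ t ∈ Set.Icc 0 T, E t = E 0 + ∫ s in (0 : ℝ)..t, ψ s := fun t ht => (hE t ht.1).2
  have hψi := (hE T hT).1
  have key := mul_eq_add_integral_of_primitive (g := fun s => Real.exp (a * s)) hT hEp
    (fun t _ => by rw [hint t]; simp) hψi (hci T)
  have hEc := continuousOn_of_primitive hT hEp hψi
  have hec : ContinuousOn (fun s : ℝ => Real.exp (a * s)) (Set.uIcc 0 T) := by fun_prop
  have hi : IntervalIntegrable
      (fun s => ψ s * Real.exp (a * s) + E s * (a * Real.exp (a * s))) volume 0 T := by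
    refine (hψi.mul_continuousOn hec).add (ContinuousOn.intervalIntegrable ?_)
    rw [Set.uIcc_of_le hT] at hec ⊢
    exact hEc.mul (continuousOn_const.mul hec)
  have hle : ∫ s in (0 : ℝ)..T, (ψ s * Real.exp (a * s) + E s * (a * Real.exp (a * s)))
      ≤ ∫ s in (0 : ℝ)..T, F / a * (a * Real.exp (a * s)) := by
    refine intervalIntegral.integral_mono_ae_restrict hT hi ((hci T).const_mul _) ?_
    have := ae_restrict_of_ae_restrict_of_subset (s := Set.Icc 0 T) Set.Icc_subset_Ici_self hψ
    filter_upwards [this] with s hs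
    have e := Real.exp_pos (a * s)
    have : F / a * (a * Real.exp (a * s)) = F * Real.exp (a * s) := by field_simp
    rw [this]
    nlinarith
  rw [intervalIntegral.integral_const_mul, hint T] at hle
  simp only [mul_zero, Real.exp_zero, mul_one] at key
  have e1 : Real.exp (-a * T) * Real.exp (a * T) = 1 := by
    rw [← Real.exp_add]
    simp
  have e2 := Real.exp_pos (-a * T)
  have hFa : 0 ≤ F / a := by positivity
  calc E T = Real.exp (-a * T) * (E T * Real.exp (a * T)) := by
        rw [mul_left_comm, e1, mul_one]
    _ ≤ Real.exp (-a * T) * (E 0 + F / a * (Real.exp (a * T) - 1)) := by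
        rw [key]
        gcongr
    _ = Real.exp (-a * T) * E 0 + F / a * (Real.exp (-a * T) * Real.exp (a * T))
          - F / a * Real.exp (-a * T) := by ring
    _ ≤ _ := by
        rw [e1]
        have := mul_nonneg hFa e2.le
        linarith

theorem norm_sq_eq_add_integral {y y' : ℝ → ℂ} {T : ℝ} (hT : 0 ≤ T)
    (hy : ∀ t ∈ Set.Icc 0 T, y t = y 0 + ∫ s in (0 : ℝ)..t, y' s)
    (hy' : IntervalIntegrable y' volume 0 T) :
    ‖y T‖ ^ 2 = ‖y 0‖ ^ 2 + ∫ s in (0 : ℝ)..T, 2 * (y' s * (starRingEnd ℂ) (y s)).re := by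
  have hsub : ∀ t ∈ Set.Icc 0 T, IntervalIntegrable y' volume 0 t := fun t ht =>
    hy'.mono_set (by
      rw [Set.uIcc_of_le ht.1, Set.uIcc_of_le hT]
      exact Set.Icc_subset_Icc_right ht.2)
  have hre : IntervalIntegrable (fun s => (y' s).re) volume 0 T := by
    rw [intervalIntegrable_iff] at hy' ⊢
    exact hy'.re
  have him : IntervalIntegrable (fun s => (y' s).im) volume 0 T := by
    rw [intervalIntegrable_iff] at hy' ⊢
    exact hy'.im
  have pre : ∀ t ∈ Set.Icc 0 T, (y t).re = (y 0).re + ∫ s in (0 : ℝ)..t, (y' s).re := by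
    intro t ht
    rw [hy t ht, Complex.add_re]
    congr 1
    exact (Complex.reCLM.intervalIntegral_comp_comm (hsub t ht)).symm
  have pim : ∀ t ∈ Set.Icc 0 T, (y t).im = (y 0).im + ∫ s in (0 : ℝ)..t, (y' s).im := by
    intro t ht
    rw [hy t ht, Complex.add_im]
    congr 1
    exact (Complex.imCLM.intervalIntegral_comp_comm (hsub t ht)).symm
  have k1 := mul_eq_add_integral_of_primitive (f := fun t => (y t).re) (g := fun t => (y t).re)
    hT pre pre hre hre
  have k2 := mul_eq_add_integral_of_primitive (f := fun t => (y t).im) (g := fun t => (y t).im)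
    hT pim pim him him
  have c1 := continuousOn_of_primitive (f := fun t => (y t).re) hT pre hre
  have c2 := continuousOn_of_primitive (f := fun t => (y t).im) hT pim him
  rw [← Set.uIcc_of_le hT] at c1 c2
  have hn : ∀ z : ℂ, ‖z‖ ^ 2 = z.re * z.re + z.im * z.im := fun z => by
    rw [← Complex.normSq_eq_norm_sq, Complex.normSq_apply]
  have hint : ∫ s in (0 : ℝ)..T, 2 * (y' s * (starRingEnd ℂ) (y s)).re
      = (∫ s in (0 : ℝ)..T, ((y' s).re * (y s).re + (y s).re * (y' s).re))
        + ∫ s in (0 : ℝ)..T, ((y' s).im * (y s).im + (y s).im * (y' s).im) := by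
    rw [← intervalIntegral.integral_add]
    · refine intervalIntegral.integral_congr fun s _ => ?_
      simp [Complex.mul_re]
      ring
    · exact (hre.mul_continuousOn c1).add (hre.continuousOn_mul c1)
    · exact (him.mul_continuousOn c2).add (him.continuousOn_mul c2)
  rw [hn, hn, hint]
  linarith

/-! ### The energy identity -/

theorem sobSq_add_le {L : ℝ} (hL : 0 < L) {s : ℕ} {u v : FourierField} (hu : MemVdot s u)
    (hv : MemVdot s v) : sobSq L s (u + v) ≤ 2 * sobSq L s u + 2 * sobSq L s v := by
  refine hasSum_le (fun K => ?_) ((hu.add hv).hasSum_sobSq L)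
    (((hu.hasSum_sobSq L).mul_left 2).add ((hv.hasSum_sobSq L).mul_left 2))
  have h1 := vecSq_add_le (u K) (v K)
  have h2 := pow_nonneg (waveSq_nonneg L K) s
  calc L ^ 3 * (waveSq L K ^ s * vecSq ((u + v) K))
      ≤ L ^ 3 * (waveSq L K ^ s * (2 * vecSq (u K) + 2 * vecSq (v K))) := by
        gcongr
        exact h1
    _ = _ := by ring

theorem sobSq_neg (L : ℝ) (s : ℕ) (u : FourierField) : sobSq L s (-u) = sobSq L s u := by
  simp [sobSq, vecSq_neg]

theorem restrict_Icc_le_Ici (T : ℝ) :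
    (volume.restrict (Set.Icc 0 T) : Measure ℝ) ≤ volume.restrict (Set.Ici 0) :=
  Measure.restrict_mono_set _ Set.Icc_subset_Ici_self

theorem L2Loc.aemeasurable_sobSq {L : ℝ} (hL : 0 < L) {s : ℕ} {u : ℝ → FourierField}
    (hu : L2Loc L s u) :
    AEMeasurable (fun t => ENNReal.ofReal (sobSq L s (u t))) (volume.restrict (Set.Ici 0)) := by
  have h : AEMeasurable
      (fun t => ∑' K, ENNReal.ofReal (L ^ 3 * (waveSq L K ^ s * vecSq (u t K))))
      (volume.restrict (Set.Ici 0)) := by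
    refine AEMeasurable.tsum fun K => ?_
    have : AEMeasurable (fun t => vecSq (u t K)) (volume.restrict (Set.Ici 0)) := by
      refine Finset.aemeasurable_fun_sum _ fun i _ => ?_
      exact (hu.meas K i).norm.aemeasurable.pow_const 2
    exact ((this.const_mul _).const_mul _).ennreal_ofReal
  refine h.congr ?_
  filter_upwards [hu.mem] with t ht
  have hs := ht.hasSum_sobSq L
  rw [← hs.tsum_eq, ENNReal.ofReal_tsum_of_nonneg _ hs.summable]
  intro K
  have := waveSq_nonneg L K
  have := vecSq_nonneg (u t K)
  positivity

theorem L2Loc.sub {L : ℝ} (hL : 0 < L) {s : ℕ} {u v : ℝ → FourierField}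
    (hu : L2Loc L s u) (hv : L2Loc L s v) : L2Loc L s fun t => u t - v t where
  meas K i := (hu.meas K i).sub (hv.meas K i)
  mem := by
    filter_upwards [hu.mem, hv.mem] with t h1 h2 using h1.sub h2
  finite T hT := by
    refine ne_top_of_le_ne_top (b := ∫⁻ t in Set.Icc 0 T, (2 * ENNReal.ofReal (sobSq L s (u t))
      + 2 * ENNReal.ofReal (sobSq L s (v t)))) ?_ ?_
    · have m := (hu.aemeasurable_sobSq hL).mono_measure (restrict_Icc_le_Ici T)
      rw [lintegral_add_left' (m.const_mul 2), lintegral_const_mul' _ _ (by norm_num),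
        lintegral_const_mul' _ _ (by norm_num)]
      exact ENNReal.add_ne_top.2 ⟨ENNReal.mul_ne_top (by norm_num) (hu.finite T hT),
        ENNReal.mul_ne_top (by norm_num) (hv.finite T hT)⟩
    · refine lintegral_mono_ae ?_
      filter_upwards [ae_mono (restrict_Icc_le_Ici T) hu.mem,
        ae_mono (restrict_Icc_le_Ici T) hv.mem] with t h1 h2
      have h := sobSq_add_le hL h1 h2.neg
      rw [sobSq_neg, ← sub_eq_add_neg] at h
      refine (ENNReal.ofReal_le_ofReal h).trans (le_of_eq ?_)
      have n1 := sobSq_nonneg hL s (u t)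
      have n2 := sobSq_nonneg hL s (v t)
      rw [ENNReal.ofReal_add (by positivity) (by positivity), ENNReal.ofReal_mul (by norm_num),
        ENNReal.ofReal_mul (by norm_num), show ENNReal.ofReal 2 = 2 by norm_num]

theorem sq_norm_le_sobSq {L : ℝ} (hL : 0 < L) {u : FourierField} (hu : MemVdot 0 u)
    (K : Mode) (i : Fin 3) : ‖u K i‖ ^ 2 ≤ (L ^ 3)⁻¹ * sobSq L 0 u := by
  have h := hu.hasSum_sobSq L
  have h1 : L ^ 3 * (waveSq L K ^ 0 * vecSq (u K)) ≤ sobSq L 0 u := by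
    refine le_hasSum h K fun J _ => ?_
    have := vecSq_nonneg (u J)
    simp only [pow_zero]
    positivity
  have h2 : ‖u K i‖ ^ 2 ≤ vecSq (u K) :=
    Finset.single_le_sum (f := fun i => ‖u K i‖ ^ 2) (fun _ _ => sq_nonneg _) (Finset.mem_univ i)
  rw [← div_eq_inv_mul, le_div_iff₀ (by positivity)]
  simp only [pow_zero, one_mul] at h1
  nlinarith [pow_pos hL 3]

theorem L2Loc.intervalIntegrable {L : ℝ} (hL : 0 < L) {u : ℝ → FourierField}
    (hu : L2Loc L 0 u) (K : Mode) (i : Fin 3) {T : ℝ} (hT : 0 ≤ T) :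
    IntervalIntegrable (fun t => u t K i) volume 0 T := by
  rcases hT.eq_or_lt with rfl | hT
  · exact IntervalIntegrable.refl
  rw [intervalIntegrable_iff_integrableOn_Icc_of_le hT.le]
  have m := (hu.meas K i).mono_measure (restrict_Icc_le_Ici T)
  refine MemLp.integrable (q := 2) (by norm_num) ⟨m, ?_⟩
  rw [eLpNorm_lt_top_iff_lintegral_rpow_enorm_lt_top (by norm_num) (by norm_num)]
  refine lt_of_le_of_lt (b := ∫⁻ t in Set.Icc 0 T, ENNReal.ofReal ((L ^ 3)⁻¹) *
    ENNReal.ofReal (sobSq L 0 (u t))) ?_ ?_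
  · refine lintegral_mono_ae ?_
    filter_upwards [ae_mono (restrict_Icc_le_Ici T) hu.mem] with t ht
    rw [← ENNReal.ofReal_mul (by positivity)]
    norm_num
    rw [← ofReal_norm, ← ENNReal.ofReal_pow (norm_nonneg _)]
    exact ENNReal.ofReal_le_ofReal (sq_norm_le_sobSq hL ht K i)
  · rw [lintegral_const_mul' _ _ ENNReal.ofReal_ne_top]
    exact ENNReal.mul_lt_top ENNReal.ofReal_lt_top (hu.finite T hT).lt_top

theorem HasTimeDeriv.sub {L : ℝ} (hL : 0 < L) {u v u' v' : ℝ → FourierField}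
    (hu : HasTimeDeriv L u u') (hv : HasTimeDeriv L v v') :
    HasTimeDeriv L (fun t => u t - v t) (fun t => u' t - v' t) where
  l2 := hu.l2.sub hL hv.l2
  ftc t ht K i := by
    simp only [Pi.sub_apply]
    rw [intervalIntegral.integral_sub (hu.l2.intervalIntegrable hL K i ht)
      (hv.l2.intervalIntegrable hL K i ht), hu.ftc t ht K i, hv.ftc t ht K i]
    ring

/-- The energy `‖u‖² + a² ‖∇u‖²`. -/
noncomputable def energy (L a : ℝ) (u : FourierField) : ℝ := sobSq L 0 u + a ^ 2 * sobSq L 1 u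

/-- The rate of change `2 ⟨(I + a² A) u', u⟩` of the energy. -/
noncomputable def energyRate (L a : ℝ) (u' u : FourierField) : ℝ :=
  L ^ 3 * ∑' K, 2 * ((1 + a ^ 2 * waveSq L K) * dotRe (u' K) (u K))

theorem MemVdot.hasSum_energy {u : FourierField} (hu : MemVdot 1 u) (L a : ℝ) :
    HasSum (fun K => L ^ 3 * ((1 + a ^ 2 * waveSq L K) * vecSq (u K))) (energy L a u) := by
  refine (((hu.mono zero_le_one).hasSum_sobSq L).add
    ((hu.hasSum_sobSq L).mul_left (a ^ 2))).congr_fun fun K => ?_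
  ring

theorem abs_energyRate_term_le {L a : ℝ} (hL : 0 < L) {u' u : FourierField} (h0 : u 0 = 0)
    (K : Mode) : |2 * ((1 + a ^ 2 * waveSq L K) * dotRe (u' K) (u K))| ≤
      vecSq (u' K) + (1 / lambda1 L + a ^ 2) ^ 2 * (waveSq L K ^ 2 * vecSq (u K)) := by
  have hw := waveSq_nonneg L K
  have hm : (1 + a ^ 2 * waveSq L K) ^ 2 * vecSq (u K) ≤
      (1 / lambda1 L + a ^ 2) ^ 2 * (waveSq L K ^ 2 * vecSq (u K)) := by
    by_cases h : K = 0
    · simp [h, h0, vecSq_zero]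
    · have hl := lambda1_pos hL
      have h1 : 1 ≤ 1 / lambda1 L * waveSq L K := by
        rw [one_div, ← div_eq_inv_mul, one_le_div hl]
        exact lambda1_le_waveSq h
      calc _ ≤ (1 / lambda1 L * waveSq L K + a ^ 2 * waveSq L K) ^ 2 * vecSq (u K) := by
            have := vecSq_nonneg (u K)
            gcongr
        _ = _ := by ring
  refine le_trans ?_ (add_le_add_right hm _)
  have h1 := dotRe_sq_le (u' K) (u K)
  have n1 := vecSq_nonneg (u' K)
  have n2 := vecSq_nonneg (u K)
  refine abs_le_of_sq_le_sq ?_ (by positivity)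
  calc (2 * ((1 + a ^ 2 * waveSq L K) * dotRe (u' K) (u K))) ^ 2
      = 4 * ((1 + a ^ 2 * waveSq L K) ^ 2 * dotRe (u' K) (u K) ^ 2) := by ring
    _ ≤ 4 * ((1 + a ^ 2 * waveSq L K) ^ 2 * (vecSq (u' K) * vecSq (u K))) := by gcongr
    _ ≤ _ := by
        nlinarith [sq_nonneg (vecSq (u' K) - (1 + a ^ 2 * waveSq L K) ^ 2 * vecSq (u K))]

theorem summable_energyRate {L a : ℝ} (hL : 0 < L) {u' u : FourierField} (hu' : MemVdot 0 u')
    (hu : MemVdot 2 u) :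
    Summable fun K => 2 * ((1 + a ^ 2 * waveSq L K) * dotRe (u' K) (u K)) := by
  refine Summable.of_norm_bounded (g := fun K => vecSq (u' K) +
    (1 / lambda1 L + a ^ 2) ^ 2 * (waveSq L K ^ 2 * vecSq (u K))) ?_
    fun K => abs_energyRate_term_le hL hu.zero K
  refine Summable.add ?_ ((hu.summable_wave L).mul_left _)
  simpa using hu'.summable

theorem vecSq_eq_add_integral {L : ℝ} (hL : 0 < L) {u u' : ℝ → FourierField}
    (h : HasTimeDeriv L u u') (K : Mode) {T : ℝ} (hT : 0 ≤ T) :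
    vecSq (u T K) = vecSq (u 0 K) + ∫ s in (0 : ℝ)..T, 2 * dotRe (u' s K) (u s K) := by
  have hi : ∀ i, IntervalIntegrable
      (fun s => 2 * (u' s K i * (starRingEnd ℂ) (u s K i)).re) volume 0 T := by
    intro i
    have h1 := h.l2.intervalIntegrable hL K i hT
    have hc : ContinuousOn (fun s => u s K i) (Set.uIcc 0 T) := by
      have := (intervalIntegral.continuousOn_primitive_interval' h1 (a := 0) (by simp))
      rw [Set.uIcc_of_le hT] at this ⊢
      exact (continuousOn_const.add this).congr fun t ht => h.ftc t ht.1 K i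
    have h2 := h1.mul_continuousOn (Complex.continuous_conj.comp_continuousOn hc)
    rw [intervalIntegrable_iff] at h2 ⊢
    exact h2.re.const_mul 2
  simp only [vecSq, dotRe, Finset.mul_sum]
  rw [intervalIntegral.integral_finsetSum fun i _ => hi i, ← Finset.sum_add_distrib]
  refine Finset.sum_congr rfl fun i _ => ?_
  exact norm_sq_eq_add_integral hT (fun t ht => h.ftc t ht.1 K i) (h.l2.intervalIntegrable hL K i hT)

/-- The energy identity in integrated form. It holds in every mode, and the modes can be summed
because `u' ∈ L²(0, T; H)` and `u ∈ L²(0, T; D(A))`. -/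
theorem energy_eq_add_integral {L : ℝ} (hL : 0 < L) (a : ℝ) {u u' : ℝ → FourierField}
    (h : HasTimeDeriv L u u') (h2 : L2Loc L 2 u) (hV : ∀ t, 0 ≤ t → MemVdot 1 (u t))
    {T : ℝ} (hT : 0 ≤ T) :
    IntervalIntegrable (fun s => energyRate L a (u' s) (u s)) volume 0 T ∧
      energy L a (u T) = energy L a (u 0) + ∫ s in (0 : ℝ)..T, energyRate L a (u' s) (u s) := by
  rcases hT.eq_or_lt with rfl | hT'
  · simp
  set μ : Measure ℝ := volume.restrict (Set.Ioc 0 T)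
  have hμ : μ ≤ volume.restrict (Set.Icc 0 T) := Measure.restrict_mono_set _ Set.Ioc_subset_Icc_self
  have hμ' := hμ.trans (restrict_Icc_le_Ici T)
  set F : Mode → ℝ → ℝ := fun K s => 2 * ((1 + a ^ 2 * waveSq L K) * dotRe (u' s K) (u s K))
  have hFm : ∀ K, AEStronglyMeasurable (F K) μ := by
    intro K
    have : AEStronglyMeasurable (fun s => dotRe (u' s K) (u s K)) μ := by
      refine Finset.aestronglyMeasurable_fun_sum _ fun i _ => ?_
      have m1 := (h.l2.meas K i).mono_measure hμ'
      have m2 := (h2.meas K i).mono_measure hμ'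
      exact Complex.continuous_re.comp_aestronglyMeasurable
        (m1.mul (Complex.continuous_conj.comp_aestronglyMeasurable m2))
    exact (this.const_mul _).const_mul _
  set C : ℝ := (1 / lambda1 L + a ^ 2) ^ 2
  have hL3 : 0 < (L ^ 3)⁻¹ := by positivity
  have hpt : ∀ᵐ s ∂μ, ∑' K, ‖F K s‖ₑ ≤ ENNReal.ofReal ((L ^ 3)⁻¹) *
      ENNReal.ofReal (sobSq L 0 (u' s)) + ENNReal.ofReal (C * (L ^ 3)⁻¹) *
      ENNReal.ofReal (sobSq L 2 (u s)) := by
    filter_upwards [ae_mono hμ' h.l2.mem, ae_mono hμ' h2.mem] with s m1 m2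
    have s1 : HasSum (fun K => vecSq (u' s K)) ((L ^ 3)⁻¹ * sobSq L 0 (u' s)) := by
      refine ((m1.hasSum_sobSq L).mul_left (L ^ 3)⁻¹).congr_fun fun K => ?_
      field_simp
    have s2 : HasSum (fun K => C * (waveSq L K ^ 2 * vecSq (u s K)))
        (C * (L ^ 3)⁻¹ * sobSq L 2 (u s)) := by
      refine ((m2.hasSum_sobSq L).mul_left (C * (L ^ 3)⁻¹)).congr_fun fun K => ?_
      field_simp
    have n1 := sobSq_nonneg hL 0 (u' s)
    have n2 := sobSq_nonneg hL 2 (u s)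
    rw [← ENNReal.ofReal_mul (by positivity), ← ENNReal.ofReal_mul (by positivity),
      ← ENNReal.ofReal_add (by positivity) (by positivity), ← (s1.add s2).tsum_eq,
      ENNReal.ofReal_tsum_of_nonneg _ (s1.add s2).summable]
    · refine ENNReal.tsum_le_tsum fun K => ?_
      rw [Real.enorm_eq_ofReal_abs]
      exact ENNReal.ofReal_le_ofReal (abs_energyRate_term_le hL m2.zero K)
    · intro K
      have := vecSq_nonneg (u' s K)
      have := vecSq_nonneg (u s K)
      have := waveSq_nonneg L K
      positivity
  have hfin : ∫⁻ s, ∑' K, ‖F K s‖ₑ ∂μ ≠ ⊤ := by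
    refine ne_top_of_le_ne_top ?_ (lintegral_mono_ae hpt)
    have m := (h.l2.aemeasurable_sobSq hL).mono_measure hμ'
    rw [lintegral_add_left' (m.const_mul _), lintegral_const_mul' _ _ ENNReal.ofReal_ne_top,
      lintegral_const_mul' _ _ ENNReal.ofReal_ne_top]
    refine ENNReal.add_ne_top.2 ⟨ENNReal.mul_ne_top ENNReal.ofReal_ne_top ?_,
        ENNReal.mul_ne_top ENNReal.ofReal_ne_top ?_⟩
    · exact ne_top_of_le_ne_top (h.l2.finite T hT') (lintegral_mono' hμ le_rfl)
    · exact ne_top_of_le_ne_top (h2.finite T hT') (lintegral_mono' hμ le_rfl)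
  have hfin' : ∑' K, ∫⁻ s, ‖F K s‖ₑ ∂μ ≠ ⊤ := by
    rwa [← lintegral_tsum fun K => (hFm K).enorm]
  have hψm : AEStronglyMeasurable (fun s => ∑' K, F K s) μ := by
    refine aestronglyMeasurable_of_tendsto_ae (u := (atTop : Filter (Finset Mode)))
      (f := fun A s => ∑ K ∈ A, F K s)
      (fun A => Finset.aestronglyMeasurable_fun_sum _ fun K _ => hFm K) ?_
    filter_upwards [ae_mono hμ' h.l2.mem, ae_mono hμ' h2.mem] with s m1 m2
    exact (summable_energyRate hL m1 m2).hasSum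
  have hψi : Integrable (fun s => ∑' K, F K s) μ := by
    refine ⟨hψm, lt_of_le_of_lt (lintegral_mono fun s => ?_) hfin.lt_top⟩
    exact enorm_tsum_le_tsum_enorm
  refine ⟨?_, ?_⟩
  · rw [intervalIntegrable_iff, Set.uIoc_of_le hT]
    exact hψi.const_mul (L ^ 3)
  · simp only [energyRate]
    rw [intervalIntegral.integral_const_mul, intervalIntegral.integral_of_le hT,
      integral_tsum hFm hfin']
    have e1 := (hV T hT).hasSum_energy L a
    have e0 := (hV 0 le_rfl).hasSum_energy L a
    have hd : ∀ K, L ^ 3 * ∫ s, F K s ∂μ = L ^ 3 * ((1 + a ^ 2 * waveSq L K) * vecSq (u T K))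
        - L ^ 3 * ((1 + a ^ 2 * waveSq L K) * vecSq (u 0 K)) := by
      intro K
      have := vecSq_eq_add_integral hL h K hT
      rw [intervalIntegral.integral_of_le hT] at this
      rw [this]
      have e : ∫ s, F K s ∂μ = (1 + a ^ 2 * waveSq L K) * ∫ s, 2 * dotRe (u' s K) (u s K) ∂μ := by
        rw [← integral_const_mul]
        refine integral_congr_ae (Eventually.of_forall fun s => ?_)
        simp only [F]
        ring
      rw [e]
      ring
    rw [← tsum_mul_left, tsum_congr hd, (e1.sub e0).tsum_eq]
    ring

/-! ### Pairings in `L²` -/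

/-- The inner product of `L²(Ω)`. -/
noncomputable def ip (L : ℝ) (x y : FourierField) : ℝ := L ^ 3 * ∑' K, dotRe (x K) (y K)

theorem summable_ip_and_ip_sq_le {L : ℝ} (hL : 0 < L) {x y : FourierField}
    (hx : Summable fun K => vecSq (x K)) (hy : Summable fun K => vecSq (y K)) :
    (Summable fun K => dotRe (x K) (y K)) ∧ ip L x y ^ 2 ≤ sobSq L 0 x * sobSq L 0 y := by
  have h1 : (∑' K, ‖dotRe (x K) (y K)‖ₑ) ^ 2 ≤
      ENNReal.ofReal ((∑' K, vecSq (x K)) * ∑' K, vecSq (y K)) := by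
    rw [ENNReal.ofReal_mul (tsum_nonneg fun K => vecSq_nonneg _),
      ENNReal.ofReal_tsum_of_nonneg (fun K => vecSq_nonneg _) hx,
      ENNReal.ofReal_tsum_of_nonneg (fun K => vecSq_nonneg _) hy]
    refine tsum_sq_le fun K => ?_
    rw [Real.enorm_eq_ofReal_abs, ← ENNReal.ofReal_pow (abs_nonneg _), sq_abs,
      ← ENNReal.ofReal_mul (vecSq_nonneg _)]
    exact ENNReal.ofReal_le_ofReal (dotRe_sq_le _ _)
  refine ⟨summable_of_tsum_enorm fun h => ?_, ?_⟩
  · rw [h, ENNReal.top_pow (by norm_num), top_le_iff] at h1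
    exact ENNReal.ofReal_ne_top h1
  · have h2 : (∑' K, dotRe (x K) (y K)) ^ 2 ≤ (∑' K, vecSq (x K)) * ∑' K, vecSq (y K) := by
      rw [← ENNReal.ofReal_le_ofReal_iff (mul_nonneg (tsum_nonneg fun K => vecSq_nonneg _)
        (tsum_nonneg fun K => vecSq_nonneg _))]
      refine le_trans ?_ h1
      rw [← sq_abs, ENNReal.ofReal_pow (abs_nonneg _), ← Real.enorm_eq_ofReal_abs]
      gcongr
      exact enorm_tsum_le_tsum_enorm
    simp only [ip, sobSq, pow_zero, one_mul]
    calc _ = (L ^ 3) ^ 2 * (∑' K, dotRe (x K) (y K)) ^ 2 := by ring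
      _ ≤ (L ^ 3) ^ 2 * ((∑' K, vecSq (x K)) * ∑' K, vecSq (y K)) := by gcongr
      _ = _ := by ring

theorem MemVdot.summable_vecSq {s : ℕ} {u : FourierField} (hu : MemVdot s u) :
    Summable fun K => vecSq (u K) := by
  simpa using (hu.mono (Nat.zero_le s)).summable

theorem sobSq_stokesA (L : ℝ) (u : FourierField) : sobSq L 0 (stokesA L u) = sobSq L 2 u := by
  rw [sobSq, sobSq]
  congr 1
  refine tsum_congr fun K => ?_
  rw [stokesA, vecSq_smul]
  simp

theorem dotRe_helmholtz (L a : ℝ) (u : FourierField) (K : Mode) (y : Fin 3 → ℂ) :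
    dotRe (helmholtz L a u K) y = (1 + a ^ 2 * waveSq L K) * dotRe (u K) y := by
  have : helmholtz L a u K = ((1 + a ^ 2 * waveSq L K : ℝ) : ℂ) • u K := by
    simp only [helmholtz, stokesA, Pi.add_apply, Pi.smul_apply, smul_smul]
    push_cast
    rw [add_smul, one_smul]
  rw [this, dotRe_smul_left]

theorem dotRe_stokesA (L : ℝ) (u : FourierField) (K : Mode) (y : Fin 3 → ℂ) :
    dotRe (stokesA L u K) y = waveSq L K * dotRe (u K) y := dotRe_smul_left _ _ _

theorem Btilde_helmholtz {L : ℝ} (hL : 0 < L) (a : ℝ) {u v : FourierField} (hu : MemVdot 1 u)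
    (hv : MemVdot 2 v) :
    Btilde L u (helmholtz L a v) = Btilde L u v + ((a ^ 2 : ℝ) : ℂ) • Btilde L u (stokesA L v) := by
  have h1 : MemVdot 0 (((a : ℂ) ^ 2) • stokesA L v) := by
    have := (hv.stokesA L).smul (a ^ 2)
    rwa [Complex.ofReal_pow] at this
  rw [helmholtz, Btilde_add_right hL hu (hv.mono (Nat.zero_le 2)) h1, Btilde_smul_right]
  push_cast
  rfl

/-! ### The energy inequality of the Navier–Stokes-α system -/

/-- Dissipation of the `α`-energy. The nonlinearity does no work. -/
theorem energyRate_le_of_NSAlpha {L ν α : ℝ} (hL : 0 < L) (hν : 0 < ν) {u u' f : FourierField}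
    (hu : MemVdot 2 u) (hf : MemVdot 0 f)
    (heq : helmholtz L α u' + (ν : ℂ) • stokesA L (helmholtz L α u)
      + Btilde L u (helmholtz L α u) = f) :
    energyRate L α u' u ≤
      -ν * (sobSq L 1 u + 2 * α ^ 2 * sobSq L 2 u) + sobSq L 0 f / (ν * lambda1 L) := by
  have hu1 := hu.mono (show 1 ≤ 2 by norm_num)
  have hv := hu.helmholtz L α
  have hmode : ∀ K, (1 + α ^ 2 * waveSq L K) * dotRe (u' K) (u K) = dotRe (f K) (u K)
      - ν * (waveSq L K ^ 1 * vecSq (u K) + α ^ 2 * (waveSq L K ^ 2 * vecSq (u K)))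
      - dotRe (Btilde L u (helmholtz L α u) K) (u K) := by
    intro K
    have h := congrArg (fun x => dotRe (x K) (u K)) heq
    simp only [Pi.add_apply, Pi.smul_apply, dotRe_add_left, dotRe_smul_left, dotRe_stokesA,
      dotRe_helmholtz, dotRe_self] at h
    rw [← h]
    ring
  obtain ⟨hs, hcs⟩ := summable_ip_and_ip_sq_le hL hf.summable_vecSq hu.summable_vecSq
  have hB := (Btilde_pairing_DA hL hu1 hv hu).1.hasSum
  rw [Btilde_pairing_self hL hu hv] at hB
  have hsum : HasSum (fun K => 2 * ((1 + α ^ 2 * waveSq L K) * dotRe (u' K) (u K)))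
      (2 * ((∑' K, dotRe (f K) (u K)) - ν * ((∑' K, waveSq L K ^ 1 * vecSq (u K))
        + α ^ 2 * ∑' K, waveSq L K ^ 2 * vecSq (u K)) - 0)) := by
    simp_rw [hmode]
    exact ((hs.hasSum.sub (((hu1.summable_wave L).hasSum.add
      ((hu.summable_wave L).hasSum.mul_left _)).mul_left ν)).sub hB).mul_left 2
  have hrate : energyRate L α u' u = 2 * ip L f u - 2 * ν * (sobSq L 1 u + α ^ 2 * sobSq L 2 u) := by
    rw [energyRate, hsum.tsum_eq, ip, sobSq, sobSq]
    ring
  have hp := hu1.poincare hL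
  have hl := lambda1_pos hL
  have n0 := sobSq_nonneg hL 0 f
  have n1 := sobSq_nonneg hL 0 u
  have hip : 2 * ip L f u ≤ sobSq L 0 f / (ν * lambda1 L) + ν * lambda1 L * sobSq L 0 u := by
    refine le_of_sq_le_sq ?_ (by positivity)
    have e : sobSq L 0 f / (ν * lambda1 L) * (ν * lambda1 L * sobSq L 0 u)
        = sobSq L 0 f * sobSq L 0 u := by field_simp
    nlinarith [sq_nonneg (sobSq L 0 f / (ν * lambda1 L) - ν * lambda1 L * sobSq L 0 u)]
  rw [hrate]
  nlinarith

/-! ### The energy inequality of the difference -/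

/-- Young's inequality with exponents `4/3` and `4`. -/
theorem young_four {N x y : ℝ} (hx : 0 ≤ x) (hy : 0 ≤ y) (h : N ^ 4 ≤ 256 * (x ^ 3 * y)) :
    |N| ≤ 3 * x + y := by
  have h1 : 256 * (x ^ 3 * y) ≤ (3 * x + y) ^ 4 := by
    have : (3 * x + y) ^ 4 - 256 * (x ^ 3 * y)
        = (x - y) ^ 2 * (81 * x ^ 2 + 14 * x * y + y ^ 2) := by ring
    have : 0 ≤ (x - y) ^ 2 * (81 * x ^ 2 + 14 * x * y + y ^ 2) := by positivity
    linarith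
  have h2 : |N| ^ 4 ≤ (3 * x + y) ^ 4 := by
    rw [Even.pow_abs (by decide)]
    exact h.trans h1
  exact le_of_pow_le_pow_left₀ (by norm_num) (by positivity) h2

theorem two_mul_le_of_sq_le {d R P G ε : ℝ} (hε : 0 < ε) (hP : 0 ≤ P) (hG : 0 ≤ G)
    (h : R ^ 2 ≤ P * G) : |2 * d * R| ≤ ε * G + d ^ 2 / ε * P := by
  refine abs_le_of_sq_le_sq ?_ (by positivity)
  have e : ε * G * (d ^ 2 / ε * P) = d ^ 2 * (P * G) := by field_simp
  nlinarith [sq_nonneg (ε * G - d ^ 2 / ε * P), mul_le_mul_of_nonneg_left h (sq_nonneg d)]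

theorem le_of_pow_four_le {R q C Y : ℝ} (hq : C ≤ q ^ 2) (hq0 : 0 ≤ q) (hY : 0 ≤ Y)
    (h : R ^ 4 ≤ C * Y ^ 2) : R ^ 2 ≤ q * Y := by
  refine le_of_sq_le_sq ?_ (by positivity)
  calc (R ^ 2) ^ 2 = R ^ 4 := by ring
    _ ≤ C * Y ^ 2 := h
    _ ≤ q ^ 2 * Y ^ 2 := by gcongr
    _ = _ := by ring

/-- The symbol `λ / (1 + α² λ)` of `A (I + α² A)⁻¹`. -/
noncomputable def filtA (L α : ℝ) (K : Mode) : ℝ := waveSq L K / (1 + α ^ 2 * waveSq L K)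

/-- The symbol `1 / (1 + α² λ)` of `(I + α² A)⁻¹`. -/
noncomputable def filt (L α : ℝ) (K : Mode) : ℝ := 1 / (1 + α ^ 2 * waveSq L K)

theorem one_le_helmholtz_symbol (L α : ℝ) (K : Mode) : 1 ≤ 1 + α ^ 2 * waveSq L K := by
  have := waveSq_nonneg L K
  have : 0 ≤ α ^ 2 * waveSq L K := by positivity
  linarith

theorem filt_nonneg (L α : ℝ) (K : Mode) : 0 ≤ filt L α K :=
  div_nonneg zero_le_one (zero_le_one.trans (one_le_helmholtz_symbol L α K))

theorem filt_le_one (L α : ℝ) (K : Mode) : filt L α K ≤ 1 :=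
  div_le_one_of_le₀ (one_le_helmholtz_symbol L α K)
    (zero_le_one.trans (one_le_helmholtz_symbol L α K))

theorem filtA_eq (L α : ℝ) (K : Mode) : filtA L α K = waveSq L K * filt L α K := by
  rw [filtA, filt, mul_one_div]

theorem MemVdot.filt {u : FourierField} (hu : MemVdot 2 u) (L α : ℝ) :
    MemVdot 2 (NSAlpha.fmul (NSAlpha.filt L α) u) := by
  refine hu.fmul (C := 1) (fun K => by simp [NSAlpha.filt, waveSq_neg]) fun K => ?_
  have h1 := filt_le_one L α K
  have h0 := filt_nonneg L α K
  have : NSAlpha.filt L α K ^ 2 ≤ 1 := pow_le_one₀ h0 h1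
  have := pow_nonneg (modeSq_nonneg K) 2
  nlinarith

theorem alpha_filtA_le_one {α : ℝ} (L : ℝ) (K : Mode) : α ^ 2 * filtA L α K ≤ 1 := by
  rw [filtA, ← mul_div_assoc]
  have := waveSq_nonneg L K
  refine div_le_one_of_le₀ (by linarith) (zero_le_one.trans (one_le_helmholtz_symbol L α K))

theorem filtA_nonneg (L α : ℝ) (K : Mode) : 0 ≤ filtA L α K :=
  div_nonneg (waveSq_nonneg L K) (zero_le_one.trans (one_le_helmholtz_symbol L α K))

theorem MemVdot.filtA {u : FourierField} (hu : MemVdot 2 u) (L : ℝ) {α : ℝ} (hα : 0 < α) :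
    MemVdot 2 (NSAlpha.fmul (NSAlpha.filtA L α) u) := by
  refine hu.fmul (C := (1 / α ^ 2) ^ 2) (fun K => by simp [NSAlpha.filtA, waveSq_neg]) fun K => ?_
  have h0 := filtA_nonneg L α K
  have h1 : NSAlpha.filtA L α K ≤ 1 / α ^ 2 := by
    rw [le_div_iff₀ (by positivity), mul_comm]
    exact alpha_filtA_le_one L K
  rw [mul_comm]
  have := pow_nonneg (modeSq_nonneg K) 2
  gcongr

theorem sobSq_fmul_le {L : ℝ} (hL : 0 < L) {s t : ℕ} {m : Mode → ℝ} {u : FourierField} {C : ℝ}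
    (hm : MemVdot s (fmul m u)) (hu : MemVdot t u)
    (h : ∀ K, waveSq L K ^ s * m K ^ 2 ≤ C * waveSq L K ^ t) :
    sobSq L s (fmul m u) ≤ C * sobSq L t u := by
  refine hasSum_le (fun K => ?_) (hm.hasSum_sobSq L) ((hu.hasSum_sobSq L).mul_left C)
  have := vecSq_nonneg (u K)
  rw [fmul, vecSq_smul, Complex.norm_real, Real.norm_eq_abs, sq_abs]
  calc _ = L ^ 3 * ((waveSq L K ^ s * m K ^ 2) * vecSq (u K)) := by ring
    _ ≤ L ^ 3 * ((C * waveSq L K ^ t) * vecSq (u K)) := by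
        have h3 := mul_le_mul_of_nonneg_right (h K) this
        gcongr
    _ = _ := by ring

/-- The terms of the energy balance of `g = w - u`. The equation for `u` is rewritten with the
parameter `β`; the defect `(β² - α²)(A (u' + ν A u) + B̃(u, Au))` is expressed by `f`, `B̃(u, u)` and
`B̃(u, Au)` with the help of the equation itself. -/
theorem dotRe_balance {L ν α β η : ℝ} (hL : 0 < L) {u u' w w' f X : FourierField}
    (hu : MemVdot 2 u) (hw : MemVdot 2 w)
    (hequ : helmholtz L α u' + (ν : ℂ) • stokesA L (helmholtz L α u)
      + Btilde L u (helmholtz L α u) = f)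
    (heqw : helmholtz L β w' + (ν : ℂ) • stokesA L (helmholtz L β w)
      + Btilde L w (helmholtz L β w) = f - (η : ℂ) • helmholtz L β (leray X)) (K : Mode) :
    (1 + β ^ 2 * waveSq L K) * dotRe ((w' - u') K) ((w - u) K) =
      -ν * (waveSq L K ^ 1 * vecSq ((w - u) K) + β ^ 2 * (waveSq L K ^ 2 * vecSq ((w - u) K)))
      - dotRe (Btilde L (w - u) (helmholtz L β w) K) ((w - u) K)
      - dotRe (Btilde L u (w - u) K) ((w - u) K)
      - β ^ 2 * dotRe (Btilde L u (stokesA L (w - u)) K) ((w - u) K)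
      - η * (waveSq L K ^ 0 * vecSq ((w - u) K) + β ^ 2 * (waveSq L K ^ 1 * vecSq ((w - u) K))
        + dotRe ((X - (w - u)) K) ((w - u) K)
        + β ^ 2 * dotRe ((X - (w - u)) K) (stokesA L (w - u) K))
      - (β ^ 2 - α ^ 2) * (dotRe (f K) (fmul (filtA L α) (w - u) K)
        - dotRe (Btilde L u u K) (fmul (filtA L α) (w - u) K)
        + dotRe (Btilde L u (stokesA L u) K) (fmul (filt L α) (w - u) K)) := by
  set g := w - u with hg
  have hgm : MemVdot 2 g := hw.sub hu
  have hu1 := hu.mono (show 1 ≤ 2 by norm_num)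
  have hg1 := hgm.mono (show 1 ≤ 2 by norm_num)
  have hwg : w = u + g := by rw [hg]; abel
  have hz := hw.helmholtz L β
  have hBw : Btilde L w (helmholtz L β w) = Btilde L u u
      + ((β ^ 2 : ℝ) : ℂ) • Btilde L u (stokesA L u) + (Btilde L u g
      + ((β ^ 2 : ℝ) : ℂ) • Btilde L u (stokesA L g)) + Btilde L g (helmholtz L β w) := by
    have hadd : helmholtz L β w = helmholtz L β u + helmholtz L β g := by
      rw [hwg]
      ext K i
      simp [helmholtz, stokesA]
      ring
    calc _ = Btilde L (u + g) (helmholtz L β w) := by rw [← hwg]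
      _ = Btilde L u (helmholtz L β w) + Btilde L g (helmholtz L β w) :=
          Btilde_add_left hL hu1 hg1 hz
      _ = _ := by
          rw [hadd, Btilde_add_right hL hu1 (hu.helmholtz L β) (hgm.helmholtz L β),
            Btilde_helmholtz hL β hu1 hu, Btilde_helmholtz hL β hu1 hgm]
  rw [hBw] at heqw
  rw [Btilde_helmholtz hL α hu1 hu] at hequ
  have e1 := congrArg (fun x => dotRe (x K) (g K)) hequ
  have e2 := congrArg (fun x => dotRe (x K) (g K)) heqw
  simp only [Pi.add_apply, Pi.sub_apply, Pi.smul_apply, dotRe_add_left, dotRe_sub_left,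
    dotRe_smul_left, dotRe_stokesA, dotRe_helmholtz, dotRe_leray hgm] at e1 e2
  have e3 : dotRe (w K) (g K) = dotRe (u K) (g K) + vecSq (g K) := by
    rw [← dotRe_self, ← dotRe_add_left]
    congr 1
    rw [hwg]
    rfl
  have e4 : dotRe (X K) (g K) = dotRe ((X - g) K) (g K) + vecSq (g K) := by
    rw [Pi.sub_apply, dotRe_sub_left, dotRe_self]
    ring
  have e5 : ∀ x : Fin 3 → ℂ, dotRe x (stokesA L g K) = waveSq L K * dotRe x (g K) := fun x =>
    dotRe_smul_right _ _ _
  have e6 : ∀ x : Fin 3 → ℂ, dotRe x (fmul (filtA L α) g K) = filtA L α K * dotRe x (g K) := fun x =>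
    dotRe_smul_right _ _ _
  have e7 : ∀ x : Fin 3 → ℂ, dotRe x (fmul (filt L α) g K) = filt L α K * dotRe x (g K) := fun x =>
    dotRe_smul_right _ _ _
  rw [e3, e4] at e2
  rw [e5, e6, e6, e7, filtA_eq, Pi.sub_apply, dotRe_sub_left]
  have hpos : (1 + α ^ 2 * waveSq L K) ≠ 0 :=
    (zero_lt_one.trans_le (one_le_helmholtz_symbol L α K)).ne'
  have hfilt : filt L α K * (1 + α ^ 2 * waveSq L K) = 1 := by
    rw [filt]
    field_simp
  have hu'eq : dotRe (u' K) (g K) = filt L α K * (dotRe (f K) (g K)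
      - dotRe (Btilde L u u K) (g K) - α ^ 2 * dotRe (Btilde L u (stokesA L u) K) (g K))
      - ν * (waveSq L K * dotRe (u K) (g K)) := by
    linear_combination (-dotRe (u' K) (g K) - ν * (waveSq L K * dotRe (u K) (g K))) * hfilt
      + filt L α K * e1
  rw [hu'eq]
  linear_combination e2 + (-(dotRe (f K) (g K)) + dotRe (Btilde L u u K) (g K)
    + β ^ 2 * dotRe (Btilde L u (stokesA L u) K) (g K)) * hfilt

/-- The balance of the dissipation, the nudging and the nonlinear terms. Here `Gᵢ` stands for the
squared norms of `g = w - u`, `U₂` for `‖Au‖²` and `m` for a bound of `‖∇u‖²`. -/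
theorem difference_balance_le {ν β η d q m s S P₂ U₂ l G₀ G₁ G₂ N₁ N₂ I₁ I₂ R₁ R₂ R₃ r A₁ A₂ : ℝ}
    (hν : 0 < ν) (hβ : 0 < β) (hq : 0 ≤ q) (hm : 0 ≤ m) (hs : 0 < s)
    (hS : 0 ≤ S) (hP₂ : 0 ≤ P₂) (hU₂ : 0 ≤ U₂) (hG₀ : 0 ≤ G₀) (hG₁ : 0 ≤ G₁) (hG₂ : 0 ≤ G₂)
    (hr0 : 0 ≤ r) (hl₀ : l * G₀ ≤ G₁) (hl₁ : l * G₁ ≤ G₂)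
    (hη : 576 * q ^ 2 * m ^ 2 / ν ^ 3 < η)
    (hA₁ : (η + η ^ 2 * β ^ 2 / ν) * A₁ + 432 * q ^ 2 * m ^ 2 / ν ^ 3 * β ^ 2 - η * β ^ 2
      ≤ 11 * ν / 16)
    (hA₂ : (η + η ^ 2 * β ^ 2 / ν) * A₂ ≤ ν / 4 * β ^ 2)
    (hr : r ≤ A₁ * G₁ + A₂ * G₂)
    (hN₁ : N₁ ^ 4 ≤ q ^ 2 * (m ^ 2 * G₁ ^ 2 * (G₀ * G₁)))
    (hN₂ : N₂ ^ 4 ≤ q ^ 2 * (m ^ 2 * G₂ ^ 2 * (G₁ * G₂)))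
    (hI₁ : I₁ ^ 2 ≤ r * G₀) (hI₂ : I₂ ^ 2 ≤ r * G₂)
    (hR₁ : R₁ ^ 2 ≤ S * G₂) (hR₂ : R₂ ^ 2 ≤ P₂ * G₂) (hR₃ : R₃ ^ 2 ≤ q * m / s * U₂ * G₂) :
    -2 * ν * (G₁ + β ^ 2 * G₂) - 2 * N₁ - 2 * β ^ 2 * N₂
        - 2 * η * (G₀ + β ^ 2 * G₁ + I₁ + β ^ 2 * I₂) - 2 * d * (R₁ - R₂ + R₃)
      ≤ -(l * ν / 2) * (G₀ + β ^ 2 * G₁)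
        + 24 * d ^ 2 / (ν * β ^ 2) * (S + P₂ + q * m / s * U₂) := by
  set x := q ^ 2 * m ^ 2 / ν ^ 3 with hx
  have hx0 : 0 ≤ x := by positivity
  have hxν : x * ν ^ 3 = q ^ 2 * m ^ 2 := by rw [hx]; field_simp
  have e1 : 576 * q ^ 2 * m ^ 2 / ν ^ 3 = 576 * x := by rw [hx]; ring
  have e2 : 432 * q ^ 2 * m ^ 2 / ν ^ 3 = 432 * x := by rw [hx]; ring
  rw [e1] at hη
  rw [e2] at hA₁
  have hη0 : 0 < η := lt_of_le_of_lt (by positivity) hη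
  have b1 : -2 * N₁ ≤ 3 * (ν * G₁ / 4) + 576 * x * G₀ := by
    have h : |2 * N₁| ≤ 3 * (ν * G₁ / 4) + 576 * x * G₀ := by
      refine young_four (by positivity) (by positivity) ?_
      calc (2 * N₁) ^ 4 = 16 * N₁ ^ 4 := by ring
        _ ≤ 16 * (q ^ 2 * (m ^ 2 * G₁ ^ 2 * (G₀ * G₁))) := by gcongr
        _ = 16 * ((x * ν ^ 3) * (G₁ ^ 3 * G₀)) := by rw [hxν]; ring
        _ ≤ 2304 * ((x * ν ^ 3) * (G₁ ^ 3 * G₀)) := by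
            have : 0 ≤ (x * ν ^ 3) * (G₁ ^ 3 * G₀) := by positivity
            linarith
        _ = _ := by ring
    have := neg_abs_le (2 * N₁)
    linarith
  have b2 : -2 * β ^ 2 * N₂ ≤ 3 * (ν * β ^ 2 * G₂ / 24) + 1008 * x * β ^ 2 * G₁ := by
    have h : |2 * β ^ 2 * N₂| ≤ 3 * (ν * β ^ 2 * G₂ / 24) + 1008 * x * β ^ 2 * G₁ := by
      refine young_four (by positivity) (by positivity) ?_
      calc (2 * β ^ 2 * N₂) ^ 4 = 16 * β ^ 8 * N₂ ^ 4 := by ring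
        _ ≤ 16 * β ^ 8 * (q ^ 2 * (m ^ 2 * G₂ ^ 2 * (G₁ * G₂))) := by gcongr
        _ = 16 * ((x * ν ^ 3) * (β ^ 8 * (G₂ ^ 3 * G₁))) := by rw [hxν]; ring
        _ ≤ 18 * ((x * ν ^ 3) * (β ^ 8 * (G₂ ^ 3 * G₁))) := by
            have : 0 ≤ (x * ν ^ 3) * (β ^ 8 * (G₂ ^ 3 * G₁)) := by positivity
            linarith
        _ ≤ 256 / 13824 * 1008 * ((x * ν ^ 3) * (β ^ 8 * (G₂ ^ 3 * G₁))) := by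
            have : 0 ≤ (x * ν ^ 3) * (β ^ 8 * (G₂ ^ 3 * G₁)) := by positivity
            linarith
        _ = _ := by ring
    have := neg_abs_le (2 * β ^ 2 * N₂)
    linarith
  have b3 : -2 * η * I₁ ≤ η * G₀ + η * r := by
    have h := two_mul_le_of_sq_le (d := η) hη0 hr0 hG₀ hI₁
    have e : η ^ 2 / η = η := by field_simp
    rw [e] at h
    have := neg_abs_le (2 * η * I₁)
    linarith
  have b4 : -2 * η * (β ^ 2 * I₂) ≤ ν * β ^ 2 * G₂ + η ^ 2 * β ^ 2 / ν * r := by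
    have h := two_mul_le_of_sq_le (d := η * β ^ 2) (ε := ν * β ^ 2) (by positivity) hr0 hG₂ hI₂
    have e : (η * β ^ 2) ^ 2 / (ν * β ^ 2) = η ^ 2 * β ^ 2 / ν := by field_simp
    rw [e] at h
    have := neg_abs_le (2 * (η * β ^ 2) * I₂)
    linarith
  have b5 : (η + η ^ 2 * β ^ 2 / ν) * r
      ≤ (11 * ν / 16 - 432 * x * β ^ 2 + η * β ^ 2) * G₁ + ν / 4 * β ^ 2 * G₂ := by
    calc _ ≤ (η + η ^ 2 * β ^ 2 / ν) * (A₁ * G₁ + A₂ * G₂) := by gcongr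
      _ = ((η + η ^ 2 * β ^ 2 / ν) * A₁) * G₁ + ((η + η ^ 2 * β ^ 2 / ν) * A₂) * G₂ := by ring
      _ ≤ _ := by
          gcongr
          linarith
  have bR : ∀ R P : ℝ, 0 ≤ P → R ^ 2 ≤ P * G₂ →
      |2 * d * R| ≤ ν * β ^ 2 / 24 * G₂ + 24 * d ^ 2 / (ν * β ^ 2) * P := by
    intro R P hP hR
    have h := two_mul_le_of_sq_le (d := d) (ε := ν * β ^ 2 / 24) (by positivity) hP hG₂ hR
    have e : d ^ 2 / (ν * β ^ 2 / 24) = 24 * d ^ 2 / (ν * β ^ 2) := by field_simp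
    rwa [e] at h
  have b6 := bR R₁ S hS hR₁
  have b7 := bR R₂ P₂ hP₂ hR₂
  have b8 := bR R₃ (q * m / s * U₂) (by positivity) hR₃
  have b6' := neg_abs_le (2 * d * R₁)
  have b7' := le_abs_self (2 * d * R₂)
  have b8' := neg_abs_le (2 * d * R₃)
  have c1 : 576 * x * G₀ ≤ η * G₀ := by gcongr
  have c2 : 576 * x * (β ^ 2 * G₁) ≤ η * (β ^ 2 * G₁) := by gcongr
  have c3 : ν / 2 * (l * G₀) ≤ ν / 2 * G₁ := by gcongr
  have c4 : ν / 2 * β ^ 2 * (l * G₁) ≤ ν / 2 * β ^ 2 * G₂ := by gcongr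
  have c5 : 0 ≤ ν * G₁ := by positivity
  linarith

theorem sobSq_one_filtA_le {L α : ℝ} (hL : 0 < L) (hα : 0 < α) {g : FourierField}
    (hg : MemVdot 2 g) : sobSq L 1 (fmul (filtA L α) g) ≤ sobSq L 2 g / α ^ 2 := by
  rw [div_eq_inv_mul]
  refine sobSq_fmul_le hL ((hg.filtA L hα).mono (by norm_num)) hg fun K => ?_
  have h1 := alpha_filtA_le_one (α := α) L K
  have h2 := filtA_nonneg L α K
  have h3 := waveSq_nonneg L K
  have h4 : filtA L α K ≤ waveSq L K := div_le_self h3 (one_le_helmholtz_symbol L α K)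
  rw [← div_eq_inv_mul, le_div_iff₀ (by positivity)]
  calc waveSq L K ^ 1 * filtA L α K ^ 2 * α ^ 2
      = waveSq L K * filtA L α K * (α ^ 2 * filtA L α K) := by ring
    _ ≤ waveSq L K * waveSq L K * 1 := by gcongr
    _ = _ := by ring

theorem sobSq_zero_filtA_le {L α : ℝ} (hL : 0 < L) (hα : 0 < α) {g : FourierField}
    (hg : MemVdot 2 g) : sobSq L 0 (fmul (filtA L α) g) ≤ sobSq L 2 g := by
  rw [← one_mul (sobSq L 2 g)]
  refine sobSq_fmul_le hL ((hg.filtA L hα).mono (by norm_num)) hg fun K => ?_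
  have h2 := filtA_nonneg L α K
  have h4 : filtA L α K ≤ waveSq L K :=
    div_le_self (waveSq_nonneg L K) (one_le_helmholtz_symbol L α K)
  rw [pow_zero, one_mul, one_mul]
  gcongr

theorem sobSq_two_filt_le {L : ℝ} (hL : 0 < L) (α : ℝ) {g : FourierField}
    (hg : MemVdot 2 g) : sobSq L 2 (fmul (filt L α) g) ≤ sobSq L 2 g := by
  rw [← one_mul (sobSq L 2 g)]
  refine sobSq_fmul_le hL (hg.filt L α) hg fun K => ?_
  have h : filt L α K ^ 2 ≤ 1 := pow_le_one₀ (filt_nonneg L α K) (filt_le_one L α K)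
  have := pow_nonneg (waveSq_nonneg L K) 2
  nlinarith

/-- The energy inequality of the difference of the nudged and the reference solution at a fixed
time. `X` is the observed difference `I_h (w - u)`, `m` a bound of `‖∇u‖²`, and `q` and `s` stand for
`c⁴` and `λ₁^{1/2}`. -/
theorem energyRate_difference_le {L ν α β η A₁ A₂ q m s S : ℝ} (hL : 0 < L) (hν : 0 < ν)
    (hα : 0 < α) (hβ : 0 < β) (hq : 0 ≤ q) (hqC : triConst ≤ q ^ 2) (hs : 0 < s)
    (hsl : s ^ 2 = lambda1 L) {u u' w w' f X : FourierField}
    (hu : MemVdot 2 u) (hw : MemVdot 2 w)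
    (hf : MemVdot 0 f) (hX : Summable fun K => vecSq ((X - (w - u)) K))
    (hfS : sobSq L 0 f ≤ S) (hm : sobSq L 1 u ≤ m)
    (happ : sobSq L 0 (X - (w - u)) ≤ A₁ * sobSq L 1 (w - u) + A₂ * sobSq L 2 (w - u))
    (hequ : helmholtz L α u' + (ν : ℂ) • stokesA L (helmholtz L α u)
      + Btilde L u (helmholtz L α u) = f)
    (heqw : helmholtz L β w' + (ν : ℂ) • stokesA L (helmholtz L β w)
      + Btilde L w (helmholtz L β w) = f - (η : ℂ) • helmholtz L β (leray X))
    (hη : 576 * q ^ 2 * m ^ 2 / ν ^ 3 < η)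
    (hA₁ : (η + η ^ 2 * β ^ 2 / ν) * A₁ + 432 * q ^ 2 * m ^ 2 / ν ^ 3 * β ^ 2 - η * β ^ 2
      ≤ 11 * ν / 16)
    (hA₂ : (η + η ^ 2 * β ^ 2 / ν) * A₂ ≤ ν / 4 * β ^ 2) :
    energyRate L β (w' - u') (w - u) ≤ -(lambda1 L * ν / 2) * energy L β (w - u)
      + 24 * (β ^ 2 - α ^ 2) ^ 2 / (ν * β ^ 2)
        * (S + q * m ^ 2 / (α ^ 2 * s) + q * m / s * sobSq L 2 u) := by
  have hmode := dotRe_balance (X := X) hL hu hw hequ heqw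
  set g := w - u with hgdef
  have hg : MemVdot 2 g := hw.sub hu
  have hu1 := hu.mono (show 1 ≤ 2 by norm_num)
  have hg1 := hg.mono (show 1 ≤ 2 by norm_num)
  have hg0 := hg.mono (show 0 ≤ 2 by norm_num)
  set φ₁ := fmul (filtA L α) g
  set φ₂ := fmul (filt L α) g
  have hφ₁ : MemVdot 2 φ₁ := hg.filtA L hα
  have hφ₂ : MemVdot 2 φ₂ := hg.filt L α
  have hAg := hg.stokesA L
  have hAu := hu.stokesA L
  obtain ⟨sN₁, bN₁⟩ := Btilde_pairing_V hL hu1 hg1 hg1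
  obtain ⟨sN₂, bN₂⟩ := Btilde_pairing_DA hL hu1 hAg hg
  obtain ⟨sI₁, bI₁⟩ := summable_ip_and_ip_sq_le hL hX hg.summable_vecSq
  obtain ⟨sI₂, bI₂⟩ := summable_ip_and_ip_sq_le hL hX hAg.summable_vecSq
  obtain ⟨sR₁, bR₁⟩ := summable_ip_and_ip_sq_le hL hf.summable_vecSq hφ₁.summable_vecSq
  obtain ⟨sR₂, bR₂⟩ := Btilde_pairing_V hL hu1 hu1 (hφ₁.mono (show 1 ≤ 2 by norm_num))
  obtain ⟨sR₃, bR₃⟩ := Btilde_pairing_DA hL hu1 hAu hφ₂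
  have hZ := (Btilde_pairing_DA hL hg1 (hw.helmholtz L β) hg).1.hasSum
  rw [Btilde_pairing_self hL hg (hw.helmholtz L β)] at hZ
  set N₁ := L ^ 3 * ∑' K, dotRe (Btilde L u g K) (g K) with hN₁
  set N₂ := L ^ 3 * ∑' K, dotRe (Btilde L u (stokesA L g) K) (g K) with hN₂
  set R₂ := L ^ 3 * ∑' K, dotRe (Btilde L u u K) (φ₁ K) with hR₂
  set R₃ := L ^ 3 * ∑' K, dotRe (Btilde L u (stokesA L u) K) (φ₂ K) with hR₃
  have hrate : energyRate L β (w' - u') g =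
      -2 * ν * (sobSq L 1 g + β ^ 2 * sobSq L 2 g) - 2 * N₁ - 2 * β ^ 2 * N₂
        - 2 * η * (sobSq L 0 g + β ^ 2 * sobSq L 1 g + ip L (X - g) g
          + β ^ 2 * ip L (X - g) (stokesA L g))
        - 2 * (β ^ 2 - α ^ 2) * (ip L f φ₁ - R₂ + R₃) := by
    have w0 := (hg0.summable_wave L).hasSum
    have w1 := (hg1.summable_wave L).hasSum
    have w2 := (hg.summable_wave L).hasSum
    have hsum := (((((((w1.add (w2.mul_left (β ^ 2))).mul_left (-ν)).sub hZ).sub sN₁.hasSum).sub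
      (sN₂.hasSum.mul_left (β ^ 2))).sub ((((w0.add (w1.mul_left (β ^ 2))).add sI₁.hasSum).add
      (sI₂.hasSum.mul_left (β ^ 2))).mul_left η)).sub
      (((sR₁.hasSum.sub sR₂.hasSum).add sR₃.hasSum).mul_left (β ^ 2 - α ^ 2))).mul_left 2
    rw [energyRate]
    simp_rw [hmode]
    rw [hsum.tsum_eq, hN₁, hN₂, hR₂, hR₃]
    simp only [ip, sobSq]
    ring
  have n0 := sobSq_nonneg hL 0 g
  have n1 := sobSq_nonneg hL 1 g
  have n2 := sobSq_nonneg hL 2 g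
  have u1 := sobSq_nonneg hL 1 u
  have u2 := sobSq_nonneg hL 2 u
  have hm0 : 0 ≤ m := u1.trans hm
  have hC0 : 0 ≤ triConst := by unfold triConst; positivity
  have hl := lambda1_pos hL
  have p0 := hg1.poincare hL
  have p1 := hg.poincare hL
  rw [sobSq_stokesA] at bN₂ bI₂ bR₃
  rw [hrate, energy]
  refine difference_balance_le hν hβ hq hm0 hs ((sobSq_nonneg hL 0 f).trans hfS) (by positivity) u2
    n0 n1 n2 (sobSq_nonneg hL 0 _) p0 p1 hη hA₁ hA₂ happ ?_ ?_ bI₁ bI₂ ?_ ?_ ?_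
  · refine bN₁.trans ?_
    gcongr
  · refine bN₂.trans ?_
    gcongr
  · refine bR₁.trans ?_
    have := sobSq_nonneg hL 0 φ₁
    have := (sobSq_nonneg hL 0 f).trans hfS
    gcongr
    exact sobSq_zero_filtA_le hL hα hg
  · have hΦ₁ := sobSq_one_filtA_le hL hα hg
    have hΦ₀ : sobSq L 0 φ₁ ≤ sobSq L 2 g / α ^ 2 / s ^ 2 := by
      rw [le_div_iff₀ (by positivity), mul_comm, hsl]
      exact ((hφ₁.mono (show 1 ≤ 2 by norm_num)).poincare hL).trans hΦ₁
    have n3 := sobSq_nonneg hL 0 φ₁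
    have n4 := sobSq_nonneg hL 1 φ₁
    have h : R₂ ^ 4 ≤ triConst * (m ^ 2 / (α ^ 2 * s) * sobSq L 2 g) ^ 2 := by
      refine bR₂.trans ?_
      calc _ ≤ triConst * (m ^ 2 * m ^ 2 *
            ((sobSq L 2 g / α ^ 2 / s ^ 2) * (sobSq L 2 g / α ^ 2))) := by gcongr
        _ = _ := by ring
    refine (le_of_pow_four_le hqC hq (by positivity) h).trans (le_of_eq (by ring))
  · have hΦ₂ := sobSq_two_filt_le hL α hg
    have hΦ₁ : sobSq L 1 φ₂ ≤ sobSq L 2 g / s ^ 2 := by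
      rw [le_div_iff₀ (by positivity), mul_comm, hsl]
      exact (hφ₂.poincare hL).trans hΦ₂
    have n3 := sobSq_nonneg hL 1 φ₂
    have n4 := sobSq_nonneg hL 2 φ₂
    have h : R₃ ^ 4 ≤ triConst * (m / s * sobSq L 2 u * sobSq L 2 g) ^ 2 := by
      refine bR₃.trans ?_
      calc _ ≤ triConst * (m ^ 2 * sobSq L 2 u ^ 2 * ((sobSq L 2 g / s ^ 2) * sobSq L 2 g)) := by
            gcongr
        _ = _ := by ring
    refine (le_of_pow_four_le hqC hq (by positivity) h).trans (le_of_eq (by ring))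

/-! ### The reference solution -/

theorem ae_sobSq_le_supForce {L : ℝ} {f : ℝ → FourierField} (hf : LinftyH L f) :
    ∀ᵐ t ∂(volume.restrict (Set.Ici (0 : ℝ))), sobSq L 0 (f t) ≤ supForce L f := by
  filter_upwards [ENNReal.ae_le_essSup (fun t => ENNReal.ofReal (sobSq L 0 (f t)))] with t ht
  exact (ENNReal.ofReal_le_iff_le_toReal hf.bounded).1 ht

theorem supForce_nonneg (L : ℝ) (f : ℝ → FourierField) : 0 ≤ supForce L f := ENNReal.toReal_nonneg

theorem M1_eq (L ν α : ℝ) (f : ℝ → FourierField) (u₀ : FourierField) :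
    M1 L ν α f u₀ = energy L α u₀ + supForce L f / (ν * lambda1 L) / (ν * lambda1 L) := by
  rw [M1, energy, div_div]
  ring

theorem energy_nonneg {L : ℝ} (hL : 0 < L) (a : ℝ) (u : FourierField) : 0 ≤ energy L a u :=
  add_nonneg (sobSq_nonneg hL _ _) (mul_nonneg (sq_nonneg _) (sobSq_nonneg hL _ _))

theorem M1_nonneg {L : ℝ} (hL : 0 < L) (ν α : ℝ) (f : ℝ → FourierField) (u₀ : FourierField) :
    0 ≤ M1 L ν α f u₀ := by
  rw [M1_eq, div_div]
  exact add_nonneg (energy_nonneg hL _ _)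
    (div_nonneg (supForce_nonneg L f) (mul_self_nonneg _))

/-- The `α`-energy of the reference solution never exceeds `M₁`. -/
theorem energy_le_M1 {L ν α : ℝ} (hL : 0 < L) (hν : 0 < ν) {f : ℝ → FourierField}
    (hf : LinftyH L f) {u₀ : FourierField} {u u' : ℝ → FourierField} (hu0 : u 0 = u₀)
    (hc : ContV L u) (h2 : L2Loc L 2 u) (hd : HasTimeDeriv L u u')
    (heq : ∀ᵐ t ∂(volume.restrict (Set.Ici (0 : ℝ))),
      helmholtz L α (u' t) + (ν : ℂ) • stokesA L (helmholtz L α (u t))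
        + Btilde L (u t) (helmholtz L α (u t)) = f t) {t : ℝ} (ht : 0 ≤ t) :
    energy L α (u t) ≤ M1 L ν α f u₀ := by
  have hl := lambda1_pos hL
  have hS := supForce_nonneg L f
  have hg := gronwall_of_primitive (E := fun t => energy L α (u t))
    (ψ := fun s => energyRate L α (u' s) (u s)) (a := ν * lambda1 L)
    (F := supForce L f / (ν * lambda1 L)) (T := t) (by positivity) (by positivity) ht
    (fun t ht => energy_eq_add_integral hL α hd h2 hc.mem ht) ?_
  · have he : Real.exp (-(ν * lambda1 L) * t) ≤ 1 := by
      rw [Real.exp_le_one_iff]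
      have : 0 ≤ ν * lambda1 L * t := by positivity
      linarith
    have h0 := energy_nonneg hL α (u 0)
    rw [M1_eq, ← hu0]
    nlinarith
  · filter_upwards [heq, h2.mem, hf.mem, ae_sobSq_le_supForce hf] with s e m mf mS
    have h := energyRate_le_of_NSAlpha hL hν m mf e
    have p0 := (m.mono (show 1 ≤ 2 by norm_num)).poincare hL
    have p1 := m.poincare hL
    have n2 := sobSq_nonneg hL 2 (u s)
    have hS' : sobSq L 0 (f s) / (ν * lambda1 L) ≤ supForce L f / (ν * lambda1 L) := by gcongr
    refine h.trans ?_
    simp only [energy]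
    have q0 : ν * (lambda1 L * sobSq L 0 (u s)) ≤ ν * sobSq L 1 (u s) := by gcongr
    have q1 : ν * α ^ 2 * (lambda1 L * sobSq L 1 (u s)) ≤ ν * α ^ 2 * sobSq L 2 (u s) := by gcongr
    have q2 : 0 ≤ ν * α ^ 2 * sobSq L 2 (u s) := by positivity
    linarith

/-! ### The error estimate -/

theorem four_le_exp_factor : 4 ≤ 2 * Real.exp 1 / (Real.exp (1 / 2) - 1) := by
  set x := Real.exp (1 / 2)
  have h1 : 1 < x := Real.one_lt_exp_iff.2 (by norm_num)
  have h2 : Real.exp 1 = x ^ 2 := by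
    rw [← Real.exp_nat_mul]
    norm_num
  rw [h2, le_div_iff₀ (by linarith)]
  nlinarith [sq_nonneg (x - 1)]

theorem M3_nonneg {c ν α M S l : ℝ} (hν : 0 < ν) (hl : 0 < l) (hM : 0 ≤ M)
    (hS : 0 ≤ S) : 0 ≤ M3 c ν α M S l := by
  unfold M3
  have h4 : 0 ≤ c ^ 4 := by positivity
  have h6 : 0 ≤ α ^ 6 := by positivity
  have h2 : 0 ≤ α ^ 4 := by positivity
  positivity

/-- The forcing terms of the energy inequality add up to less than the bound in terms of `M₃`. -/
theorem forcing_le_M3 {c ν α β M S l s d : ℝ} (hν : 0 < ν) (hα : 0 < α) (hβ : 0 < β)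
    (hM : 0 ≤ M) (hS : 0 ≤ S) (hs : 0 < s) (hsl : s ^ 2 = l) :
    2 / (l * ν) * (24 * d ^ 2 / (ν * β ^ 2) * (S + c ^ 4 * (M / α ^ 2) ^ 2 / (α ^ 2 * s)))
      + 2 * (24 * d ^ 2 / (ν * β ^ 2) * (c ^ 4 * (M / α ^ 2) / s) / (2 * ν * α ^ 2))
        * (M + S / (ν * l) / (ν * l))
      ≤ 4 * (d ^ 2 / β ^ 2) * M3 c ν α M S l := by
  have hl : 0 < l := by rw [← hsl]; positivity
  have r1 : l ^ (1 / 2 : ℝ) = s := by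
    rw [← hsl, ← Real.sqrt_eq_rpow, Real.sqrt_sq hs.le]
  have r3 : l ^ (3 / 2 : ℝ) = s ^ 3 := by
    rw [show (3 / 2 : ℝ) = (1 / 2 : ℝ) * (3 : ℕ) by norm_num, Real.rpow_mul hl.le, r1,
      Real.rpow_natCast]
  have hc : 0 ≤ c ^ 4 := by positivity
  have key : 4 * (d ^ 2 / β ^ 2) * M3 c ν α M S l -
      (2 / (l * ν) * (24 * d ^ 2 / (ν * β ^ 2) * (S + c ^ 4 * (M / α ^ 2) ^ 2 / (α ^ 2 * s)))
      + 2 * (24 * d ^ 2 / (ν * β ^ 2) * (c ^ 4 * (M / α ^ 2) / s) / (2 * ν * α ^ 2))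
        * (M + S / (ν * l) / (ν * l)))
      = 4 * (d ^ 2 / β ^ 2) * (24 / ν / α ^ 2 * ν ^ 2 * (M / ν + 1 / (ν ^ 3 * l ^ 2) * S)
        + 18 / ν * (c ^ 4 * M / (s * α ^ 4)) * (M / ν + 1 / (ν ^ 3 * l ^ 2) * S)
        + 4 * ν / α ^ 2 * (M / ν + 1 / (ν ^ 3 * l ^ 2) * S)
        + 2 * c ^ 4 * M / (ν * α ^ 4 * s) * (M / ν + 1 / (ν ^ 3 * l ^ 2) * S)) := by
    rw [M3, r1, r3, ← hsl]
    field_simp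
    ring
  have : 0 ≤ 4 * (d ^ 2 / β ^ 2) * (24 / ν / α ^ 2 * ν ^ 2 * (M / ν + 1 / (ν ^ 3 * l ^ 2) * S)
        + 18 / ν * (c ^ 4 * M / (s * α ^ 4)) * (M / ν + 1 / (ν ^ 3 * l ^ 2) * S)
        + 4 * ν / α ^ 2 * (M / ν + 1 / (ν ^ 3 * l ^ 2) * S)
        + 2 * c ^ 4 * M / (ν * α ^ 4 * s) * (M / ν + 1 / (ν ^ 3 * l ^ 2) * S)) := by positivity
  linarith

theorem nudging_threshold_eq {ν α : ℝ} (c M : ℝ) (hν : 0 < ν) (hα : 0 < α) :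
    576 * c ^ 8 * M ^ 2 / (α ^ 4 * ν ^ 3)
      = 576 * (c ^ 4) ^ 2 * (M / α ^ 2) ^ 2 / ν ^ 3 := by field_simp

theorem gradient_condition_eq {ν α : ℝ} (c M β η h c₁ : ℝ) (hν : 0 < ν) (hα : 0 < α) :
    η * c₁ * h ^ 2 + η ^ 2 * c₁ * β ^ 2 * h ^ 2 / ν
        + 432 * c ^ 8 * β ^ 2 * M ^ 2 / (ν ^ 3 * α ^ 4) - η * β ^ 2
      = (η + η ^ 2 * β ^ 2 / ν) * (c₁ * h ^ 2)
        + 432 * (c ^ 4) ^ 2 * (M / α ^ 2) ^ 2 / ν ^ 3 * β ^ 2 - η * β ^ 2 := by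
  field_simp

theorem laplacian_condition_eq (ν β η h c₂ : ℝ) :
    η * c₂ * h ^ 4 + η ^ 2 * β ^ 2 * c₂ * h ^ 4 / ν
      = (η + η ^ 2 * β ^ 2 / ν) * (c₂ * h ^ 4) := by
  ring

theorem forcing_div_rate {ν l : ℝ} (F κ S M : ℝ) (hν : 0 < ν) (hl : 0 < l) :
    (F + κ * (S / (ν * l)) + l * ν / 2 * κ * M) / (l * ν / 2)
      = 2 / (l * ν) * F + 2 * κ * (S / (ν * l) / (ν * l)) + κ * M := by
  field_simp

set_option maxHeartbeats 800000 in
/-- The error estimate, with any constant `c` for which `c⁸` dominates the constant of the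
trilinear estimates. -/
theorem error_le {c : ℝ} (hc : triConst ≤ (c ^ 4) ^ 2) {L ν α β η h c₁ c₂ : ℝ} (hL : 0 < L)
    (hν : 0 < ν) (hα : 0 < α) (hβ : 0 < β) {f : ℝ → FourierField} (hf : LinftyH L f)
    {Ih : FourierField →ₗ[ℝ] FourierField} (hI : IsInterpolant L h c₁ c₂ Ih)
    {u₀ w₀ : FourierField} {u w : ℝ → FourierField} (hu : IsSolution L ν α f u₀ u)
    (hw : IsSolution L ν β (nudgedForce L β η Ih f u w) w₀ w)
    (h1 : η > 576 * c ^ 8 * M1 L ν α f u₀ ^ 2 / (α ^ 4 * ν ^ 3))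
    (h2 : η * c₁ * h ^ 2 + η ^ 2 * c₁ * β ^ 2 * h ^ 2 / ν
        + 432 * c ^ 8 * β ^ 2 * M1 L ν α f u₀ ^ 2 / (ν ^ 3 * α ^ 4) - η * β ^ 2 < 11 * ν / 16)
    (h3 : η * c₂ * h ^ 4 + η ^ 2 * β ^ 2 * c₂ * h ^ 4 / ν < ν / 4 * β ^ 2) {t : ℝ} (ht : 0 ≤ t) :
    energy L β (w t - u t) ≤ Real.exp (-(lambda1 L * ν / 2) * t) * energy L β (w 0 - u 0)
      + 4 * ((β ^ 2 - α ^ 2) ^ 2 / β ^ 2)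
        * M3 c ν α (M1 L ν α f u₀) (supForce L f) (lambda1 L) := by
  obtain ⟨u', hud, hueq⟩ := hu.eqn
  obtain ⟨w', hwd, hweq⟩ := hw.eqn
  have hl := lambda1_pos hL
  have hS := supForce_nonneg L f
  have hM := M1_nonneg hL ν α f u₀
  set M := M1 L ν α f u₀ with hMdef
  set S := supForce L f with hSdef
  set l := lambda1 L with hldef
  have hEu : ∀ s, 0 ≤ s → energy L α (u s) ≤ M := fun s hs =>
    energy_le_M1 hL hν hf hu.init hu.cont hu.l2DA hud hueq hs
  set s := Real.sqrt l with hsdef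
  have hs : 0 < s := Real.sqrt_pos.2 hl
  have hsl : s ^ 2 = l := Real.sq_sqrt hl.le
  set d := β ^ 2 - α ^ 2
  set F₀ := 24 * d ^ 2 / (ν * β ^ 2) * (S + c ^ 4 * (M / α ^ 2) ^ 2 / (α ^ 2 * s)) with hF₀
  set k := 24 * d ^ 2 / (ν * β ^ 2) * (c ^ 4 * (M / α ^ 2) / s) with hk
  -- with this weight the dissipation `2 ν α² ‖Au‖²` of the energy of `u` cancels the term `k ‖Au‖²`
  set κ := k / (2 * ν * α ^ 2) with hκ
  have hc4 : 0 ≤ c ^ 4 := by positivity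
  have hF0 : 0 ≤ F₀ := by positivity
  have hk0 : 0 ≤ k := by positivity
  have hκ0 : 0 ≤ κ := by positivity
  have hκk : κ * (2 * ν * α ^ 2) = k := div_mul_cancel₀ _ (by positivity)
  have hgd := hwd.sub hL hud
  have hg2 := hw.l2DA.sub hL hu.l2DA
  have hgV : ∀ t, 0 ≤ t → MemVdot 1 (w t - u t) := fun t ht =>
    (hw.cont.mem t ht).sub (hu.cont.mem t ht)
  have hZ := gronwall_of_primitive
    (E := fun t => energy L β (w t - u t) + κ * energy L α (u t))
    (ψ := fun t => energyRate L β (w' t - u' t) (w t - u t) + κ * energyRate L α (u' t) (u t))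
    (a := l * ν / 2) (F := F₀ + κ * (S / (ν * l)) + l * ν / 2 * κ * M) (T := t)
    (by positivity) (by positivity) ht ?_ ?_
  · have he : Real.exp (-(l * ν / 2) * t) ≤ 1 := by
      rw [Real.exp_le_one_iff]
      have : 0 ≤ l * ν / 2 * t := by positivity
      linarith
    have hE0 := energy_nonneg hL α (u 0)
    have hEt := energy_nonneg hL α (u t)
    have hM' : M = energy L α (u 0) + S / (ν * l) / (ν * l) := by
      rw [hMdef, M1_eq, hu.init]
    have hfin := forcing_le_M3 (c := c) (d := d) hν hα hβ hM hS hs hsl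
    have e1 : (F₀ + κ * (S / (ν * l)) + l * ν / 2 * κ * M) / (l * ν / 2)
        = 2 / (l * ν) * F₀ + 2 * κ * (S / (ν * l) / (ν * l)) + κ * M :=
      forcing_div_rate F₀ κ S M hν hl
    have hu0 : Real.exp (-(l * ν / 2) * t) * (κ * energy L α (u 0)) ≤ κ * M := by
      have : κ * energy L α (u 0) ≤ κ * M := by
        have := hEu 0 le_rfl
        gcongr
      have h0 : 0 ≤ κ * energy L α (u 0) := by positivity
      nlinarith
    have hκEt : 0 ≤ κ * energy L α (u t) := by positivity
    rw [e1] at hZ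
    rw [← hF₀, ← hk, ← hκ] at hfin
    linarith
  · intro T hT
    obtain ⟨i1, q1⟩ := energy_eq_add_integral hL β hgd hg2 hgV hT
    obtain ⟨i2, q2⟩ := energy_eq_add_integral hL α hud hu.l2DA hu.cont.mem hT
    refine ⟨i1.add (i2.const_mul κ), ?_⟩
    rw [intervalIntegral.integral_add i1 (i2.const_mul κ), intervalIntegral.integral_const_mul,
      q1, q2]
    ring
  · filter_upwards [hueq, hweq, hu.l2DA.mem, hw.l2DA.mem, hf.mem, ae_sobSq_le_supForce hf,
      ae_restrict_mem measurableSet_Ici] with τ eu ew mu mw mf mS hτ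
    have mg := mw.sub mu
    have hX : Ih (w τ) - Ih (u τ) = Ih (w τ - u τ) := (map_sub Ih _ _).symm
    have hr : Summable fun K => vecSq ((Ih (w τ) - Ih (u τ) - (w τ - u τ)) K) := by
      rw [hX]
      refine Summable.of_nonneg_of_le (fun K => vecSq_nonneg _) (fun K => ?_)
        (((hI.mem _ mg).summable.mul_left 2).add (mg.summable_vecSq.mul_left 2))
      have := vecSq_add_le (Ih (w τ - u τ) K) (-((w τ - u τ) K))
      rwa [vecSq_neg, ← sub_eq_add_neg] at this
    have happ := hI.approx _ mg
    rw [← hX] at happ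
    have hm : sobSq L 1 (u τ) ≤ M / α ^ 2 := by
      rw [le_div_iff₀ (by positivity)]
      have := hEu τ hτ
      have := sobSq_nonneg hL 0 (u τ)
      simp only [energy] at *
      linarith
    have hbound := energyRate_difference_le (A₁ := c₁ * h ^ 2) (A₂ := c₂ * h ^ 4) (η := η)
      (q := c ^ 4) (m := M / α ^ 2) (s := s) (S := S) hL hν hα hβ hc4 hc hs hsl mu mw mf hr mS hm
      happ eu ew ?_ ?_ ?_
    · have hub := energyRate_le_of_NSAlpha hL hν mu mf eu
      have hS' : sobSq L 0 (f τ) / (ν * l) ≤ S / (ν * l) := by gcongr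
      have n1 := sobSq_nonneg hL 1 (u τ)
      have hub' : energyRate L α (u' τ) (u τ)
          ≤ -(2 * ν * α ^ 2) * sobSq L 2 (u τ) + S / (ν * l) := by
        have : 0 ≤ ν * sobSq L 1 (u τ) := by positivity
        linarith
      have hκub : κ * energyRate L α (u' τ) (u τ)
          ≤ -(k * sobSq L 2 (u τ)) + κ * (S / (ν * l)) := by
        calc _ ≤ κ * (-(2 * ν * α ^ 2) * sobSq L 2 (u τ) + S / (ν * l)) := by gcongr
          _ = -(κ * (2 * ν * α ^ 2) * sobSq L 2 (u τ)) + κ * (S / (ν * l)) := by ring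
          _ = _ := by rw [hκk]
      have hE := hEu τ hτ
      have hκE : l * ν / 2 * (κ * energy L α (u τ)) ≤ l * ν / 2 * (κ * M) := by gcongr
      have hsplit : 24 * d ^ 2 / (ν * β ^ 2) * (S + c ^ 4 * (M / α ^ 2) ^ 2 / (α ^ 2 * s)
          + c ^ 4 * (M / α ^ 2) / s * sobSq L 2 (u τ)) = F₀ + k * sobSq L 2 (u τ) := by
        rw [hF₀, hk]
        ring
      rw [hsplit] at hbound
      linarith
    · exact (nudging_threshold_eq c M hν hα).symm.trans_lt h1
    · exact (gradient_condition_eq c M β η h c₁ hν hα).symm.trans_le h2.le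
    · exact (laplacian_condition_eq ν β η h c₂).symm.trans_le h3.le

/-! ### Iterated convolutions -/

/-- The product estimate `H¹ · H^{1/2} → L²` for convolutions, by duality. -/
theorem tsum_sq_conv_le {a b q : Mode → ℝ≥0∞} (ha : a 0 = 0) (hb : b 0 = 0)
    (hq : ∀ K, q K ≤ ∑' J, a J * b (K - J)) :
    ∑' K, q K ^ 2 ≤ 208 * (wsum 2 a * wsum 1 b) := by
  have dual : ∀ d : Mode → ℝ≥0∞, (∑' K, q K * d K) ^ 2 ≤ 208 * (wsum 2 a * wsum 1 b * ∑' K, d K ^ 2) := by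
    intro d
    refine le_trans ?_ (trilinear_le a b (fun J M => d (J + M)) (∑' K, d K ^ 2) ha hb
      (fun J => ((Equiv.addLeft J).tsum_eq fun K => d K ^ 2).le)
      (fun M => ((Equiv.addRight M).tsum_eq fun K => d K ^ 2).le))
    refine pow_le_pow_left' ?_ 2
    calc ∑' K, q K * d K ≤ ∑' K, ∑' J, a J * b (K - J) * d K := by
          refine ENNReal.tsum_le_tsum fun K => ?_
          rw [ENNReal.tsum_mul_right]
          exact mul_le_mul_left (hq K) _
      _ = ∑' J, ∑' K, a J * b (K - J) * d K := ENNReal.tsum_comm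
      _ = _ := by
          refine tsum_congr fun J => ?_
          rw [← (Equiv.addLeft J).tsum_eq (fun K => a J * b (K - J) * d K)]
          simp
  rcases eq_or_ne (208 * (wsum 2 a * wsum 1 b)) ⊤ with ht | ht
  · rw [ht]; exact le_top
  have hfin : ∀ K, q K ≠ ⊤ := by
    intro K hK
    have h := dual (Pi.single K 1)
    rw [tsum_eq_single K (fun J hJ => by simp [Pi.single_eq_of_ne hJ]),
      tsum_eq_single K (fun J hJ => by simp [Pi.single_eq_of_ne hJ])] at h
    simp only [Pi.single_eq_same, mul_one, one_pow, hK, ENNReal.top_pow (two_ne_zero)] at h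
    exact ht (top_le_iff.1 h)
  rw [ENNReal.tsum_eq_iSup_sum]
  refine iSup_le fun S => ?_
  set X := ∑ K ∈ S, q K ^ 2 with hX
  have hXt : X ≠ ⊤ := ENNReal.sum_ne_top.2 fun K _ => ENNReal.pow_ne_top (hfin K)
  have h := dual (fun K => if K ∈ S then q K else 0)
  have e1 : ∑' K, q K * (if K ∈ S then q K else 0) = X := by
    rw [tsum_eq_sum (s := S) (fun K hK => by simp [hK])]
    exact Finset.sum_congr rfl fun K hK => by simp [hK, sq]
  have e2 : ∑' K, (if K ∈ S then q K else 0) ^ 2 = X := by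
    rw [tsum_eq_sum (s := S) (fun K hK => by simp [hK])]
    exact Finset.sum_congr rfl fun K hK => by simp [hK]
  rw [e1, e2, sq, ← mul_assoc] at h
  rcases eq_or_ne X 0 with h0 | h0
  · rw [h0]; exact zero_le
  · exact (ENNReal.mul_le_mul_iff_left h0 hXt).1 h

theorem wsum_zero_le (a : Mode → ℝ≥0∞) (ha : a 0 = 0) : ∑' K, a K ^ 2 ≤ wsum 2 a := by
  have := wsum_mono_order a ha (Nat.zero_le 2)
  simpa [wsum] using this

/-- The iterated convolution bound behind the embedding `H¹ ⊂ L⁶`: if `a`, `q`, `r` majorize the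
Fourier coefficients of `P`, `P²`, `P³`, then `‖P³‖² ≲ ‖P‖⁶_{H¹}`. -/
theorem tsum_sq_cube_le {a q r : Mode → ℝ≥0∞} (ha : a 0 = 0)
    (hq : ∀ K, q K ≤ ∑' J, a J * a (K - J)) (hr : ∀ K, r K ≤ ∑' J, a J * q (K - J)) :
    ∑' K, r K ^ 2 ≤ 1400000 * wsum 2 a ^ 3 := by
  set A := wsum 2 a with hA
  -- the weight `N(K)^{1/2}` is distributed over the two factors of `P²`
  set ρ : Mode → ℝ≥0∞ := fun K => (supN K : ℝ≥0∞) ^ (1 / 2 : ℝ) with hρ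
  have hρ2 : ∀ K, ρ K ^ 2 = supN K := fun K => by
    rw [hρ, ← ENNReal.rpow_two, ← ENNReal.rpow_mul]
    norm_num
  have hρadd : ∀ J K, ρ K ≤ ρ J + ρ (K - J) := by
    intro J K
    have h : (supN K : ℝ≥0∞) ≤ supN J + supN (K - J) := by
      have := supN_add_le J (K - J)
      rw [add_sub_cancel] at this
      exact_mod_cast this
    calc ρ K ≤ ((supN J : ℝ≥0∞) + supN (K - J)) ^ (1 / 2 : ℝ) := by simp only [hρ]; gcongr
      _ ≤ _ := ENNReal.rpow_add_le_add_rpow _ _ (by norm_num) (by norm_num)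
  have hρa : wsum 1 (fun K => ρ K * a K) = A := by
    rw [hA, wsum, wsum]
    refine tsum_congr fun K => ?_
    rw [mul_pow, hρ2]
    ring
  have hY : wsum 1 q ≤ 1664 * A ^ 2 := by
    set e1 : Mode → ℝ≥0∞ := fun K => ∑' J, (ρ J * a J) * a (K - J)
    set e2 : Mode → ℝ≥0∞ := fun K => ∑' J, a J * (ρ (K - J) * a (K - J))
    have he12 : ∀ K, e1 K = e2 K := by
      intro K
      simp only [e1, e2]
      rw [← (Equiv.subLeft K).tsum_eq]
      refine tsum_congr fun J => ?_
      simp only [Equiv.subLeft_apply, sub_sub_cancel]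
      ring
    have hle : ∀ K, ρ K * q K ≤ e1 K + e2 K := by
      intro K
      simp only [e1, e2]
      rw [← ENNReal.tsum_add]
      calc ρ K * q K ≤ ρ K * ∑' J, a J * a (K - J) := by gcongr; exact hq K
        _ = ∑' J, ρ K * (a J * a (K - J)) := ENNReal.tsum_mul_left.symm
        _ ≤ _ := by
            refine ENNReal.tsum_le_tsum fun J => ?_
            calc _ ≤ (ρ J + ρ (K - J)) * (a J * a (K - J)) := by gcongr; exact hρadd J K
              _ = _ := by ring
    have h2 : ∑' K, e2 K ^ 2 ≤ 208 * (A * A) := by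
      have := tsum_sq_conv_le (a := a) (b := fun K => ρ K * a K) (q := e2) ha (by simp [ha])
        (fun K => le_rfl)
      rwa [hρa] at this
    have h1 : ∑' K, e1 K ^ 2 ≤ 208 * (A * A) := by
      simp_rw [he12]
      exact h2
    calc wsum 1 q = ∑' K, (ρ K * q K) ^ 2 := by
          refine tsum_congr fun K => ?_
          rw [mul_pow, hρ2, pow_one]
      _ ≤ ∑' K, 4 * (e1 K ^ 2 + e2 K ^ 2) := by
          refine ENNReal.tsum_le_tsum fun K => le_trans ?_ (ennreal_add_sq_le _ _)
          gcongr
          exact hle K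
      _ = 4 * (∑' K, e1 K ^ 2 + ∑' K, e2 K ^ 2) := by rw [ENNReal.tsum_mul_left, ENNReal.tsum_add]
      _ ≤ 4 * (208 * (A * A) + 208 * (A * A)) := by gcongr
      _ = _ := by ring
  have hq0 : q 0 ≤ A := by
    have h : (∑' J, a J * a (0 - J)) ^ 2 ≤ A ^ 2 := by
      refine (tsum_sq_le (p := fun J => a J ^ 2) (q := fun J => a (0 - J) ^ 2)
        fun J => le_of_eq (by ring)).trans ?_
      rw [tsum_sub_left (fun K => a K ^ 2) 0, sq]
      gcongr <;> exact wsum_zero_le a ha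
    refine (hq 0).trans ?_
    rwa [ENNReal.pow_le_pow_left_iff two_ne_zero] at h
  -- the mean of `P²` is treated apart, as the product estimate concerns mean-free factors
  set q' : Mode → ℝ≥0∞ := fun K => if K = 0 then 0 else q K with hq'
  have hq'Y : wsum 1 q' ≤ wsum 1 q := by
    refine ENNReal.tsum_le_tsum fun K => ?_
    gcongr
    simp only [hq']
    split_ifs <;> simp
  set r1 : Mode → ℝ≥0∞ := fun K => ∑' J, a J * q' (K - J)
  have hrle : ∀ K, r K ≤ r1 K + a K * q 0 := by
    intro K
    refine (hr K).trans ?_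
    have e : a K * q 0 = ∑' J, (if J = K then a K * q 0 else 0) := by
      rw [tsum_ite_eq]
    rw [e]
    simp only [r1]
    rw [← ENNReal.tsum_add]
    refine ENNReal.tsum_le_tsum fun J => ?_
    by_cases h : J = K
    · subst h
      simp
    · simp [hq', sub_eq_zero, Ne.symm h]
  calc ∑' K, r K ^ 2 ≤ ∑' K, 4 * (r1 K ^ 2 + (a K * q 0) ^ 2) := by
        refine ENNReal.tsum_le_tsum fun K => le_trans ?_ (ennreal_add_sq_le _ _)
        gcongr
        exact hrle K
    _ = 4 * (∑' K, r1 K ^ 2 + (∑' K, a K ^ 2) * q 0 ^ 2) := by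
        rw [ENNReal.tsum_mul_left, ENNReal.tsum_add, ← ENNReal.tsum_mul_right]
        simp_rw [mul_pow]
    _ ≤ 4 * (208 * (A * (1664 * A ^ 2)) + A * A ^ 2) := by
        gcongr
        · refine (tsum_sq_conv_le ha (by simp [hq']) (fun K => le_rfl)).trans ?_
          gcongr
          exact hq'Y.trans hY
        · exact wsum_zero_le a ha
    _ = (4 * (208 * 1664 + 1)) * A ^ 3 := by ring
    _ ≤ _ := by gcongr; norm_num

/-! ### The embedding `H¹ ⊂ L⁶` on the torus -/

open UnitAddTorus

-- the circle carries the normalized Haar measure, as in Mathlib's multivariate Fourier series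
attribute [local instance] instMeasureSpaceUnitAddCircle

local instance : Measure.IsAddHaarMeasure (volume : Measure UnitAddCircle) :=
  inferInstanceAs (Measure.IsAddHaarMeasure AddCircle.haarAddCircle)

local instance : IsProbabilityMeasure (volume : Measure UnitAddCircle) :=
  inferInstanceAs (IsProbabilityMeasure AddCircle.haarAddCircle)

/-- The three-dimensional unit torus. -/
abbrev Torus := UnitAddTorus (Fin 3)

/-- Parseval's identity, in `[0, ∞]`. -/
theorem lintegral_enorm_sq_eq {g : Torus → ℂ} (hg : MemLp g 2) :
    ∫⁻ y, ‖g y‖ₑ ^ 2 = ∑' K, ‖mFourierCoeff g K‖ₑ ^ 2 := by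
  have h := hasSum_sq_mFourierCoeff hg.toLp
  have hcoef : ∀ K, mFourierCoeff hg.toLp K = mFourierCoeff g K := fun K =>
    integral_congr_ae (by
      filter_upwards [hg.coeFn_toLp] with t ht
      rw [ht])
  have e : ∫ t, ‖hg.toLp g t‖ ^ 2 = ∫ t : Torus, ‖g t‖ ^ 2 := by
    refine integral_congr_ae ?_
    filter_upwards [hg.coeFn_toLp] with t ht
    rw [ht]
  simp_rw [hcoef] at h
  rw [e] at h
  have hi : Integrable (fun t : Torus => ‖g t‖ ^ 2) := hg.integrable_norm_pow (by norm_num)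
  have e2 : ∀ z : ℂ, ‖z‖ₑ ^ 2 = ENNReal.ofReal (‖z‖ ^ 2) := fun z => by
    rw [← ofReal_norm, ENNReal.ofReal_pow (norm_nonneg _)]
  simp_rw [e2]
  rw [← ofReal_integral_eq_lintegral_ofReal hi (Eventually.of_forall fun t => by positivity),
    ← h.tsum_eq, ENNReal.ofReal_tsum_of_nonneg (fun K => by positivity) h.summable]

/-- The trigonometric polynomial with coefficients `p` and spectrum `F`. -/
noncomputable def trigPoly (F : Finset Mode) (p : Mode → ℂ) : C(Torus, ℂ) :=
  ∑ K ∈ F, p K • mFourier K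

theorem integrable_torus (G : C(Torus, ℂ)) : Integrable (fun t : Torus => G t) :=
  G.continuous.integrable_of_hasCompactSupport (HasCompactSupport.of_compactSpace _)

theorem mFourierCoeff_trigPoly_mul (F : Finset Mode) (p : Mode → ℂ) (G : C(Torus, ℂ)) (K : Mode) :
    mFourierCoeff (trigPoly F p * G : C(Torus, ℂ)) K
      = ∑ J ∈ F, p J * mFourierCoeff G (K - J) := by
  have h : ∀ t : Torus, mFourier (-K) t • (trigPoly F p * G : C(Torus, ℂ)) t
      = ∑ J ∈ F, p J * (mFourier (-(K - J)) t • G t) := by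
    intro t
    simp only [trigPoly, ContinuousMap.mul_apply, ContinuousMap.sum_apply, ContinuousMap.smul_apply,
      smul_eq_mul, Finset.sum_mul, Finset.mul_sum]
    refine Finset.sum_congr rfl fun J _ => ?_
    rw [show -(K - J) = -K + J by abel, mFourier_add]
    ring
  simp only [mFourierCoeff]
  simp_rw [h]
  rw [integral_finsetSum]
  · exact Finset.sum_congr rfl fun J _ => integral_const_mul _ _
  · intro J _
    exact (integrable_torus (mFourier (-(K - J)) * G)).const_mul (p J)

theorem mFourierCoeff_one (K : Mode) :
    mFourierCoeff (1 : C(Torus, ℂ)) K = if K = 0 then 1 else 0 := by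
  have h := orthonormal_iff_ite.1 (orthonormal_mFourier (d := Fin 3)) K 0
  rw [ContinuousMap.inner_toLp] at h
  rw [← h, mFourierCoeff]
  refine integral_congr_ae (Eventually.of_forall fun t => ?_)
  simp [mFourier_neg, mFourier_zero]

theorem enorm_mFourierCoeff_trigPoly_mul_le (F : Finset Mode) (p : Mode → ℂ) (G : C(Torus, ℂ))
    (K : Mode) : ‖mFourierCoeff (trigPoly F p * G : C(Torus, ℂ)) K‖ₑ
      ≤ ∑' J, ‖p J‖ₑ * ‖mFourierCoeff G (K - J)‖ₑ := by
  rw [mFourierCoeff_trigPoly_mul]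
  refine (enorm_sum_le _ _).trans ?_
  simp_rw [enorm_mul]
  exact ENNReal.sum_le_tsum F

theorem enorm_mFourierCoeff_trigPoly_le (F : Finset Mode) (p : Mode → ℂ) (K : Mode) :
    ‖mFourierCoeff (trigPoly F p) K‖ₑ ≤ ‖p K‖ₑ := by
  have h := enorm_mFourierCoeff_trigPoly_mul_le F p 1 K
  rw [mul_one] at h
  refine h.trans (le_of_eq ?_)
  rw [tsum_eq_single K]
  · rw [sub_self, mFourierCoeff_one]
    simp
  · intro J hJ
    rw [mFourierCoeff_one, if_neg (sub_ne_zero.2 hJ.symm)]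
    simp

theorem lintegral_trigPoly_pow_six_le (F : Finset Mode) {p : Mode → ℂ} (hp : p 0 = 0) :
    ∫⁻ y, ‖trigPoly F p y‖ₑ ^ 6 ≤ 1400000 * wsum 2 (fun K => ‖p K‖ₑ) ^ 3 := by
  set P := trigPoly F p with hP
  have h := lintegral_enorm_sq_eq ((P * (P * P)).continuous.memLp_of_hasCompactSupport
    (HasCompactSupport.of_compactSpace _) : MemLp (P * (P * P) : C(Torus, ℂ)) 2)
  have e : ∀ y, ‖(P * (P * P)) y‖ₑ ^ 2 = ‖P y‖ₑ ^ 6 := fun y => by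
    simp only [ContinuousMap.mul_apply, enorm_mul]
    ring
  simp_rw [e] at h
  rw [h]
  refine tsum_sq_cube_le (q := fun K => ‖mFourierCoeff (P * P : C(Torus, ℂ)) K‖ₑ) (by simp [hp])
    (fun K => ?_) (fun K => enorm_mFourierCoeff_trigPoly_mul_le F p (P * P) K)
  refine (enorm_mFourierCoeff_trigPoly_mul_le F p P K).trans ?_
  exact ENNReal.tsum_le_tsum fun J => by
    gcongr
    exact enorm_mFourierCoeff_trigPoly_le F p _

/-- The embedding `H¹ ⊂ L⁶` on the torus for mean-free functions. -/
theorem lintegral_pow_six_le {g : Torus → ℂ} (hg : MemLp g 2) (h0 : mFourierCoeff g 0 = 0) :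
    ∫⁻ y, ‖g y‖ₑ ^ 6 ≤ 1400000 * wsum 2 (fun K => ‖mFourierCoeff g K‖ₑ) ^ 3 := by
  set p : Mode → ℂ := fun K => mFourierCoeff g K
  have hs := hasSum_mFourier_series_L2 hg.toLp
  have hcoef : ∀ K, mFourierCoeff hg.toLp K = p K := fun K =>
    integral_congr_ae (by
      filter_upwards [hg.coeFn_toLp] with t ht
      rw [ht])
  simp_rw [hcoef] at hs
  obtain ⟨S, hS⟩ := exists_seq_tendsto (atTop : Filter (Finset Mode))
  have hlim := (hs : Tendsto _ _ _).comp hS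
  have hLp : ∀ F : Finset Mode, ∑ K ∈ F, p K • mFourierLp 2 K
      = (trigPoly F p).toLp 2 (volume : Measure Torus) ℂ := fun F => by
    rw [trigPoly, map_sum]
    simp
  obtain ⟨ns, -, hns⟩ := (tendstoInMeasure_of_tendsto_Lp hlim).exists_seq_tendsto_ae
  have hae : ∀ᵐ y : Torus, Tendsto (fun n => trigPoly (S (ns n)) p y) atTop (𝓝 (g y)) := by
    have hall : ∀ᵐ y : Torus, ∀ n, ((trigPoly (S n) p).toLp 2 (volume : Measure Torus) ℂ) y
        = trigPoly (S n) p y :=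
      ae_all_iff.2 fun n => (trigPoly (S n) p).coeFn_toLp (p := 2) (𝕜 := ℂ) volume
    filter_upwards [hns, hall, hg.coeFn_toLp] with y h1 h2 h3
    rw [← h3]
    refine h1.congr fun n => ?_
    simp only [Function.comp_apply]
    rw [hLp, h2]
  calc ∫⁻ y, ‖g y‖ₑ ^ 6 = ∫⁻ y, liminf (fun n => ‖trigPoly (S (ns n)) p y‖ₑ ^ 6) atTop := by
        refine lintegral_congr_ae ?_
        filter_upwards [hae] with y hy
        exact (((ENNReal.continuous_pow 6).tendsto _).comp hy.enorm).liminf_eq.symm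
    _ ≤ liminf (fun n => ∫⁻ y, ‖trigPoly (S (ns n)) p y‖ₑ ^ 6) atTop := by
        refine lintegral_liminf_le fun n => ?_
        exact ((trigPoly (S (ns n)) p).continuous.enorm.measurable.pow_const 6)
    _ ≤ _ := by
        refine liminf_le_of_le (by isBoundedDefault) fun b hb => ?_
        obtain ⟨n, hn⟩ := hb.exists
        exact hn.trans (lintegral_trigPoly_pow_six_le _ h0)

/-! ### From the unit torus to the box -/

/-- The point of the box `(0, L]³` that represents a point of the unit torus. -/
noncomputable def boxPoint (L : ℝ) (y : Torus) : Fin 3 → ℝ :=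
  L • (measurableEquivPiIoc (0 : Fin 3 → ℝ) y).1

theorem measurePreserving_boxPoint {L : ℝ} (hL : 0 < L) :
    MeasurePreserving (boxPoint L) (volume : Measure Torus)
      (ENNReal.ofReal (L ^ 3)⁻¹ • volume.restrict (box L)) := by
  set B : Set (Fin 3 → ℝ) :=
    {x | ∀ i, x i ∈ Set.Ioc ((0 : Fin 3 → ℝ) i) ((0 : Fin 3 → ℝ) i + 1)} with hB
  have hBm : MeasurableSet B := MeasurableSet.univ_pi' fun i => measurableSet_Ioc
  have h1 : MeasurePreserving (fun y : Torus => (measurableEquivPiIoc (0 : Fin 3 → ℝ) y).1) volume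
      (volume.restrict B) :=
    (measurePreserving_subtype_coe hBm).comp (measurePreserving_equivPiIoc 0)
  refine MeasurePreserving.comp (g := fun x : Fin 3 → ℝ => L • x) ⟨measurable_const_smul L, ?_⟩ h1
  set B' : Set (Fin 3 → ℝ) := Set.pi Set.univ fun _ => Set.Ioc 0 L with hB'
  have hB'm : MeasurableSet B' := MeasurableSet.univ_pi fun i => measurableSet_Ioc
  have hpre : (fun x : Fin 3 → ℝ => L • x) ⁻¹' B' = B := by
    ext x
    simp only [hB', hB, Set.mem_preimage, Set.mem_pi, Set.mem_univ, true_implies, Set.mem_Ioc,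
      Pi.smul_apply, smul_eq_mul, Pi.zero_apply, zero_add, Set.mem_ofPred_eq]
    refine forall_congr' fun i => and_congr ?_ ?_
    · exact ⟨fun h => pos_of_mul_pos_right h hL.le, fun h => mul_pos hL h⟩
    · exact ⟨fun h => by nlinarith, fun h => by nlinarith⟩
  have hae : B' =ᵐ[volume] box L := by
    have := Measure.univ_pi_Ioc_ae_eq_Icc (μ := fun _ : Fin 3 => (volume : Measure ℝ))
      (f := fun _ => 0) (g := fun _ => L)
    exact this
  rw [← hpre, ← Measure.restrict_map (measurable_const_smul L) hB'm,
    Measure.map_addHaar_smul _ hL.ne', Measure.restrict_smul, Measure.restrict_congr_set hae]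
  congr 2
  simp [abs_of_pos hL]

theorem lintegral_box_eq {L : ℝ} (hL : 0 < L) {φ : (Fin 3 → ℝ) → ℝ≥0∞}
    (hφ : AEMeasurable φ (volume.restrict (box L))) :
    ∫⁻ x in box L, φ x = ENNReal.ofReal (L ^ 3) * ∫⁻ y : Torus, φ (boxPoint L y) := by
  have hmp := measurePreserving_boxPoint hL
  have h : ∫⁻ y : Torus, φ (boxPoint L y)
      = ∫⁻ x, φ x ∂(ENNReal.ofReal (L ^ 3)⁻¹ • volume.restrict (box L)) := by
    rw [← hmp.map_eq]
    refine (lintegral_map' ?_ hmp.measurable.aemeasurable).symm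
    rw [hmp.map_eq]
    exact hφ.smul_measure _
  rw [h, lintegral_smul_measure, smul_eq_mul, ← mul_assoc, ← ENNReal.ofReal_mul (by positivity),
    mul_inv_cancel₀ (by positivity), ENNReal.ofReal_one, one_mul]

theorem mFourierCoeff_comp_boxPoint {L : ℝ} (hL : 0 < L)
    {G : (Fin 3 → ℝ) → EuclideanSpace ℝ (Fin 3)}
    (hG : AEStronglyMeasurable G (volume.restrict (box L))) (K : Mode) (i : Fin 3) :
    mFourierCoeff (fun y => (G (boxPoint L y) i : ℂ)) K = fourierCoeffs L G K i := by
  have hmp := measurePreserving_boxPoint hL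
  set φ : (Fin 3 → ℝ) → ℂ := fun x => (G x i : ℂ) *
    Complex.exp (-(2 * Real.pi * Complex.I * (∑ j, (K j : ℂ) * (x j : ℂ)) / L)) with hφ
  have hφm : AEStronglyMeasurable φ (volume.restrict (box L)) := by
    have he : Continuous fun x : Fin 3 → ℝ =>
        Complex.exp (-(2 * Real.pi * Complex.I * (∑ j, (K j : ℂ) * (x j : ℂ)) / L)) := by fun_prop
    refine AEStronglyMeasurable.mul ?_ he.aestronglyMeasurable
    have hc : Continuous fun v : EuclideanSpace ℝ (Fin 3) => (v i : ℂ) := by fun_prop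
    exact hc.comp_aestronglyMeasurable hG
  have e : ∀ y : Torus, mFourier (-K) y • (G (boxPoint L y) i : ℂ) = φ (boxPoint L y) := by
    intro y
    rw [hφ, smul_eq_mul, mul_comm]
    congr 1
    have hy : ∀ j, y j = (((boxPoint L y j / L : ℝ)) : UnitAddCircle) := by
      intro j
      have h1 : boxPoint L y j / L = (AddCircle.equivIoc 1 ((0 : Fin 3 → ℝ) j) (y j)).1 := by
        simp [boxPoint, hL.ne']
      rw [h1]
      exact ((AddCircle.equivIoc 1 ((0 : Fin 3 → ℝ) j)).symm_apply_apply (y j)).symm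
    simp only [mFourier, ContinuousMap.coe_mk]
    conv_lhs =>
      enter [2, j]
      rw [hy j, fourier_coe_apply]
    rw [← Complex.exp_sum]
    congr 1
    rw [Finset.mul_sum, Finset.sum_div, ← Finset.sum_neg_distrib]
    refine Finset.sum_congr rfl fun j _ => ?_
    simp
    ring
  rw [mFourierCoeff]
  simp_rw [e]
  have h : ∫ y : Torus, φ (boxPoint L y)
      = ∫ x, φ x ∂(ENNReal.ofReal (L ^ 3)⁻¹ • volume.restrict (box L)) := by
    rw [← hmp.map_eq]
    refine (integral_map hmp.measurable.aemeasurable ?_).symm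
    rw [hmp.map_eq]
    exact hφm.smul_measure _
  rw [h, integral_smul_measure, ENNReal.toReal_ofReal (by positivity), fourierCoeffs,
    Complex.real_smul]
  push_cast
  rfl

/-! ### The Gagliardo–Nirenberg inequalities -/

theorem eLpNorm_le_of_lintegral_pow_le {α E : Type*} [MeasurableSpace α] {μ : Measure α}
    [NormedAddCommGroup E] {f : α → E} {n : ℕ} (hn : n ≠ 0) {x : ℝ} (hx : 0 ≤ x)
    (h : ∫⁻ t, ‖f t‖ₑ ^ n ∂μ ≤ ENNReal.ofReal (x ^ n)) :
    eLpNorm f n μ ≤ ENNReal.ofReal x := by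
  have hn' : (0 : ℝ) < n := by exact_mod_cast Nat.pos_of_ne_zero hn
  rw [eLpNorm_eq_lintegral_rpow_enorm_toReal (by exact_mod_cast hn) (ENNReal.natCast_ne_top n)]
  simp only [ENNReal.toReal_natCast, ENNReal.rpow_natCast]
  calc _ ≤ (ENNReal.ofReal (x ^ n)) ^ (1 / (n : ℝ)) := by gcongr
    _ = ENNReal.ofReal x := by
        rw [ENNReal.ofReal_pow hx, ← ENNReal.rpow_natCast, ← ENNReal.rpow_mul,
          mul_one_div_cancel hn'.ne', ENNReal.rpow_one]

/-- Cauchy–Schwarz for integrals in `[0, ∞]`. -/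
theorem lintegral_mul_sq_le {α : Type*} [MeasurableSpace α] {μ : Measure α} {f g : α → ℝ≥0∞}
    (hf : AEMeasurable f μ) (hg : AEMeasurable g μ) :
    (∫⁻ t, f t * g t ∂μ) ^ 2 ≤ (∫⁻ t, f t ^ 2 ∂μ) * ∫⁻ t, g t ^ 2 ∂μ := by
  have h := ENNReal.lintegral_mul_le_Lp_mul_Lq μ Real.HolderConjugate.two_two hf hg
  simp only [ENNReal.rpow_two, Pi.mul_apply] at h
  calc _ ≤ ((∫⁻ t, f t ^ 2 ∂μ) ^ (1 / 2 : ℝ) * (∫⁻ t, g t ^ 2 ∂μ) ^ (1 / 2 : ℝ)) ^ 2 := by gcongr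
    _ = _ := by
        rw [mul_pow, ← ENNReal.rpow_two, ← ENNReal.rpow_two, ← ENNReal.rpow_mul, ← ENNReal.rpow_mul]
        norm_num

theorem enorm_pow_six_le (v : EuclideanSpace ℝ (Fin 3)) :
    ‖v‖ₑ ^ 6 ≤ 9 * ∑ i, ‖(v i : ℂ)‖ₑ ^ 6 := by
  have h : ‖v‖ ^ 6 ≤ 9 * ∑ i, ‖(v i : ℂ)‖ ^ 6 := by
    have := pow_sum_div_card_le_sum_pow (s := (Finset.univ : Finset (Fin 3)))
      (f := fun i => ‖v i‖ ^ 2) (fun i _ => by positivity) 2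
    rw [← EuclideanSpace.norm_sq_eq] at this
    simp only [Finset.card_univ, Fintype.card_fin, ← pow_mul] at this
    norm_num at this
    simp only [Complex.norm_real, Real.norm_eq_abs]
    linarith
  simp only [← ofReal_norm]
  have e : ∀ x : ℝ, 0 ≤ x → ENNReal.ofReal x ^ 6 = ENNReal.ofReal (x ^ 6) := fun x hx =>
    (ENNReal.ofReal_pow hx 6).symm
  rw [e _ (norm_nonneg v), Finset.sum_congr rfl fun i _ => e _ (norm_nonneg (v i : ℂ)),
    ← ENNReal.ofReal_sum_of_nonneg fun i _ => by positivity,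
    show (9 : ℝ≥0∞) = ENNReal.ofReal 9 by norm_num, ← ENNReal.ofReal_mul (by norm_num)]
  exact ENNReal.ofReal_le_ofReal h

theorem enorm_sq_eq_sum (v : EuclideanSpace ℝ (Fin 3)) :
    ‖v‖ₑ ^ 2 = ∑ i, ‖(v i : ℂ)‖ₑ ^ 2 := by
  have h : ‖v‖ ^ 2 = ∑ i, ‖(v i : ℂ)‖ ^ 2 := by
    rw [EuclideanSpace.norm_sq_eq]
    simp
  simp only [← ofReal_norm]
  have e : ∀ x : ℝ, 0 ≤ x → ENNReal.ofReal x ^ 2 = ENNReal.ofReal (x ^ 2) := fun x hx =>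
    (ENNReal.ofReal_pow hx 2).symm
  rw [e _ (norm_nonneg v), Finset.sum_congr rfl fun i _ => e _ (norm_nonneg (v i : ℂ)),
    ← ENNReal.ofReal_sum_of_nonneg fun i _ => by positivity, h]

section Box

variable {L : ℝ} {G : (Fin 3 → ℝ) → EuclideanSpace ℝ (Fin 3)}

theorem memLp_comp_boxPoint (hL : 0 < L) (hG : MemLp G 2 (volume.restrict (box L))) (i : Fin 3) :
    MemLp (fun y : Torus => (G (boxPoint L y) i : ℂ)) 2 := by
  have hc : Continuous fun v : EuclideanSpace ℝ (Fin 3) => (v i : ℂ) := by fun_prop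
  have h1 : MemLp (fun x => (G x i : ℂ)) 2 (volume.restrict (box L)) := by
    refine hG.of_le (hc.comp_aestronglyMeasurable hG.1) (Eventually.of_forall fun x => ?_)
    rw [Complex.norm_real]
    exact PiLp.norm_apply_le _ i
  exact (h1.smul_measure ENNReal.ofReal_ne_top).comp_measurePreserving (measurePreserving_boxPoint hL)

theorem aemeasurable_coord (hG : MemLp G 2 (volume.restrict (box L))) (i : Fin 3) :
    AEMeasurable (fun x => ‖(G x i : ℂ)‖ₑ) (volume.restrict (box L)) := by
  have hc : Continuous fun v : EuclideanSpace ℝ (Fin 3) => (v i : ℂ) := by fun_prop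
  exact (hc.comp_aestronglyMeasurable hG.1).enorm

theorem lintegral_box_sq_le (hL : 0 < L) (hG : MemLp G 2 (volume.restrict (box L)))
    (hV : MemVdot 1 (fourierCoeffs L G)) :
    ∫⁻ x in box L, ‖G x‖ₑ ^ 2 ≤ ENNReal.ofReal (sobSq L 0 (fourierCoeffs L G)) := by
  simp_rw [enorm_sq_eq_sum]
  rw [lintegral_finsetSum' _ fun i _ => (aemeasurable_coord hG i).pow_const 2]
  have h : ∀ i : Fin 3, ∫⁻ x in box L, ‖(G x i : ℂ)‖ₑ ^ 2
      = ENNReal.ofReal (L ^ 3) * ∑' K, ‖fourierCoeffs L G K i‖ₑ ^ 2 := by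
    intro i
    rw [lintegral_box_eq hL ((aemeasurable_coord hG i).pow_const 2),
      lintegral_enorm_sq_eq (memLp_comp_boxPoint hL hG i)]
    simp_rw [mFourierCoeff_comp_boxPoint hL hG.1]
  simp_rw [h]
  rw [← Finset.mul_sum, sobSq, ENNReal.ofReal_mul (by positivity)]
  gcongr
  simp only [pow_zero, one_mul]
  rw [ENNReal.ofReal_tsum_of_nonneg (fun K => vecSq_nonneg _)
    (by simpa using (hV.mono zero_le_one).summable), ← Summable.tsum_finsetSum fun i _ =>
    ENNReal.summable]
  refine ENNReal.tsum_le_tsum fun K => le_of_eq ?_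
  rw [vecSq, ENNReal.ofReal_sum_of_nonneg fun i _ => by positivity]
  refine Finset.sum_congr rfl fun i _ => ?_
  rw [← ofReal_norm, ENNReal.ofReal_pow (norm_nonneg _)]

theorem lintegral_box_pow_six_le (hL : 0 < L) (hG : MemLp G 2 (volume.restrict (box L)))
    (hV : MemVdot 1 (fourierCoeffs L G)) :
    ∫⁻ x in box L, ‖G x‖ₑ ^ 6
      ≤ ENNReal.ofReal (100000000 * sobSq L 1 (fourierCoeffs L G) ^ 3) := by
  set û := fourierCoeffs L G with hû
  have hn := latSq_nonneg 1 û
  have h : ∀ i : Fin 3, ∫⁻ x in box L, ‖(G x i : ℂ)‖ₑ ^ 6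
      ≤ ENNReal.ofReal (1400000 * (L ^ 3 * latSq 1 û ^ 3)) := by
    intro i
    have hc : ∀ K, mFourierCoeff (fun y => (G (boxPoint L y) i : ℂ)) K = û K i := fun K =>
      mFourierCoeff_comp_boxPoint hL hG.1 K i
    have h0 : mFourierCoeff (fun y => (G (boxPoint L y) i : ℂ)) 0 = 0 := by
      rw [hc, hV.zero]
      rfl
    rw [lintegral_box_eq hL ((aemeasurable_coord hG i).pow_const 6)]
    have hw : wsum 2 (fun K => ‖mFourierCoeff (fun y => (G (boxPoint L y) i : ℂ)) K‖ₑ)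
        ≤ ENNReal.ofReal (latSq 1 û) := by
      refine le_trans (ENNReal.tsum_le_tsum fun K => ?_) (wsum_coeffNorm_le hV)
      simp only [hc]
      gcongr
      rw [coeffNorm, ← ofReal_norm, ← ofReal_norm]
      exact ENNReal.ofReal_le_ofReal (norm_le_pi_norm (û K) i)
    calc _ ≤ ENNReal.ofReal (L ^ 3) * (1400000 * ENNReal.ofReal (latSq 1 û) ^ 3) := by
          gcongr
          refine (lintegral_pow_six_le (memLp_comp_boxPoint hL hG i) h0).trans ?_
          gcongr
      _ = _ := by
          rw [ENNReal.ofReal_mul (by norm_num), ENNReal.ofReal_mul (by positivity),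
            ENNReal.ofReal_pow hn, show ENNReal.ofReal 1400000 = 1400000 by norm_num]
          ring
  have hscale : L ^ 3 * latSq 1 û ^ 3 ≤ sobSq L 1 û ^ 3 := by
    rw [sobSq_eq_latSq]
    have h2 : 1 ≤ 2 * Real.pi := by linarith [Real.pi_gt_three]
    have h3 : (1 : ℝ) ≤ (2 * Real.pi) ^ 6 := one_le_pow₀ h2
    calc L ^ 3 * latSq 1 û ^ 3 = 1 * (L ^ 3 * latSq 1 û ^ 3) := (one_mul _).symm
      _ ≤ (2 * Real.pi) ^ 6 * (L ^ 3 * latSq 1 û ^ 3) := by gcongr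
      _ = _ := by
          rw [div_pow, mul_one]
          field_simp
  calc ∫⁻ x in box L, ‖G x‖ₑ ^ 6 ≤ ∫⁻ x in box L, 9 * ∑ i, ‖(G x i : ℂ)‖ₑ ^ 6 :=
        lintegral_mono fun x => enorm_pow_six_le _
    _ = 9 * ∑ i, ∫⁻ x in box L, ‖(G x i : ℂ)‖ₑ ^ 6 := by
        rw [lintegral_const_mul' _ _ (by norm_num),
          lintegral_finsetSum' _ fun i _ => (aemeasurable_coord hG i).pow_const 6]
    _ ≤ 9 * ∑ _i : Fin 3, ENNReal.ofReal (1400000 * (L ^ 3 * latSq 1 û ^ 3)) := by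
        gcongr with i
        exact h i
    _ = ENNReal.ofReal (27 * (1400000 * (L ^ 3 * latSq 1 û ^ 3))) := by
        rw [Finset.sum_const, Finset.card_univ, Fintype.card_fin,
          ENNReal.ofReal_mul (by norm_num : (0 : ℝ) ≤ 27), show ENNReal.ofReal 27 = 27 by norm_num,
          nsmul_eq_mul, ← mul_assoc]
        norm_num
    _ ≤ _ := by
        apply ENNReal.ofReal_le_ofReal
        have : 0 ≤ sobSq L 1 û ^ 3 := pow_nonneg (sobSq_nonneg hL 1 û) 3
        linarith

end Box

/-- The Gagliardo–Nirenberg inequalities hold with every sufficiently large constant. The exponents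
`3` and `4` follow from `2` and `6` by the Cauchy–Schwarz inequality. -/
theorem isGagliardoNirenbergConst_of_le {c : ℝ} (hc : 100 ≤ c) : IsGagliardoNirenbergConst c := by
  intro L hL G hG hV n0 n1
  set μ := volume.restrict (box L)
  have s0 := sobSq_nonneg hL 0 (fourierCoeffs L G)
  have s1 := sobSq_nonneg hL 1 (fourierCoeffs L G)
  have hn0 : 0 ≤ n0 := Real.sqrt_nonneg _
  have hn1 : 0 ≤ n1 := Real.sqrt_nonneg _
  have hc0 : 0 < c := by linarith
  have hc6 : (100 : ℝ) ^ 6 ≤ c ^ 6 := by gcongr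
  have q0 : sobSq L 0 (fourierCoeffs L G) = n0 ^ 2 := (Real.sq_sqrt s0).symm
  have q1 : sobSq L 1 (fourierCoeffs L G) = n1 ^ 2 := (Real.sq_sqrt s1).symm
  have hm : AEMeasurable (fun x => ‖G x‖ₑ) μ := hG.1.enorm
  have i2 : ∫⁻ x, ‖G x‖ₑ ^ 2 ∂μ ≤ ENNReal.ofReal (n0 ^ 2) := by
    rw [← q0]
    exact lintegral_box_sq_le hL hG hV
  have i6 : ∫⁻ x, ‖G x‖ₑ ^ 6 ∂μ ≤ ENNReal.ofReal ((100 * n1) ^ 6) := by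
    refine (lintegral_box_pow_six_le hL hG hV).trans (ENNReal.ofReal_le_ofReal ?_)
    rw [q1]
    have : 0 ≤ n1 ^ 6 := by positivity
    nlinarith
  have i4 : ∫⁻ x, ‖G x‖ₑ ^ 4 ∂μ ≤ ENNReal.ofReal (n0 * (100 * n1) ^ 3) := by
    have h := lintegral_mul_sq_le hm (hm.pow_const 3)
    rw [← ENNReal.pow_le_pow_left_iff two_ne_zero, ← ENNReal.ofReal_pow (by positivity)]
    calc (∫⁻ x, ‖G x‖ₑ ^ 4 ∂μ) ^ 2 = (∫⁻ x, ‖G x‖ₑ * ‖G x‖ₑ ^ 3 ∂μ) ^ 2 := by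
          congr 1
          exact lintegral_congr fun x => by ring
      _ ≤ (∫⁻ x, ‖G x‖ₑ ^ 2 ∂μ) * ∫⁻ x, (‖G x‖ₑ ^ 3) ^ 2 ∂μ := h
      _ ≤ ENNReal.ofReal (n0 ^ 2) * ENNReal.ofReal ((100 * n1) ^ 6) := by
          simp_rw [← pow_mul]
          gcongr
      _ = _ := by
          rw [← ENNReal.ofReal_mul (by positivity)]
          congr 1
          ring
  have i3 : ∫⁻ x, ‖G x‖ₑ ^ 3 ∂μ ≤ ENNReal.ofReal ((c * n0 ^ (1 / 2 : ℝ) * n1 ^ (1 / 2 : ℝ)) ^ 3) := by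
    have h := lintegral_mul_sq_le hm (hm.pow_const 2)
    rw [← ENNReal.pow_le_pow_left_iff two_ne_zero, ← ENNReal.ofReal_pow (by positivity)]
    have r : ∀ x : ℝ, 0 ≤ x → (x ^ (1 / 2 : ℝ)) ^ 2 = x := fun x hx => by
      rw [← Real.sqrt_eq_rpow, Real.sq_sqrt hx]
    calc (∫⁻ x, ‖G x‖ₑ ^ 3 ∂μ) ^ 2 = (∫⁻ x, ‖G x‖ₑ * ‖G x‖ₑ ^ 2 ∂μ) ^ 2 := by
          congr 1
          exact lintegral_congr fun x => by ring
      _ ≤ (∫⁻ x, ‖G x‖ₑ ^ 2 ∂μ) * ∫⁻ x, (‖G x‖ₑ ^ 2) ^ 2 ∂μ := h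
      _ ≤ ENNReal.ofReal (n0 ^ 2) * ENNReal.ofReal (n0 * (100 * n1) ^ 3) := by
          simp_rw [← pow_mul]
          gcongr
      _ = ENNReal.ofReal (100 ^ 3 * (n0 ^ 3 * n1 ^ 3)) := by
          rw [← ENNReal.ofReal_mul (by positivity)]
          congr 1
          ring
      _ ≤ ENNReal.ofReal (c ^ 6 * (n0 ^ 3 * n1 ^ 3)) := by
          gcongr
          exact le_trans (by norm_num) hc6
      _ = _ := by
          congr 1
          calc c ^ 6 * (n0 ^ 3 * n1 ^ 3)
              = c ^ 6 * (((n0 ^ (1 / 2 : ℝ)) ^ 2) ^ 3 * ((n1 ^ (1 / 2 : ℝ)) ^ 2) ^ 3) := by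
                rw [r n0 hn0, r n1 hn1]
            _ = _ := by ring
  have rp : ∀ (x : ℝ) (a : ℝ) (k : ℕ), 0 ≤ x → (x ^ a) ^ k = x ^ (a * k) := fun x a k hx => by
    rw [Real.rpow_mul hx, Real.rpow_natCast]
  refine ⟨?_, ?_, ?_⟩
  · exact_mod_cast eLpNorm_le_of_lintegral_pow_le (n := 3) (by norm_num) (by positivity) i3
  · refine mod_cast eLpNorm_le_of_lintegral_pow_le (n := 4) (by norm_num) (by positivity)
      (i4.trans (ENNReal.ofReal_le_ofReal ?_))
    have e0 : (n0 ^ (1 / 4 : ℝ)) ^ 4 = n0 := by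
      rw [rp _ _ _ hn0]
      norm_num
    have e1 : (n1 ^ (3 / 4 : ℝ)) ^ 4 = n1 ^ 3 := by
      rw [rp _ _ _ hn1, ← Real.rpow_natCast]
      norm_num
    have e : (c * n0 ^ (1 / 4 : ℝ) * n1 ^ (3 / 4 : ℝ)) ^ 4 = c ^ 4 * (n0 * n1 ^ 3) := by
      rw [mul_pow, mul_pow, e0, e1, mul_assoc]
    rw [e]
    have hc4 : (100 : ℝ) ^ 4 ≤ c ^ 4 := by gcongr
    have : (100 : ℝ) ^ 3 ≤ c ^ 4 := le_trans (by norm_num) hc4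
    calc n0 * (100 * n1) ^ 3 = 100 ^ 3 * (n0 * n1 ^ 3) := by ring
      _ ≤ c ^ 4 * (n0 * n1 ^ 3) := by gcongr
  · refine mod_cast eLpNorm_le_of_lintegral_pow_le (n := 6) (by norm_num) (by positivity)
      (i6.trans (ENNReal.ofReal_le_ofReal ?_))
    gcongr

end NSAlpha

theorem theorem3p2 :
    ∃ c : ℝ, 0 < c ∧ IsGagliardoNirenbergConst c ∧
      ∀ (L ν α β η h c₁ c₂ : ℝ), 0 < L → 0 < ν → 0 < α → 0 < β → 0 < h → 0 < c₁ → 0 < c₂ →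
      ∀ (f : ℝ → FourierField), LinftyH L f →
      ∀ (Ih : FourierField →ₗ[ℝ] FourierField), IsInterpolant L h c₁ c₂ Ih →
      ∀ (u₀ w₀ : FourierField), MemVdot 1 u₀ → MemVdot 1 w₀ →
      ∀ (u w : ℝ → FourierField),
        IsSolution L ν α f u₀ u →
        IsSolution L ν β (nudgedForce L β η Ih f u w) w₀ w →
        η > 576 * c ^ 8 * M1 L ν α f u₀ ^ 2 / (α ^ 4 * ν ^ 3) →
        η * c₁ * h ^ 2 + η ^ 2 * c₁ * β ^ 2 * h ^ 2 / ν
            + 432 * c ^ 8 * β ^ 2 * M1 L ν α f u₀ ^ 2 / (ν ^ 3 * α ^ 4) - η * β ^ 2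
          < 11 * ν / 16 →
        η * c₂ * h ^ 4 + η ^ 2 * β ^ 2 * c₂ * h ^ 4 / ν < ν / 4 * β ^ 2 →
        ∀ t : ℝ, 0 ≤ t →
          sobSq L 0 (w t - u t) + β ^ 2 * sobSq L 1 (w t - u t)
            ≤ Real.exp (-(lambda1 L * ν / 2) * t)
                * (sobSq L 0 (w 0 - u 0) + β ^ 2 * sobSq L 1 (w 0 - u 0))
              + 2 * Real.exp 1 / (Real.exp (1 / 2) - 1) * (|β ^ 2 - α ^ 2| ^ 2 / β ^ 2)
                * M3 c ν α (M1 L ν α f u₀) (supForce L f) (lambda1 L) := by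
  have hc1 : 1 ≤ triConst := by
    unfold triConst
    norm_num
  -- a power `c⁸` is what the hypotheses on `η` and `h` offer to dominate `triConst`
  have hc8 : triConst ≤ ((triConst + 100) ^ 4) ^ 2 := by
    rw [← pow_mul]
    exact (by linarith : triConst ≤ triConst + 100).trans
      (le_self_pow₀ (by linarith) (by norm_num))
  refine ⟨triConst + 100, by linarith, isGagliardoNirenbergConst_of_le (by linarith), ?_⟩
  intro L ν α β η h c₁ c₂ hL hν hα hβ _ _ _ f hf Ih hI u₀ w₀ _ _ u w hu hw h1 h2 h3 t ht
  have hmain := error_le hc8 hL hν hα hβ hf hI hu hw h1 h2 h3 ht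
  rw [sq_abs]
  refine hmain.trans ?_
  have hM3 : 0 ≤ M3 (triConst + 100) ν α (M1 L ν α f u₀) (supForce L f) (lambda1 L) :=
    M3_nonneg hν (lambda1_pos hL) (M1_nonneg hL ν α f u₀) (supForce_nonneg L f)
  have h4 := four_le_exp_factor
  unfold energy
  gcongr
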